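/- **Setting.** Latent Dirichlet allocation with $D\ge1$ documents of $N\ge1$ words, $K$ topics and a vocabulary of size $V$. The parameter is $\theta=(\gamma,\beta)$, with topic proportions $\gamma_d$ in the simplex of $\mathbb R^K$ ($d\le D$) and topics $\beta_k$ in the simplex of $\mathbb R^V$ ($k\le K$). Independently over $d\le D$, $n\le N$: $z_{dn}\sim\mathrm{multi}(\gamma_d)$, and $w_{dn}\mid z_{dn}\sim\mathrm{multi}(\beta_{z_{dn}})$. The data are $Y=(Y_1,\dots,Y_N)$ with $Y_n=(w_{dn})_{d\le D}$, the latent variables are $S=(z_{dn})$, and $p(\cdot\mid\theta)=\prod_{d}p_d(\cdot\mid\theta)$, $p_d(v\mid\theta)=\sum_k\gamma_{dk}\beta_{kv}$, is the probability mass function of a single $Y_n$. The prior $p_\theta$ makes all $\gamma_d\sim\mathrm{Dir}_K(K^{-c},\dots,K^{-c})$ and $\beta_k\sim\mathrm{Dir}_V(V^{-c},\dots,V^{-c})$ independent, with $c>1$ fixed. For $\alpha\in(0,1)$, the $\alpha$-VB solution is any global minimiser $(\hat q_\theta,\hat q_S)$ of $$\Psi_\alpha(q_\theta,q_S)=-\int\log\frac{p(Y\mid\theta)}{p(Y\mid\theta^\ast)}\,q_\theta(d\theta)+\Delta_J(q_\theta,q_S)+\alpha^{-1}D(q_\theta\,\|\,p_\theta),$$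 $$\Delta_J(q_\theta,q_S)=\int\Big[\log p(Y\mid\theta)-\sum_{S}q_S(S)\log\frac{p(Y,S\mid\theta)}{q_S(S)}\Big]q_\theta(d\theta),$$ over the mean-field family $q_\theta=\prod_d q_{\gamma_d}\prod_kq_{\beta_k}$, $q_S=\prod_{d,n}q_{z_{dn}}$, whose factors $q_{\gamma_d}$, $q_{\beta_k}$ are arbitrary probability densities on the simplices and whose $q_{z_{dn}}$ are arbitrary probability vectors. Here $D(\cdot\|\cdot)$ is the Kullback–Leibler divergence. Let $D_\alpha(p\|q)=\frac1{\alpha-1}\log\sum_y p(y)^\alpha q(y)^{1-\alpha}$ (Rényi divergence) and $h^2(p\|q)=\sum_y(\sqrt{p(y)}-\sqrt{q(y)})^2$ (squared Hellinger distance). **Assumption S** (with constant $\delta_0>0$). The data come from a true parameter $\theta^\ast=(\gamma^\ast,\beta^\ast)$; each $\gamma_d^\ast$ has at most $e_d$ nonzero entries, each $\beta_k^\ast$ has at most $d_k$ nonzero entries, and all nonzero entries of $\gamma_d^\ast$ and $\beta_k^\ast$ are at least $\delta_0$. **Statement.** Let $c>1$ and $\delta_0>0$. There are constants $A,C>0$,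 depending only on $c$ and $\delta_0$, such that the following holds for every $\alpha\in(0,1)$. 1. Let $D,N\ge1$, $K,V$ be arbitrary and let Assumption S hold. For all $\varepsilon_{\gamma_1},\dots,\varepsilon_{\gamma_D},\varepsilon_{\beta_1},\dots,\varepsilon_{\beta_K}\in(0,1)$, with probability at least $$1-\frac{C}{N\sum_{d=1}^D\varepsilon_{\gamma_d}^2+N\sum_{k=1}^K\varepsilon_{\beta_k}^2}$$ every $\alpha$-VB solution satisfies $$\int \frac1D\,D_\alpha\big[p(\cdot\mid\theta)\,\|\,p(\cdot\mid\theta^\ast)\big]\,\hat q_\theta(d\theta)\le A\Big(\frac{\alpha}{1-\alpha}\Big\{\frac1D\sum_{d=1}^D\varepsilon_{\gamma_d}^2+\frac1D\sum_{k=1}^K\varepsilon_{\beta_k}^2\Big\}+\frac1{N(1-\alpha)}\Big\{\frac1D\sum_{d=1}^De_d\log\frac K{\varepsilon_{\gamma_d}}+\frac1D\sum_{k=1}^Kd_k\log\frac V{\varepsilon_{\beta_k}}\Big\}\Big).$$ 2. Let $D$, $K$, $V$, $\theta^\ast$, $e_d$, $d_k$ vary with $N$ in such a way that $D\ge1$ and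 Assumption S holds (with the same $\delta_0$) for every $N$. If $\big(\sum_{d=1}^De_d+\sum_{k=1}^Kd_k\big)/(DN)\to0$ as $N\to\infty$, then with probability tending to one as $N\to\infty$ every $\alpha$-VB solution satisfies $$\Big\{\int \frac1D\,h^2\big[p(\cdot\mid\theta)\,\|\,p(\cdot\mid\theta^\ast)\big]\,\hat q_\theta(d\theta)\Big\}^{1/2}\le A\sqrt{\frac{\sum_{d=1}^De_d}{DN\min\{\alpha,1-\alpha\}}\log(DKN)+\frac{\sum_{k=1}^Kd_k}{DN\min\{\alpha,1-\alpha\}}\log(KVN)}.$$ -/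

import Mathlib

open MeasureTheory Filter Topology
open scoped ENNReal

namespace LDA

/-- The symmetric Dirichlet distribution with concentration `η` on the probability simplex of
`ℝ^m`: the law of `(g_i / ∑ j, g_j)_i` for i.i.d. `g_j ~ Gamma(η, 1)`. -/
noncomputable def dirichlet (m : ℕ) (η : ℝ) : Measure (Fin m → ℝ) :=
  (Measure.pi fun _ : Fin m => ProbabilityTheory.gammaMeasure η 1).map
    fun g i => g i / ∑ j, g j

/-- A parameter `θ = (γ, β)`: topic proportions `γ_d ∈ ℝ^K` of the documents `d`, and topics
`β_k ∈ ℝ^V` (distributions over words). -/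
abbrev Param (D K V : ℕ) : Type := (Fin D → Fin K → ℝ) × (Fin K → Fin V → ℝ)

/-- Words `w_{dn}`, as `Y n d`: the `n`-th observation `Y n` holds the `n`-th word of every
document. -/
abbrev Words (D V N : ℕ) : Type := Fin N → Fin D → Fin V

/-- Topic assignments `z_{dn}`, as `S n d`. -/
abbrev Topics (D K N : ℕ) : Type := Fin N → Fin D → Fin K

/-- `p(S ∣ θ)`: independently, `z_{dn} ~ multi(γ_d)`. -/
def latentProb {D K V N : ℕ} (θ : Param D K V) (S : Topics D K N) : ℝ :=
  ∏ n, ∏ d, θ.1 d (S n d)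

/-- `p(Y ∣ S, θ)`: given `S`, independently, `w_{dn} ~ multi(β_{z_{dn}})`. -/
def condLik {D K V N : ℕ} (θ : Param D K V) (Y : Words D V N) (S : Topics D K N) : ℝ :=
  ∏ n, ∏ d, θ.2 (S n d) (Y n d)

/-- The likelihood `p(Y ∣ θ)` of all the words. -/
noncomputable def lik {D K V N : ℕ} (θ : Param D K V) (Y : Words D V N) : ℝ :=
  ∑ S : Topics D K N, condLik θ Y S * latentProb θ S

/-- The distribution of the data under `θ`, with probability mass function `p(· ∣ θ)`. -/
noncomputable def dataLaw {D K V : ℕ} (N : ℕ) (θ : Param D K V) : Measure (Words D V N) :=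
  ∑ Y : Words D V N, ENNReal.ofReal (lik θ Y) • Measure.dirac Y

/-- The probability mass function `p(· ∣ θ) = ∏_d p_d(· ∣ θ)` of one observation, which consists of
one word of each of the `D` documents, where `p_d(v ∣ θ) = ∑_k γ_{dk} β_{kv}`. -/
def obsPMF {D K V : ℕ} (θ : Param D K V) (y : Fin D → Fin V) : ℝ :=
  ∏ d, ∑ k, θ.1 d k * θ.2 k (y d)

/-- The prior: independent `γ_d ~ Dir_K(1 / K^c)` and `β_k ~ Dir_V(1 / V^c)`. -/
noncomputable def prior (c : ℝ) (D K V : ℕ) : Measure (Param D K V) :=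
  (Measure.pi fun _ : Fin D => dirichlet K (1 / (K : ℝ) ^ c)).prod
    (Measure.pi fun _ : Fin K => dirichlet V (1 / (V : ℝ) ^ c))

/-- The mean-field variational family: independent factors `q_{γ_d}`, `q_{β_k}` and `q_{z_{dn}}`.
A Dirichlet distribution has a density that is positive on the interior of the simplex, so absolute
continuity with respect to it says that the factor has a density on the simplex. -/
structure MeanField (c : ℝ) (D K V N : ℕ) where
  qγ : Fin D → Measure (Fin K → ℝ)
  qβ : Fin K → Measure (Fin V → ℝ)
  qz : Fin N → Fin D → Fin K → ℝ
  prob_γ : ∀ d, IsProbabilityMeasure (qγ d)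
  prob_β : ∀ k, IsProbabilityMeasure (qβ k)
  ac_γ : ∀ d, qγ d ≪ dirichlet K (1 / (K : ℝ) ^ c)
  ac_β : ∀ k, qβ k ≪ dirichlet V (1 / (V : ℝ) ^ c)
  mem_z : ∀ n d, qz n d ∈ stdSimplex ℝ (Fin K)

/-- The distribution `q_θ` of the parameter. -/
noncomputable def MeanField.qθ {c : ℝ} {D K V N : ℕ} (q : MeanField c D K V N) :
    Measure (Param D K V) :=
  (Measure.pi q.qγ).prod (Measure.pi q.qβ)

/-- The probability mass function `q_S` of the topic assignments. -/
def MeanField.qS {c : ℝ} {D K V N : ℕ} (q : MeanField c D K V N) (S : Topics D K N) : ℝ :=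
  ∏ n, ∏ d, q.qz n d (S n d)

/-- `-log p(Y ∣ θ)`, with value `∞` where the likelihood vanishes. -/
noncomputable def negLogLik {D K V N : ℕ} (Y : Words D V N) (θ : Param D K V) : ℝ≥0∞ :=
  if lik θ Y ≤ 0 then ∞ else ENNReal.ofReal (-Real.log (lik θ Y))

open scoped Classical in
/-- The Jensen gap
`log p(Y ∣ θ) - ∑ S, q_S(S) log (p(Y ∣ S, θ) p(S ∣ θ) / q_S(S)) ≥ 0` at `θ`, which is `∞` if `q_S`
charges an assignment `S` with `p(Y ∣ S, θ) p(S ∣ θ) = 0`. -/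
noncomputable def jensenGap {D K V N : ℕ} (Y : Words D V N) (qS : Topics D K N → ℝ)
    (θ : Param D K V) : ℝ≥0∞ :=
  if ∀ S, qS S ≠ 0 → condLik θ Y S * latentProb θ S ≠ 0 then
    ENNReal.ofReal (Real.log (lik θ Y) -
      ∑ S, qS S * Real.log (condLik θ Y S * latentProb θ S / qS S))
  else ∞

/-- The `α`-VB objective
`-∫ log (p(Y ∣ θ) / p(Y ∣ θ⋆)) dq_θ + Δ_J(q_θ, q_S) + α⁻¹ D(q_θ ‖ p_θ)`, with values in
`(-∞, ∞]`; the likelihood of the data under the truth `θ⋆` is a constant in it. -/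
noncomputable def objective {c : ℝ} {D K V N : ℕ} (α : ℝ) (θs : Param D K V) (Y : Words D V N)
    (q : MeanField c D K V N) : EReal :=
  ((∫⁻ θ, negLogLik Y θ ∂q.qθ + ∫⁻ θ, jensenGap Y q.qS θ ∂q.qθ
    + ENNReal.ofReal α⁻¹ * InformationTheory.klDiv q.qθ (prior c D K V) : ℝ≥0∞) : EReal)
    + (Real.log (lik θs Y) : EReal)

/-- `q` is an `α`-VB solution: a global minimiser of the objective over the mean-field family. -/
def IsAlphaVB {c : ℝ} {D K V N : ℕ} (α : ℝ) (θs : Param D K V) (Y : Words D V N)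
    (q : MeanField c D K V N) : Prop :=
  ∀ r : MeanField c D K V N, objective α θs Y q ≤ objective α θs Y r

/-- The Rényi divergence `D_α(p ‖ q) = (α - 1)⁻¹ log ∑ p^α q^(1-α)` of probability mass functions,
for `0 < α < 1`; it is `∞` if `p` and `q` have disjoint supports. -/
noncomputable def renyiDiv {ι : Type*} [Fintype ι] (α : ℝ) (p q : ι → ℝ) : ℝ≥0∞ :=
  if ∑ i, p i ^ α * q i ^ (1 - α) ≤ 0 then ∞
  else ENNReal.ofReal (1 / (α - 1) * Real.log (∑ i, p i ^ α * q i ^ (1 - α)))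

/-- The squared Hellinger distance `∑ (√p - √q)²`. -/
noncomputable def hellingerSq {ι : Type*} [Fintype ι] (p q : ι → ℝ) : ℝ :=
  ∑ i, (Real.sqrt (p i) - Real.sqrt (q i)) ^ 2

/-- Sparsity and regularity of the truth `θ⋆ = (γ⋆, β⋆)`: the `γ⋆_d` and the `β⋆_k` are probability
vectors, `γ⋆_d` is `e_d`-sparse, `β⋆_k` is `s_k`-sparse, and all nonzero entries are at least
`δ₀`. -/
structure AssumptionS {D K V : ℕ} (δ₀ : ℝ) (θs : Param D K V) (e : Fin D → ℕ) (s : Fin K → ℕ) :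
    Prop where
  simplex_γ : ∀ d, θs.1 d ∈ stdSimplex ℝ (Fin K)
  simplex_β : ∀ k, θs.2 k ∈ stdSimplex ℝ (Fin V)
  sparse_γ : ∀ d, {k | θs.1 d k ≠ 0}.ncard ≤ e d
  sparse_β : ∀ k, {v | θs.2 k v ≠ 0}.ncard ≤ s k
  lower_γ : ∀ d k, θs.1 d k ≠ 0 → δ₀ ≤ θs.1 d k
  lower_β : ∀ k v, θs.2 k v ≠ 0 → δ₀ ≤ θs.2 k v

end LDA

/-! The proof has a variational half and a sampling half; they meet in one inequality for `∫ -log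
lik dq_θ`.

Variational half. The minimiser is compared with one explicit mean-field member: the prior truncated
to a one-sided neighbourhood of the truth `θs`, times the exact topic posterior under `θs`.
One-sided closeness (each entry loses at most a factor `exp (-ε²)`) is all that a lower bound on the
joint likelihood requires, and the exact posterior makes the Jensen gap vanish at `θs` itself. The
Kullback–Leibler cost of truncation is minus the log of the prior mass (`klDiv_cond`), and the
Dirichlet prior charges the neighbourhood of an `e`-sparse vector with at least `exp (-C e log
(m/ε))` (`exists_dirichlet_mass_ge`). The obstacle is that the loss in `β_k` is weighted by the
expected number of words assigned to topic `k`, which may reach `D N` rather than `N`. For heavy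
topics the radius is therefore replaced by a weighted geometric mean of the document radii
(`exists_radius`). Summed over topics, both the squared radii and their logarithms are then paid for
by the document terms, because each document has total weight `N` and each topic has at most `1/δ`
supported words.

Sampling half. The log-likelihood ratio is bounded simultaneously for all interior `θ` by a function
of the data alone. For a sample of size `M` from `q`, half of the expected counts yields, by Jensen,
`M/2` times the log affinity `log ∑ p^α q^(1-α)`. Maximising the remaining part over `p` leaves
Pearson's statistic (`mul_sum_log_sub_log_affinity_le_chiSq`). Its second moment is bounded in terms
of `δ` alone, so Chebyshev over the `D` documents gives a total of order `max (N r) D`, with `r` the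
sum of squared radii. If `K, V ≥ 2` the complexity term dominates `D + K`. If `K = 1` all words are
pooled into one sample; if `V = 1` nothing is random.

Since the likelihood ratio bound is uniform in `θ`, integrating it against the minimiser gives the
Rényi risk bound (`exists_renyi_risk_le`). The Hellinger bound follows from `min α (1-α) · h² ≤ 1 -
affinity`, with every radius equal to `√(log N / N)`. -/

namespace LDA

/-! ### Small-ball mass of the sparse Dirichlet prior -/

section Dirichlet

open ProbabilityTheory Set

/-- Convexity of `Γ` between `Γ 1 = Γ 2 = 1` gives `Γ (η + 1) ≤ 1`, and `Γ (η + 1) = η Γ η`. -/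
theorem Gamma_le_inv {η : ℝ} (h0 : 0 < η) (h1 : η ≤ 1) : Real.Gamma η ≤ η⁻¹ := by
  have h := Real.convexOn_Gamma.2 (show (1 : ℝ) ∈ Ioi 0 by simp) (show (2 : ℝ) ∈ Ioi 0 by simp)
    (sub_nonneg.2 h1) h0.le (by ring)
  simp only [smul_eq_mul, Real.Gamma_one, Real.Gamma_two] at h
  rw [show (1 - η) * 1 + η * 2 = η + 1 by ring, Real.Gamma_add_one h0.ne'] at h
  rw [le_inv_comm₀ (Real.Gamma_pos_of_pos h0) h0, ← one_div, le_div_iff₀ (Real.Gamma_pos_of_pos h0)]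
  linarith

theorem le_inv_Gamma {η : ℝ} (h0 : 0 < η) (h1 : η ≤ 1) : η ≤ 1 / Real.Gamma η := by
  rw [one_div, le_inv_comm₀ h0 (Real.Gamma_pos_of_pos h0)]
  exact Gamma_le_inv h0 h1

/-- On `(0, 2]` the density is at least `(η / 2) exp (-2)`: the exponent `η - 1` lies in `(-1, 0]`,
so the power is at least `1/2`, and `1 / Γ η ≥ η`. The factor `η` is the price of a supported
coordinate. -/
theorem gammaMeasure_Icc_ge {η a b : ℝ} (h0 : 0 < η) (h1 : η ≤ 1) (ha : 0 < a) (hb : b ≤ 2) :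
    ENNReal.ofReal (η / 2 * Real.exp (-2) * (b - a)) ≤ gammaMeasure η 1 (Icc a b) := by
  rw [gammaMeasure, withDensity_apply _ measurableSet_Icc]
  calc ENNReal.ofReal (η / 2 * Real.exp (-2) * (b - a))
      = ∫⁻ _ in Icc a b, ENNReal.ofReal (η / 2 * Real.exp (-2)) := by
        rw [setLIntegral_const, Real.volume_Icc, ENNReal.ofReal_mul (by positivity)]
    _ ≤ ∫⁻ x in Icc a b, gammaPDF η 1 x := by
        refine setLIntegral_mono' measurableSet_Icc fun x hx => ?_
        have hx0 : 0 < x := ha.trans_le hx.1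
        rw [gammaPDF_of_nonneg hx0.le]
        refine ENNReal.ofReal_le_ofReal ?_
        rw [Real.one_rpow, one_mul]
        have hp : 1 / 2 ≤ x ^ (η - 1) := by
          calc (1 / 2 : ℝ) = 2 ^ (-1 : ℝ) := by rw [Real.rpow_neg_one]; norm_num
            _ ≤ 2 ^ (η - 1) := Real.rpow_le_rpow_of_exponent_le (by norm_num) (by linarith)
            _ ≤ x ^ (η - 1) :=
              Real.rpow_le_rpow_of_nonpos hx0 (hx.2.trans hb) (by linarith)
        have he : Real.exp (-2) ≤ Real.exp (-x) := Real.exp_le_exp.2 (by linarith [hx.2])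
        have hG := le_inv_Gamma h0 h1
        calc η / 2 * Real.exp (-2) = η * (1 / 2) * Real.exp (-2) := by ring
          _ ≤ _ := by gcongr

/-- The factor `η` from `1 / Γ η` cancels against `∫ x ^ (η - 1) = u ^ η / η`. What remains is close
to `1` when `η` is small, so coordinates off the support cost almost nothing. -/
theorem gammaMeasure_Icc_zero_ge {η u : ℝ} (h0 : 0 < η) (h1 : η ≤ 1) (hu : 0 < u) :
    ENNReal.ofReal (Real.exp (-u) * u ^ η) ≤ gammaMeasure η 1 (Icc 0 u) := by
  have hint : IntegrableOn (fun x : ℝ => x ^ (η - 1)) (Ioc 0 u) := by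
    have := intervalIntegral.intervalIntegrable_rpow' (a := 0) (b := u) (r := η - 1) (by linarith)
    rwa [intervalIntegrable_iff_integrableOn_Ioc_of_le hu.le] at this
  have hval : ∫ x in Ioc 0 u, x ^ (η - 1) = u ^ η / η := by
    rw [← intervalIntegral.integral_of_le hu.le, integral_rpow (Or.inl (by linarith))]
    simp [Real.zero_rpow h0.ne']
  rw [gammaMeasure, withDensity_apply _ measurableSet_Icc]
  calc ENNReal.ofReal (Real.exp (-u) * u ^ η)
      = ∫⁻ x in Ioc 0 u, ENNReal.ofReal (η * Real.exp (-u) * x ^ (η - 1)) := by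
        rw [← ofReal_integral_eq_lintegral_ofReal]
        · rw [integral_const_mul, hval]; congr 1; field_simp
        · exact hint.const_mul _
        · refine (ae_restrict_iff' measurableSet_Ioc).2 (ae_of_all _ fun x hx => ?_)
          have : 0 < x := hx.1
          simp only [Pi.zero_apply]; positivity
    _ ≤ ∫⁻ x in Ioc 0 u, gammaPDF η 1 x := by
        refine setLIntegral_mono' measurableSet_Ioc fun x hx => ?_
        have hx0 : 0 < x := hx.1
        rw [gammaPDF_of_nonneg hx0.le]
        refine ENNReal.ofReal_le_ofReal ?_
        rw [Real.one_rpow, one_mul]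
        have he : Real.exp (-u) ≤ Real.exp (-x) := Real.exp_le_exp.2 (by linarith [hx.2])
        have hG := le_inv_Gamma h0 h1
        calc η * Real.exp (-u) * x ^ (η - 1) = η * x ^ (η - 1) * Real.exp (-u) := by ring
          _ ≤ _ := by gcongr
    _ ≤ _ := lintegral_mono_set Ioc_subset_Icc_self

theorem ae_gammaMeasure_pos (η : ℝ) : ∀ᵐ x ∂gammaMeasure η 1, 0 < x := by
  have h1 : ∀ᵐ x ∂gammaMeasure η 1, x ≠ 0 :=
    (withDensity_absolutelyContinuous _ _).ae_le (Measure.ae_ne volume 0)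
  have h2 : ∀ᵐ x ∂gammaMeasure η 1, 0 ≤ x := by
    rw [ae_iff, gammaMeasure]
    have : {x : ℝ | ¬ 0 ≤ x} = Iio 0 := by ext; simp
    rw [this, withDensity_apply _ measurableSet_Iio]
    exact lintegral_gammaPDF_of_nonpos le_rfl
  filter_upwards [h1, h2] with x h h' using lt_of_le_of_ne h' h.symm

theorem measurable_normalize (m : ℕ) :
    Measurable fun (g : Fin m → ℝ) (i : Fin m) => g i / ∑ j, g j := by
  fun_prop

instance isProbabilityMeasure_gamma_inv_rpow (m : ℕ) [NeZero m] (c : ℝ) :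
    IsProbabilityMeasure (gammaMeasure (1 / (m : ℝ) ^ c) 1) :=
  isProbabilityMeasure_gammaMeasure
    (by have : (0 : ℝ) < m := by exact_mod_cast Nat.pos_of_ne_zero (NeZero.ne m)
        positivity) one_pos

instance isProbabilityMeasure_dirichlet (m : ℕ) [NeZero m] (c : ℝ) :
    IsProbabilityMeasure (dirichlet m (1 / (m : ℝ) ^ c)) :=
  Measure.isProbabilityMeasure_map (measurable_normalize m).aemeasurable

theorem ae_dirichlet (m : ℕ) [NeZero m] (c : ℝ) :
    ∀ᵐ x ∂dirichlet m (1 / (m : ℝ) ^ c), (∀ i, 0 < x i) ∧ ∑ i, x i = 1 := by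
  have hs : MeasurableSet {x : Fin m → ℝ | (∀ i, 0 < x i) ∧ ∑ i, x i = 1} := by
    measurability
  rw [dirichlet, ae_map_iff (measurable_normalize m).aemeasurable hs]
  have : ∀ᵐ g ∂(Measure.pi fun _ : Fin m => gammaMeasure (1 / (m : ℝ) ^ c) 1),
      ∀ i, 0 < g i := by
    rw [ae_all_iff]
    exact fun i => Measure.tendsto_eval_ae_ae.eventually (ae_gammaMeasure_pos _)
  filter_upwards [this] with g hg
  have hS : 0 < ∑ j, g j := Finset.sum_pos (fun i _ => hg i) Finset.univ_nonempty
  refine ⟨fun i => div_pos (hg i) hS, ?_⟩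
  rw [← Finset.sum_div, div_self hS.ne']

/-- The box is dimensioned so that the total mass of `g` is between `1` and `1 + t`; normalising
then divides by at most `1 + t ≤ exp t`. -/
theorem le_div_sum_of_mem_box {m : ℕ} {xs g : Fin m → ℝ} {t : ℝ}
    (hxs : xs ∈ stdSimplex ℝ (Fin m))
    (hg : ∀ i, xs i ≤ g i ∧ g i ≤ xs i * (1 + t / 2) + t / (2 * m)) (i : Fin m) :
    xs i * Real.exp (-t) ≤ g i / ∑ j, g j := by
  have hm : (0 : ℝ) < m := by exact_mod_cast i.pos
  have h1 : 1 ≤ ∑ j, g j := hxs.2 ▸ Finset.sum_le_sum fun j _ => (hg j).1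
  have h2 : ∑ j, g j ≤ 1 + t := by
    calc ∑ j, g j ≤ ∑ j, (xs j * (1 + t / 2) + t / (2 * m)) :=
          Finset.sum_le_sum fun j _ => (hg j).2
      _ = 1 + t := by
        rw [Finset.sum_add_distrib, ← Finset.sum_mul, hxs.2, Finset.sum_const, Finset.card_univ,
          Fintype.card_fin, nsmul_eq_mul]
        field_simp; ring
  have h3 : Real.exp (-t) ≤ 1 / ∑ j, g j := by
    rw [Real.exp_neg, ← one_div]
    exact one_div_le_one_div_of_le (by linarith) (by linarith [Real.add_one_le_exp t])
  calc xs i * Real.exp (-t) ≤ g i * (1 / ∑ j, g j) :=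
        mul_le_mul (hg i).1 h3 (Real.exp_pos _).le ((hxs.1 i).trans (hg i).1)
    _ = _ := by ring

/-- The interval has length at least `δ ε² / 2` and the density is of order `m ^ (-c)`, so minus the
log of the mass is at most `c log m - 2 log ε` plus a constant. Since `m ≥ 2`, the constant is
absorbed as a multiple of `log m / log 2`. -/
theorem exp_le_gammaMeasure_Icc {c δ : ℝ} (hδ1 : δ ≤ 1) {m : ℕ} (hc : 1 < c) (hδ : 0 < δ)
    (hm : 2 ≤ m) {x ε : ℝ} (hx : δ ≤ x) (hx1 : x ≤ 1) (hε : 0 < ε) (hε1 : ε < 1) :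
    ENNReal.ofReal (Real.exp (-((c + 2 + (2 + Real.log (4 / δ)) / Real.log 2) *
      Real.log (m / ε)))) ≤
    gammaMeasure (1 / (m : ℝ) ^ c) 1 (Icc x (x * (1 + ε ^ 2 / 2))) := by
  have hm2 : (2 : ℝ) ≤ m := by exact_mod_cast hm
  have hm0 : (0 : ℝ) < m := by linarith
  have hlm : Real.log 2 ≤ Real.log m := Real.log_le_log (by norm_num) hm2
  have hl2 : 0 < Real.log 2 := Real.log_pos (by norm_num)
  have hle : Real.log ε < 0 := Real.log_neg hε hε1
  have hL : 0 ≤ 2 + Real.log (4 / δ) := by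
    have : 0 ≤ Real.log (4 / δ) := Real.log_nonneg (by rw [le_div_iff₀ hδ]; linarith)
    linarith
  have hmc : 1 ≤ (m : ℝ) ^ c := Real.one_le_rpow (by linarith) (by linarith)
  have hε2 : ε ^ 2 < 1 := by nlinarith
  refine le_trans (ENNReal.ofReal_le_ofReal ?_) (gammaMeasure_Icc_ge (by positivity)
    (by rw [div_le_one (by positivity)]; exact hmc) (hδ.trans_le hx) (by nlinarith))
  calc Real.exp (-((c + 2 + (2 + Real.log (4 / δ)) / Real.log 2) * Real.log (m / ε)))
      ≤ Real.exp (-(c * Real.log m) + 2 * Real.log ε - (2 + Real.log (4 / δ))) := by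
        rw [Real.exp_le_exp, Real.log_div hm0.ne' hε.ne']
        have h1 : 2 + Real.log (4 / δ) ≤ (2 + Real.log (4 / δ)) / Real.log 2 *
            (Real.log m - Real.log ε) := by
          rw [div_mul_eq_mul_div, le_div_iff₀ hl2]
          exact mul_le_mul_of_nonneg_left (by linarith) hL
        have h2 : c * Real.log ε ≤ 0 := mul_nonpos_of_nonneg_of_nonpos (by linarith) hle.le
        linarith
    _ = 1 / (m : ℝ) ^ c / 2 * Real.exp (-2) * (δ * (ε ^ 2 / 2)) := by
        rw [Real.log_div (by norm_num) hδ.ne', show (4 : ℝ) = 2 * 2 by norm_num,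
          Real.log_mul (by norm_num) (by norm_num), Real.rpow_def_of_pos hm0,
          show -(c * Real.log m) + 2 * Real.log ε - (2 + (Real.log 2 + Real.log 2 - Real.log δ))
            = -(Real.log m * c) + (Real.log ε + Real.log ε) + -2 + - Real.log 2 + - Real.log 2
              + Real.log δ by ring]
        simp only [Real.exp_add, Real.exp_neg, Real.exp_log hε, Real.exp_log hδ,
          Real.exp_log two_pos]
        field_simp
    _ ≤ _ := by
        rw [show x * (1 + ε ^ 2 / 2) - x = x * (ε ^ 2 / 2) by ring]
        gcongr

/-- The concentration is at most `1/m`, so each null coordinate costs only `O(log (m/ε) / m)`, and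
all of them together `O(log (m/ε))`. -/
theorem exp_le_gammaMeasure_Icc_zero {c : ℝ} {m : ℕ} (hc : 1 < c)
    (hm : 2 ≤ m) {ε : ℝ} (hε : 0 < ε) (hε1 : ε < 1) :
    ENNReal.ofReal (Real.exp (-(4 * Real.log (m / ε) / m))) ≤
    gammaMeasure (1 / (m : ℝ) ^ c) 1 (Icc 0 (ε ^ 2 / (2 * m))) := by
  have hm2 : (2 : ℝ) ≤ m := by exact_mod_cast hm
  have hm0 : (0 : ℝ) < m := by linarith
  have hlm : Real.log 2 ≤ Real.log m := Real.log_le_log (by norm_num) hm2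
  have hl2 := Real.log_two_gt_d9
  have hl2' := Real.log_two_lt_d9
  have hle : Real.log ε < 0 := Real.log_neg hε hε1
  have hmc : (m : ℝ) ≤ (m : ℝ) ^ c := by
    conv_lhs => rw [← Real.rpow_one (m : ℝ)]
    exact Real.rpow_le_rpow_of_exponent_le (by linarith) hc.le
  have hu : 0 < ε ^ 2 / (2 * m) := by positivity
  refine le_trans (ENNReal.ofReal_le_ofReal ?_) (gammaMeasure_Icc_zero_ge (by positivity)
    (by rw [div_le_one (by positivity)]; linarith) hu)
  rw [Real.rpow_def_of_pos hu, ← Real.exp_add, Real.exp_le_exp]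
  have hη : 1 / (m : ℝ) ^ c ≤ 1 / m := one_div_le_one_div_of_le hm0 hmc
  have hη0 : 0 < 1 / (m : ℝ) ^ c := by positivity
  have hlu : Real.log (ε ^ 2 / (2 * m)) = 2 * Real.log ε - Real.log 2 - Real.log m := by
    rw [Real.log_div (by positivity) (by positivity), Real.log_pow,
      Real.log_mul two_ne_zero hm0.ne']
    push_cast; ring
  have hlu0 : Real.log (ε ^ 2 / (2 * m)) ≤ 0 := by rw [hlu]; linarith
  have h1 : Real.log (ε ^ 2 / (2 * m)) * (1 / m) ≤
      Real.log (ε ^ 2 / (2 * m)) * (1 / (m : ℝ) ^ c) :=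
    mul_le_mul_of_nonpos_left hη hlu0
  have h2 : ε ^ 2 / (2 * m) ≤ 1 / 2 * (1 / m) := by
    rw [show (1 / 2 * (1 / m) : ℝ) = 1 / (2 * m) by field_simp]
    gcongr; nlinarith
  have h3 : 4 * Real.log (m / ε) / m = (4 * Real.log m - 4 * Real.log ε) * (1 / m) := by
    rw [Real.log_div hm0.ne' hε.ne']; ring
  have h4 : (1 / 2 - Real.log (ε ^ 2 / (2 * m))) * (1 / m) ≤
      (4 * Real.log m - 4 * Real.log ε) * (1 / m) := by
    apply mul_le_mul_of_nonneg_right _ (by positivity)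
    rw [hlu]; linarith
  rw [h3]
  linarith

/-- The Dirichlet prior puts enough mass near a sparse vector. -/
theorem exists_dirichlet_mass_ge (c δ : ℝ) (hc : 1 < c) (hδ : 0 < δ) :
    ∃ C : ℝ, 0 < C ∧ ∀ (m : ℕ) (xs : Fin m → ℝ) (e : ℕ) (ε : ℝ), xs ∈ stdSimplex ℝ (Fin m) →
      {i | xs i ≠ 0}.ncard ≤ e → (∀ i, xs i ≠ 0 → δ ≤ xs i) → 0 < ε → ε < 1 →
      ENNReal.ofReal (Real.exp (-(C * (e * Real.log (m / ε))))) ≤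
        dirichlet m (1 / (m : ℝ) ^ c) {x | ∀ i, xs i * Real.exp (-ε ^ 2) ≤ x i} := by
  set C₁ := c + 2 + (2 + Real.log (4 / δ)) / Real.log 2 with hC₁
  -- `|C₁|` per supported coordinate, and `4` for all null coordinates together. The absolute value
  -- keeps the constant positive before `δ ≤ 1` is known.
  refine ⟨|C₁| + 4, by positivity, fun m xs e ε hxs he hlow hε hε1 => ?_⟩
  have hm : m ≠ 0 := by
    rintro rfl
    simpa using hxs.2
  have : NeZero m := ⟨hm⟩
  have hS : MeasurableSet {x : Fin m → ℝ | ∀ i, xs i * Real.exp (-ε ^ 2) ≤ x i} := by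
    measurability
  have hm1 : (1 : ℝ) ≤ m := by exact_mod_cast Nat.one_le_iff_ne_zero.2 hm
  have hlog : 0 ≤ Real.log (m / ε) := Real.log_nonneg (by rw [le_div_iff₀ hε]; linarith)
  have hx1 : ∀ i, xs i ≤ 1 := fun i => hxs.2 ▸
    Finset.single_le_sum (fun j _ => hxs.1 j) (Finset.mem_univ i)
  rcases Nat.lt_or_ge m 2 with hm2 | hm2
  -- For `m = 1` the target `log (1/ε)` can be arbitrarily small, so no constant can be absorbed;
  -- but the Dirichlet law is then a point mass and the neighbourhood has probability one.
  · obtain rfl : m = 1 := by omega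
    have hall : ∀ᵐ x ∂dirichlet 1 (1 / ((1 : ℕ) : ℝ) ^ c),
        x ∈ {x : Fin 1 → ℝ | ∀ i, xs i * Real.exp (-ε ^ 2) ≤ x i} := by
      filter_upwards [ae_dirichlet 1 c] with x hx i
      have hxi : x i = 1 := by
        have := hx.2
        rw [Fin.sum_univ_one] at this
        rwa [Subsingleton.elim i 0]
      rw [hxi]
      have : Real.exp (-ε ^ 2) ≤ 1 := Real.exp_le_one_iff.2 (by nlinarith)
      exact mul_le_one₀ (hx1 i) (Real.exp_pos _).le this
    rw [(mem_ae_iff_prob_eq_one hS).1 hall, ENNReal.ofReal_le_one, Real.exp_le_one_iff]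
    have : 0 ≤ (|C₁| + 4) * (e * Real.log (((1 : ℕ) : ℝ) / ε)) := by positivity
    linarith
  have hδ1 : δ ≤ 1 := by
    obtain ⟨i, hi⟩ : ∃ i, xs i ≠ 0 := by
      by_contra! h
      have := hxs.2
      simp [h] at this
    exact (hlow i hi).trans (hx1 i)
  classical
  -- A product box for the unnormalised gamma variables: the relative slack on the support and the
  -- absolute slack off it each add at most `ε² / 2` to the total mass.
  let box : Fin m → Set ℝ := fun i =>
    if xs i ≠ 0 then Icc (xs i) (xs i * (1 + ε ^ 2 / 2)) else Icc 0 (ε ^ 2 / (2 * m))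
  have he1 : (1 : ℝ) ≤ e := by
    have : 0 < {i | xs i ≠ 0}.ncard := by
      rw [Set.ncard_pos]
      by_contra! h
      have h0 : ∀ i, xs i = 0 := fun i => by
        by_contra hi
        exact (Set.eq_empty_iff_forall_notMem.1 h i) hi
      have := hxs.2
      simp [h0] at this
    exact_mod_cast this.trans_le he
  calc ENNReal.ofReal (Real.exp (-((|C₁| + 4) * (e * Real.log (m / ε)))))
      ≤ ENNReal.ofReal (∏ i, Real.exp (-(if xs i ≠ 0 then C₁ * Real.log (m / ε) else
          4 * Real.log (m / ε) / m))) := by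
        refine ENNReal.ofReal_le_ofReal ?_
        rw [← Real.exp_sum, Real.exp_le_exp, Finset.sum_neg_distrib, neg_le_neg_iff]
        calc ∑ i, (if xs i ≠ 0 then C₁ * Real.log (m / ε) else 4 * Real.log (m / ε) / m)
            ≤ ∑ i, ((if xs i ≠ 0 then |C₁| * Real.log (m / ε) else 0)
              + 4 * Real.log (m / ε) / m) := by
              refine Finset.sum_le_sum fun i _ => ?_
              have : 0 ≤ 4 * Real.log (m / ε) / m := by positivity
              split_ifs
              · have := mul_le_mul_of_nonneg_right (le_abs_self C₁) hlog
                linarith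
              · linarith
          _ = ({i | xs i ≠ 0}.ncard : ℝ) * (|C₁| * Real.log (m / ε)) + 4 * Real.log (m / ε) := by
              rw [Finset.sum_add_distrib, ← Finset.sum_filter, Finset.sum_const, Finset.sum_const,
                Set.ncard_eq_toFinset_card', Set.toFinset_ofPred, Finset.card_univ,
                Fintype.card_fin, nsmul_eq_mul, nsmul_eq_mul]
              field_simp
          _ ≤ e * (|C₁| * Real.log (m / ε)) + e * (4 * Real.log (m / ε)) := by
              have : ({i | xs i ≠ 0}.ncard : ℝ) ≤ e := by exact_mod_cast he
              refine add_le_add (by gcongr) ?_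
              exact le_mul_of_one_le_left (by positivity) he1
          _ = _ := by ring
    _ = ∏ i, ENNReal.ofReal (Real.exp (-(if xs i ≠ 0 then C₁ * Real.log (m / ε) else
          4 * Real.log (m / ε) / m))) :=
        ENNReal.ofReal_prod_of_nonneg fun i _ => (Real.exp_pos _).le
    _ ≤ ∏ i, gammaMeasure (1 / (m : ℝ) ^ c) 1 (box i) := by
        refine Finset.prod_le_prod' fun i _ => ?_
        by_cases hi : xs i ≠ 0
        · simp only [box, if_pos hi]
          exact exp_le_gammaMeasure_Icc hδ1 hc hδ hm2 (hlow i hi) (hx1 i) hε hε1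
        · simp only [box, if_neg hi]
          exact exp_le_gammaMeasure_Icc_zero hc hm2 hε hε1
    _ = (Measure.pi fun _ : Fin m => gammaMeasure (1 / (m : ℝ) ^ c) 1) (univ.pi box) :=
        (Measure.pi_pi _ _).symm
    _ ≤ _ := by
        rw [dirichlet, Measure.map_apply (measurable_normalize m) hS]
        refine measure_mono fun g hg => ?_
        refine le_div_sum_of_mem_box hxs fun i => ?_
        have hgi := hg i (mem_univ i)
        have : 0 ≤ ε ^ 2 / (2 * m) := by positivity
        by_cases hi : xs i ≠ 0
        · simp only [box, if_pos hi] at hgi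
          exact ⟨hgi.1, hgi.2.trans (by linarith)⟩
        · simp only [box, if_neg hi] at hgi
          rw [not_not.1 hi]
          exact ⟨hgi.1, hgi.2.trans (by linarith)⟩

end Dirichlet

/-! ### Relative entropy and products of conditioned measures -/

section Conditioning

open ProbabilityTheory Set

/-- The density of the conditioned measure is the constant `1 / μ s` on `s` and zero elsewhere. In
the `klFun` form of the divergence the complement contributes `klFun 0 = 1` times its mass, which
cancels the linear part of `klFun` on `s`. -/
theorem klDiv_cond {Ω : Type*} [MeasurableSpace Ω] (μ : Measure Ω) [IsProbabilityMeasure μ]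
    {s : Set Ω} (hs : MeasurableSet s) (h0 : μ s ≠ 0) :
    InformationTheory.klDiv μ[|s] μ = ENNReal.ofReal (-Real.log (μ.real s)) := by
  have hwd : μ[|s] = μ.withDensity (s.indicator fun _ => (μ s)⁻¹) := by
    rw [withDensity_indicator hs, withDensity_const, ProbabilityTheory.cond]
  have : IsProbabilityMeasure μ[|s] := cond_isProbabilityMeasure h0
  have hM : 0 < μ.real s := ENNReal.toReal_pos h0 (measure_ne_top _ _)
  have hrn : μ[|s].rnDeriv μ =ᵐ[μ] s.indicator fun _ => (μ s)⁻¹ := by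
    rw [hwd]
    exact Measure.rnDeriv_withDensity _ (measurable_const.indicator hs)
  rw [InformationTheory.klDiv_eq_lintegral_klFun_of_ac cond_absolutelyContinuous]
  have hcongr : ∫⁻ x, ENNReal.ofReal (InformationTheory.klFun (μ[|s].rnDeriv μ x).toReal) ∂μ =
      ∫⁻ x, (s.indicator (fun _ => ENNReal.ofReal (InformationTheory.klFun (μ.real s)⁻¹)) x +
        sᶜ.indicator (fun _ => 1) x) ∂μ := by
    refine lintegral_congr_ae ?_
    filter_upwards [hrn] with x hx
    rw [hx]
    by_cases h : x ∈ s <;> simp [h, measureReal_def, ENNReal.toReal_inv, InformationTheory.klFun_zero]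
  rw [hcongr, lintegral_add_left (measurable_const.indicator hs), lintegral_indicator_const hs,
    lintegral_indicator_const hs.compl, one_mul]
  rw [← ofReal_measureReal (μ := μ) (s := s), ← ofReal_measureReal (μ := μ) (s := sᶜ),
    ← ENNReal.ofReal_mul (InformationTheory.klFun_nonneg (by positivity)),
    ← ENNReal.ofReal_add (mul_nonneg (InformationTheory.klFun_nonneg (by positivity)) hM.le)
      measureReal_nonneg, probReal_compl_eq_one_sub hs, InformationTheory.klFun_apply, Real.log_inv]
  congr 1
  field_simp
  ring

theorem prod_cond {Ω Ω' : Type*} [MeasurableSpace Ω] [MeasurableSpace Ω'] (μ : Measure Ω)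
    (ν : Measure Ω') [IsProbabilityMeasure μ] [IsProbabilityMeasure ν] {s : Set Ω} {t : Set Ω'}
    (hs : MeasurableSet s) (ht : MeasurableSet t) (hs0 : μ s ≠ 0) (ht0 : ν t ≠ 0) :
    (μ[|s]).prod (ν[|t]) = (μ.prod ν)[|s ×ˢ t] := by
  have : IsProbabilityMeasure μ[|s] := cond_isProbabilityMeasure hs0
  have : IsProbabilityMeasure ν[|t] := cond_isProbabilityMeasure ht0
  refine Measure.prod_eq fun a b _ _ => ?_
  rw [cond_apply hs, cond_apply ht, cond_apply (hs.prod ht), Set.prod_inter_prod,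
    Measure.prod_prod, Measure.prod_prod,
    ENNReal.mul_inv (Or.inl hs0) (Or.inl (measure_ne_top _ _))]
  ring

theorem pi_cond {ι : Type*} [Fintype ι] {Ω : ι → Type*} [∀ i, MeasurableSpace (Ω i)]
    (μ : ∀ i, Measure (Ω i)) [∀ i, IsProbabilityMeasure (μ i)] {s : ∀ i, Set (Ω i)}
    (hs : ∀ i, MeasurableSet (s i)) (h0 : ∀ i, μ i (s i) ≠ 0) :
    Measure.pi (fun i => (μ i)[|s i]) = (Measure.pi μ)[|univ.pi s] := by
  have : ∀ i, IsProbabilityMeasure (μ i)[|s i] := fun i => cond_isProbabilityMeasure (h0 i)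
  refine Measure.pi_eq fun a _ => ?_
  rw [cond_apply (MeasurableSet.univ_pi hs), ← Set.pi_inter_distrib, Measure.pi_pi, Measure.pi_pi,
    ENNReal.prod_inv_distrib]
  · rw [← Finset.prod_mul_distrib]
    exact Finset.prod_congr rfl fun i _ => (cond_apply (hs i) _ _).symm
  · intro i _ j _ _
    exact Or.inl (h0 i)

end Conditioning

/-! ### Factorisation of the likelihood and the evidence lower bound -/

section Likelihood

variable {D K V N : ℕ}

theorem sum_prod_apply {ι κ R : Type*} [Fintype ι] [DecidableEq ι] [Fintype κ] [CommSemiring R]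
    (f : ι → κ → R) : ∑ x : ι → κ, ∏ i, f i (x i) = ∏ i, ∑ k, f i k := by
  rw [Finset.prod_univ_sum, Fintype.piFinset_univ]

theorem sum_prod_prod_apply {ι ι' κ R : Type*} [Fintype ι] [DecidableEq ι] [Fintype ι']
    [DecidableEq ι'] [Fintype κ] [CommSemiring R] (f : ι → ι' → κ → R) :
    ∑ x : ι → ι' → κ, ∏ i, ∏ j, f i j (x i j) = ∏ i, ∏ j, ∑ k, f i j k := by
  rw [sum_prod_apply fun i (y : ι' → κ) => ∏ j, f i j (y j)]
  exact Finset.prod_congr rfl fun i _ => sum_prod_apply (f i)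

/-- The marginals of a product distribution. -/
theorem sum_prod_prod_mul_apply {ι ι' κ : Type*} [Fintype ι] [DecidableEq ι] [Fintype ι']
    [DecidableEq ι'] [Fintype κ] (q : ι → ι' → κ → ℝ) (hq : ∀ i j, ∑ k, q i j k = 1)
    (i₀ : ι) (j₀ : ι') (f : κ → ℝ) :
    ∑ x : ι → ι' → κ, (∏ i, ∏ j, q i j (x i j)) * f (x i₀ j₀) = ∑ k, q i₀ j₀ k * f k := by
  have h : ∀ x : ι → ι' → κ, (∏ i, ∏ j, q i j (x i j)) * f (x i₀ j₀) =
      ∏ i, ∏ j, (q i j (x i j) * if i = i₀ ∧ j = j₀ then f (x i j) else 1) := by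
    intro x
    simp_rw [Finset.prod_mul_distrib]
    congr 1
    rw [Finset.prod_eq_single i₀ (fun i _ hi => by simp [hi]) (by simp),
      Finset.prod_eq_single j₀ (fun j _ hj => by simp [hj]) (by simp)]
    simp
  simp_rw [h]
  rw [sum_prod_prod_apply fun i j k => q i j k * if i = i₀ ∧ j = j₀ then f k else 1,
    Finset.prod_eq_single i₀ (fun i _ hi => by simp [hi, hq]) (by simp),
    Finset.prod_eq_single j₀ (fun j _ hj => by simp [hj, hq]) (by simp)]
  simp

/-- The word distribution `p_d(· ∣ θ)` of a document. -/
def wordProb (θ : Param D K V) (d : Fin D) (v : Fin V) : ℝ := ∑ k, θ.1 d k * θ.2 k v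

theorem condLik_mul_latentProb (θ : Param D K V) (Y : Words D V N) (S : Topics D K N) :
    condLik θ Y S * latentProb θ S = ∏ n, ∏ d, (θ.1 d (S n d) * θ.2 (S n d) (Y n d)) := by
  simp_rw [condLik, latentProb, Finset.prod_mul_distrib]
  rw [mul_comm]

theorem lik_eq_prod (θ : Param D K V) (Y : Words D V N) :
    lik θ Y = ∏ n, ∏ d, wordProb θ d (Y n d) := by
  simp_rw [lik, condLik_mul_latentProb]
  exact sum_prod_prod_apply fun n d k => θ.1 d k * θ.2 k (Y n d)

theorem obsPMF_eq_prod (θ : Param D K V) (y : Fin D → Fin V) :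
    obsPMF θ y = ∏ d, wordProb θ d (y d) := rfl

/-- Parameters with all entries in the probability simplices. -/
def IsParam (θ : Param D K V) : Prop :=
  (∀ d, θ.1 d ∈ stdSimplex ℝ (Fin K)) ∧ ∀ k, θ.2 k ∈ stdSimplex ℝ (Fin V)

/-- Parameters in the interiors of the probability simplices. -/
def IsPosParam (θ : Param D K V) : Prop :=
  (∀ d, (∀ k, 0 < θ.1 d k) ∧ ∑ k, θ.1 d k = 1) ∧ ∀ k, (∀ v, 0 < θ.2 k v) ∧ ∑ v, θ.2 k v = 1

theorem IsPosParam.isParam {θ : Param D K V} (h : IsPosParam θ) : IsParam θ :=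
  ⟨fun d => ⟨fun k => ((h.1 d).1 k).le, (h.1 d).2⟩, fun k => ⟨fun v => ((h.2 k).1 v).le, (h.2 k).2⟩⟩

theorem IsParam.wordProb_mem {θ : Param D K V} (h : IsParam θ) (d : Fin D) :
    wordProb θ d ∈ stdSimplex ℝ (Fin V) := by
  refine ⟨fun v => Finset.sum_nonneg fun k _ => mul_nonneg ((h.1 d).1 k) ((h.2 k).1 v), ?_⟩
  simp_rw [wordProb]
  rw [Finset.sum_comm]
  simp_rw [← Finset.mul_sum, (h.2 _).2, mul_one, (h.1 d).2]

theorem IsPosParam.wordProb_pos [NeZero K] {θ : Param D K V} (h : IsPosParam θ) (d : Fin D)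
    (v : Fin V) : 0 < wordProb θ d v :=
  Finset.sum_pos (fun k _ => mul_pos ((h.1 d).1 k) ((h.2 k).1 v)) Finset.univ_nonempty

theorem le_one_of_mem_stdSimplex {ι : Type*} [Fintype ι] {p : ι → ℝ} (hp : p ∈ stdSimplex ℝ ι)
    (i : ι) : p i ≤ 1 :=
  hp.2 ▸ Finset.single_le_sum (fun j _ => hp.1 j) (Finset.mem_univ i)

theorem IsParam.lik_le_one {θ : Param D K V} (h : IsParam θ) (Y : Words D V N) : lik θ Y ≤ 1 := by
  rw [lik_eq_prod]
  refine Finset.prod_le_one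
    (fun n _ => Finset.prod_nonneg fun d _ => (h.wordProb_mem d).1 _) fun n _ => ?_
  exact Finset.prod_le_one (fun d _ => (h.wordProb_mem d).1 _)
    fun d _ => le_one_of_mem_stdSimplex (h.wordProb_mem d) _

theorem IsParam.lik_nonneg {θ : Param D K V} (h : IsParam θ) (Y : Words D V N) : 0 ≤ lik θ Y := by
  rw [lik_eq_prod]
  exact Finset.prod_nonneg fun n _ => Finset.prod_nonneg fun d _ => (h.wordProb_mem d).1 _

theorem IsPosParam.lik_pos [NeZero K] {θ : Param D K V} (h : IsPosParam θ) (Y : Words D V N) :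
    0 < lik θ Y := by
  rw [lik_eq_prod]
  exact Finset.prod_pos fun n _ => Finset.prod_pos fun d _ => h.wordProb_pos d _

theorem measurable_lik (Y : Words D V N) : Measurable fun θ : Param D K V => lik θ Y := by
  simp_rw [lik_eq_prod, wordProb]
  fun_prop

theorem measurable_negLogLik (Y : Words D V N) :
    Measurable (negLogLik Y : Param D K V → ℝ≥0∞) := by
  unfold negLogLik
  refine Measurable.ite (measurableSet_le (measurable_lik Y) measurable_const) measurable_const ?_
  exact (Real.measurable_log.comp (measurable_lik Y)).neg.ennreal_ofReal

theorem negLogLik_eq {θ : Param D K V} {Y : Words D V N} (h : 0 < lik θ Y) :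
    negLogLik Y θ = ENNReal.ofReal (-Real.log (lik θ Y)) := if_neg h.not_ge

/-- The evidence lower bound is a lower bound. -/
theorem sum_mul_log_div_le {ι : Type*} [Fintype ι] {q b : ι → ℝ} (hq : q ∈ stdSimplex ℝ ι)
    (hb : ∀ i, 0 ≤ b i) (hqb : ∀ i, q i ≠ 0 → 0 < b i) :
    ∑ i, q i * Real.log (b i / q i) ≤ Real.log (∑ i, b i) := by
  obtain ⟨i₀, hi₀⟩ : ∃ i, q i ≠ 0 := by
    by_contra! h
    have := hq.2
    simp [h] at this
  have hL : 0 < ∑ i, b i := (hqb i₀ hi₀).trans_le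
    (Finset.single_le_sum (fun i _ => hb i) (Finset.mem_univ i₀))
  calc ∑ i, q i * Real.log (b i / q i)
      ≤ ∑ i, (q i * (Real.log (∑ i, b i) - 1) + b i / ∑ i, b i) := by
        refine Finset.sum_le_sum fun i _ => ?_
        rcases (hq.1 i).eq_or_lt with h | h
        · rw [← h]; simp [div_nonneg (hb i) hL.le]
        · have hx : 0 < b i / q i := div_pos (hqb i h.ne') h
          -- Jensen for the logarithm, in tangent-line form at the mean `∑ i, b i`.
          have h1 := Real.log_le_sub_one_of_pos (div_pos hx hL)
          rw [Real.log_div hx.ne' hL.ne'] at h1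
          have h2 : b i / ∑ i, b i = q i * (b i / q i / ∑ i, b i) := by field_simp
          rw [h2, ← mul_add]
          exact mul_le_mul_of_nonneg_left (by linarith) h.le
    _ = Real.log (∑ i, b i) := by
        rw [Finset.sum_add_distrib, ← Finset.sum_mul, hq.2, ← Finset.sum_div, div_self hL.ne']
        ring

/-- The negative evidence lower bound, split into likelihood and Jensen gap. -/
theorem negLogLik_add_jensenGap [NeZero K] {θ : Param D K V} (h : IsPosParam θ) (Y : Words D V N)
    {q : Topics D K N → ℝ} (hq : q ∈ stdSimplex ℝ (Topics D K N)) :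
    negLogLik Y θ + jensenGap Y q θ =
      ENNReal.ofReal (-∑ S, q S * Real.log (condLik θ Y S * latentProb θ S / q S)) := by
  have hb : ∀ S, 0 < condLik θ Y S * latentProb θ S := fun S => by
    rw [condLik_mul_latentProb]
    exact Finset.prod_pos fun n _ => Finset.prod_pos fun d _ =>
      mul_pos ((h.1 d).1 _) ((h.2 _).1 _)
  have hJ := sum_mul_log_div_le hq (fun S => (hb S).le) fun S _ => hb S
  have hl : ∑ S, condLik θ Y S * latentProb θ S = lik θ Y := rfl
  rw [hl] at hJ
  have hlog : Real.log (lik θ Y) ≤ 0 :=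
    Real.log_nonpos (h.isParam.lik_nonneg Y) (h.isParam.lik_le_one Y)
  -- Both summands are nonnegative (`lik ≤ 1` for the first, the evidence bound for the second), so
  -- the truncations in `ENNReal.ofReal` are harmless and `log lik` cancels.
  rw [negLogLik_eq (h.lik_pos Y), jensenGap, if_pos fun S _ => (hb S).ne',
    ← ENNReal.ofReal_add (by linarith) (by linarith)]
  congr 1
  ring

theorem MeanField.qS_mem {c : ℝ} (q : MeanField c D K V N) :
    q.qS ∈ stdSimplex ℝ (Topics D K N) := by
  refine ⟨fun S => Finset.prod_nonneg fun n _ => Finset.prod_nonneg fun d _ => (q.mem_z n d).1 _, ?_⟩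
  simp_rw [MeanField.qS, sum_prod_prod_apply, (q.mem_z _ _).2, Finset.prod_const_one]

instance (c : ℝ) (q : MeanField c D K V N) : IsProbabilityMeasure q.qθ := by
  have := q.prob_γ
  have := q.prob_β
  unfold MeanField.qθ
  infer_instance

instance (c : ℝ) [NeZero K] [NeZero V] : IsProbabilityMeasure (prior c D K V) := by
  unfold prior
  infer_instance

theorem MeanField.ae_isPosParam {c : ℝ} [NeZero K] [NeZero V] (q : MeanField c D K V N) :
    ∀ᵐ θ ∂q.qθ, IsPosParam θ := by
  have := q.prob_γ
  have := q.prob_β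
  have h1 : ∀ᵐ γ ∂Measure.pi q.qγ, ∀ d, (∀ k, 0 < γ d k) ∧ ∑ k, γ d k = 1 := by
    rw [ae_all_iff]
    exact fun d => Measure.tendsto_eval_ae_ae.eventually ((q.ac_γ d).ae_le (ae_dirichlet K c))
  have h2 : ∀ᵐ β ∂Measure.pi q.qβ, ∀ k, (∀ v, 0 < β k v) ∧ ∑ v, β k v = 1 := by
    rw [ae_all_iff]
    exact fun k => Measure.tendsto_eval_ae_ae.eventually ((q.ac_β k).ae_le (ae_dirichlet V c))
  exact (Measure.quasiMeasurePreserving_fst.ae h1).and (Measure.quasiMeasurePreserving_snd.ae h2)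

end Likelihood

/-! ### The truncated-prior competitor and its objective value -/

section Candidate

variable {D K V N : ℕ}

open ProbabilityTheory Set

/-- The vectors that lose at most a factor `exp (-ε²)` against `x` in every entry. -/
def nbhd {m : ℕ} (x : Fin m → ℝ) (ε : ℝ) : Set (Fin m → ℝ) :=
  {y | ∀ i, x i * Real.exp (-ε ^ 2) ≤ y i}

theorem measurableSet_nbhd {m : ℕ} (x : Fin m → ℝ) (ε : ℝ) : MeasurableSet (nbhd x ε) := by
  unfold nbhd
  measurability

/-- The conditional distribution `p(z_{dn} = · ∣ w_{dn}, θ)` of a topic. -/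
noncomputable def posterior (θ : Param D K V) (Y : Words D V N) (n : Fin N) (d : Fin D)
    (k : Fin K) : ℝ :=
  θ.1 d k * θ.2 k (Y n d) / wordProb θ d (Y n d)

theorem wordProb_pos_of_lik_pos {θ : Param D K V} (hθ : IsParam θ) {Y : Words D V N}
    (hY : 0 < lik θ Y) (n : Fin N) (d : Fin D) : 0 < wordProb θ d (Y n d) := by
  refine lt_of_le_of_ne ((hθ.wordProb_mem d).1 _) fun h => hY.ne' ?_
  rw [lik_eq_prod]
  exact Finset.prod_eq_zero (Finset.mem_univ n) (Finset.prod_eq_zero (Finset.mem_univ d) h.symm)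

theorem posterior_mem {θ : Param D K V} (hθ : IsParam θ) {Y : Words D V N} (hY : 0 < lik θ Y)
    (n : Fin N) (d : Fin D) : posterior θ Y n d ∈ stdSimplex ℝ (Fin K) := by
  have h := wordProb_pos_of_lik_pos hθ hY n d
  refine ⟨fun k => div_nonneg (mul_nonneg ((hθ.1 d).1 k) ((hθ.2 k).1 _)) h.le, ?_⟩
  simp_rw [posterior]
  rw [← Finset.sum_div]
  exact div_self h.ne'

theorem prod_posterior (θ : Param D K V) (Y : Words D V N) (S : Topics D K N) :
    ∏ n, ∏ d, posterior θ Y n d (S n d) = condLik θ Y S * latentProb θ S / lik θ Y := by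
  simp_rw [posterior, Finset.prod_div_distrib, condLik_mul_latentProb, lik_eq_prod]

/-- The mean-field distribution whose parameter factors are the prior, truncated to neighbourhoods
of `θ`, and whose topic factors are the posterior under `θ`. -/
noncomputable def truncatedPrior (c : ℝ) {θ : Param D K V} (hθ : IsParam θ) {Y : Words D V N}
    (hY : 0 < lik θ Y) (εγ : Fin D → ℝ) (εβ : Fin K → ℝ)
    (hγ : ∀ d, dirichlet K (1 / (K : ℝ) ^ c) (nbhd (θ.1 d) (εγ d)) ≠ 0)
    (hβ : ∀ k, dirichlet V (1 / (V : ℝ) ^ c) (nbhd (θ.2 k) (εβ k)) ≠ 0)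
    (hγ' : IsFiniteMeasure (dirichlet K (1 / (K : ℝ) ^ c)))
    (hβ' : IsFiniteMeasure (dirichlet V (1 / (V : ℝ) ^ c))) :
    MeanField c D K V N where
  qγ d := (dirichlet K (1 / (K : ℝ) ^ c))[|nbhd (θ.1 d) (εγ d)]
  qβ k := (dirichlet V (1 / (V : ℝ) ^ c))[|nbhd (θ.2 k) (εβ k)]
  qz := posterior θ Y
  prob_γ d := cond_isProbabilityMeasure (hγ d)
  prob_β k := cond_isProbabilityMeasure (hβ k)
  ac_γ _ := cond_absolutelyContinuous
  ac_β _ := cond_absolutelyContinuous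
  mem_z := posterior_mem hθ hY

/-- The negative evidence lower bound near the truth. -/
theorem neg_elbo_le {θs θ : Param D K V} (hθs : IsParam θs) {Y : Words D V N} (hY : 0 < lik θs Y)
    {εγ : Fin D → ℝ} {εβ : Fin K → ℝ} (hθ : IsPosParam θ)
    (hγ : ∀ d, θ.1 d ∈ nbhd (θs.1 d) (εγ d)) (hβ : ∀ k, θ.2 k ∈ nbhd (θs.2 k) (εβ k)) :
    -∑ S, (∏ n, ∏ d, posterior θs Y n d (S n d)) *
        Real.log (condLik θ Y S * latentProb θ S / ∏ n, ∏ d, posterior θs Y n d (S n d)) ≤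
      -Real.log (lik θs Y) + N * ∑ d, εγ d ^ 2
        + ∑ k, (∑ d, ∑ n, posterior θs Y n d k) * εβ k ^ 2 := by
  have hpost := posterior_mem hθs hY
  have hsum : ∑ S : Topics D K N, ∏ n, ∏ d, posterior θs Y n d (S n d) = 1 := by
    rw [sum_prod_prod_apply (posterior θs Y)]
    simp_rw [(hpost _ _).2, Finset.prod_const_one]
  have hterm : ∀ S : Topics D K N, (∏ n, ∏ d, posterior θs Y n d (S n d)) *
      (Real.log (lik θs Y) - ∑ n, ∑ d, (εγ d ^ 2 + εβ (S n d) ^ 2)) ≤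
      (∏ n, ∏ d, posterior θs Y n d (S n d)) *
        Real.log (condLik θ Y S * latentProb θ S / ∏ n, ∏ d, posterior θs Y n d (S n d)) := by
    intro S
    have hq0 : 0 ≤ ∏ n, ∏ d, posterior θs Y n d (S n d) :=
      Finset.prod_nonneg fun n _ => Finset.prod_nonneg fun d _ => (hpost n d).1 _
    rcases hq0.eq_or_lt with hq | hq
    · rw [← hq]; simp
    · refine mul_le_mul_of_nonneg_left ?_ hq.le
      -- The joint likelihood is a product of entries of `γ` and `β`, so entrywise one-sided
      -- closeness multiplies up.
      have hb : (condLik θs Y S * latentProb θs S) *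
          Real.exp (-∑ n, ∑ d, (εγ d ^ 2 + εβ (S n d) ^ 2)) ≤ condLik θ Y S * latentProb θ S := by
        simp_rw [condLik_mul_latentProb, ← Finset.sum_neg_distrib, Real.exp_sum,
          ← Finset.prod_mul_distrib]
        have h0 : ∀ n d, 0 ≤ θs.1 d (S n d) * θs.2 (S n d) (Y n d) *
            Real.exp (-(εγ d ^ 2 + εβ (S n d) ^ 2)) := fun n d =>
          mul_nonneg (mul_nonneg ((hθs.1 d).1 _) ((hθs.2 _).1 _)) (Real.exp_pos _).le
        refine Finset.prod_le_prod (fun n _ => Finset.prod_nonneg fun d _ => h0 n d) fun n _ => ?_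
        refine Finset.prod_le_prod (fun d _ => h0 n d) fun d _ => ?_
        calc θs.1 d (S n d) * θs.2 (S n d) (Y n d) * Real.exp (-(εγ d ^ 2 + εβ (S n d) ^ 2))
            = (θs.1 d (S n d) * Real.exp (-εγ d ^ 2)) *
              (θs.2 (S n d) (Y n d) * Real.exp (-εβ (S n d) ^ 2)) := by
              rw [neg_add, Real.exp_add]; ring
          _ ≤ _ := mul_le_mul (hγ d _) (hβ _ _)
              (mul_nonneg ((hθs.2 _).1 _) (Real.exp_pos _).le) ((hθ.1 d).1 _).le
      -- The weight is the joint likelihood under `θs` divided by `lik θs Y`; hence the ratio inside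
      -- the logarithm is `lik θs Y` up to the exponential loss, whatever `S` is.
      rw [prod_posterior] at hq ⊢
      have hbs : 0 < condLik θs Y S * latentProb θs S := by
        have := mul_pos hq hY
        rwa [div_mul_cancel₀ _ hY.ne'] at this
      have hlow : lik θs Y * Real.exp (-∑ n, ∑ d, (εγ d ^ 2 + εβ (S n d) ^ 2)) ≤
          condLik θ Y S * latentProb θ S / (condLik θs Y S * latentProb θs S / lik θs Y) := by
        rw [le_div_iff₀ hq]
        calc _ = (condLik θs Y S * latentProb θs S) *
          Real.exp (-∑ n, ∑ d, (εγ d ^ 2 + εβ (S n d) ^ 2)) := by field_simp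
          _ ≤ _ := hb
      have := Real.log_le_log (by positivity) hlow
      rw [Real.log_mul hY.ne' (Real.exp_pos _).ne', Real.log_exp] at this
      linarith
  -- Only one-coordinate marginals are needed: each word contributes its document radius once, and
  -- the topic radii in proportion to its posterior.
  have hmarg : ∑ S : Topics D K N, (∏ n, ∏ d, posterior θs Y n d (S n d)) *
      ∑ n, ∑ d, (εγ d ^ 2 + εβ (S n d) ^ 2) =
      N * ∑ d, εγ d ^ 2 + ∑ k, (∑ d, ∑ n, posterior θs Y n d k) * εβ k ^ 2 := by
    calc _ = ∑ n, ∑ d, ∑ S : Topics D K N, (∏ n, ∏ d, posterior θs Y n d (S n d)) *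
          (εγ d ^ 2 + εβ (S n d) ^ 2) := by
          simp_rw [Finset.mul_sum]
          rw [Finset.sum_comm]
          exact Finset.sum_congr rfl fun n _ => Finset.sum_comm
      _ = ∑ n, ∑ d, (εγ d ^ 2 + ∑ k, posterior θs Y n d k * εβ k ^ 2) := by
          refine Finset.sum_congr rfl fun n _ => Finset.sum_congr rfl fun d _ => ?_
          rw [sum_prod_prod_mul_apply (posterior θs Y) (fun n d => (hpost n d).2) n d
            fun k => εγ d ^ 2 + εβ k ^ 2]
          simp_rw [mul_add, Finset.sum_add_distrib, ← Finset.sum_mul, (hpost n d).2, one_mul]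
      _ = _ := by
          simp_rw [Finset.sum_add_distrib, Finset.sum_const, Finset.card_univ, Fintype.card_fin,
            nsmul_eq_mul]
          congr 1
          simp_rw [Finset.sum_mul]
          rw [Finset.sum_congr rfl fun n _ => Finset.sum_comm, Finset.sum_comm]
          exact Finset.sum_congr rfl fun k _ => Finset.sum_comm
  have htot := Finset.sum_le_sum fun S (_ : S ∈ Finset.univ) => hterm S
  simp_rw [mul_sub] at htot
  rw [Finset.sum_sub_distrib, ← Finset.sum_mul, hsum, one_mul, hmarg] at htot
  linarith

/-- Truncating every factor of a product prior is the same as conditioning the whole prior on a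
product set, so the divergence is the sum of the individual log-masses. -/
theorem klDiv_truncatedPrior_le (c : ℝ) [NeZero K] [NeZero V] {θ : Param D K V} (hθ : IsParam θ)
    {Y : Words D V N} (hY : 0 < lik θ Y) (εγ : Fin D → ℝ) (εβ : Fin K → ℝ) {a : Fin D → ℝ}
    {b : Fin K → ℝ}
    (ha : ∀ d, ENNReal.ofReal (Real.exp (-a d)) ≤
      dirichlet K (1 / (K : ℝ) ^ c) (nbhd (θ.1 d) (εγ d)))
    (hb : ∀ k, ENNReal.ofReal (Real.exp (-b k)) ≤
      dirichlet V (1 / (V : ℝ) ^ c) (nbhd (θ.2 k) (εβ k)))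
    (hγ hβ hγ' hβ') :
    InformationTheory.klDiv (truncatedPrior c hθ hY εγ εβ hγ hβ hγ' hβ').qθ (prior c D K V) ≤
      ENNReal.ofReal (∑ d, a d + ∑ k, b k) := by
  have hmγ : ∀ d, MeasurableSet (nbhd (θ.1 d) (εγ d)) := fun d => measurableSet_nbhd _ _
  have hmβ : ∀ k, MeasurableSet (nbhd (θ.2 k) (εβ k)) := fun k => measurableSet_nbhd _ _
  have hγ0 : (Measure.pi fun _ : Fin D => dirichlet K (1 / (K : ℝ) ^ c))
      (univ.pi fun d => nbhd (θ.1 d) (εγ d)) ≠ 0 := by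
    rw [Measure.pi_pi]; exact Finset.prod_ne_zero_iff.2 fun d _ => hγ d
  have hβ0 : (Measure.pi fun _ : Fin K => dirichlet V (1 / (V : ℝ) ^ c))
      (univ.pi fun k => nbhd (θ.2 k) (εβ k)) ≠ 0 := by
    rw [Measure.pi_pi]; exact Finset.prod_ne_zero_iff.2 fun k _ => hβ k
  have hq : (truncatedPrior c hθ hY εγ εβ hγ hβ hγ' hβ').qθ =
      (prior c D K V)[|(univ.pi fun d => nbhd (θ.1 d) (εγ d)) ×ˢ
        (univ.pi fun k => nbhd (θ.2 k) (εβ k))] := by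
    simp only [MeanField.qθ, truncatedPrior, prior]
    rw [pi_cond _ hmγ hγ, pi_cond _ hmβ hβ,
      prod_cond _ _ (MeasurableSet.univ_pi hmγ) (MeasurableSet.univ_pi hmβ) hγ0 hβ0]
  have hp : prior c D K V ((univ.pi fun d => nbhd (θ.1 d) (εγ d)) ×ˢ
      (univ.pi fun k => nbhd (θ.2 k) (εβ k))) =
      (∏ d, dirichlet K (1 / (K : ℝ) ^ c) (nbhd (θ.1 d) (εγ d))) *
        ∏ k, dirichlet V (1 / (V : ℝ) ^ c) (nbhd (θ.2 k) (εβ k)) := by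
    rw [prior, Measure.prod_prod, Measure.pi_pi, Measure.pi_pi]
  have hge : ENNReal.ofReal (Real.exp (-(∑ d, a d + ∑ k, b k))) ≤
      prior c D K V ((univ.pi fun d => nbhd (θ.1 d) (εγ d)) ×ˢ
      (univ.pi fun k => nbhd (θ.2 k) (εβ k))) := by
    rw [hp, neg_add, Real.exp_add, ENNReal.ofReal_mul (Real.exp_pos _).le,
      ← Finset.sum_neg_distrib, ← Finset.sum_neg_distrib, Real.exp_sum, Real.exp_sum,
      ENNReal.ofReal_prod_of_nonneg fun i _ => (Real.exp_pos _).le,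
      ENNReal.ofReal_prod_of_nonneg fun i _ => (Real.exp_pos _).le]
    exact mul_le_mul' (Finset.prod_le_prod' fun d _ => ha d) (Finset.prod_le_prod' fun k _ => hb k)
  have h0 : prior c D K V ((univ.pi fun d => nbhd (θ.1 d) (εγ d)) ×ˢ
      (univ.pi fun k => nbhd (θ.2 k) (εβ k))) ≠ 0 :=
    (lt_of_lt_of_le (ENNReal.ofReal_pos.2 (Real.exp_pos _)) hge).ne'
  rw [hq, klDiv_cond _ ((MeasurableSet.univ_pi hmγ).prod (MeasurableSet.univ_pi hmβ)) h0]
  refine ENNReal.ofReal_le_ofReal ?_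
  rw [ENNReal.ofReal_le_iff_le_toReal (measure_ne_top _ _)] at hge
  have := Real.log_le_log (Real.exp_pos _) hge
  rw [Real.log_exp] at this
  rw [measureReal_def]
  linarith

/-- The objective without its constant term. -/
noncomputable def objectiveCore {c : ℝ} (α : ℝ) (Y : Words D V N) (q : MeanField c D K V N) :
    ℝ≥0∞ :=
  ∫⁻ θ, negLogLik Y θ ∂q.qθ + ∫⁻ θ, jensenGap Y q.qS θ ∂q.qθ
    + ENNReal.ofReal α⁻¹ * InformationTheory.klDiv q.qθ (prior c D K V)

theorem objectiveCore_truncatedPrior_le (c : ℝ) {α : ℝ} (hα : 0 < α) [NeZero K] [NeZero V]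
    {θ : Param D K V} (hθ : IsParam θ)
    {Y : Words D V N} (hY : 0 < lik θ Y) (εγ : Fin D → ℝ) (εβ : Fin K → ℝ) {a : Fin D → ℝ}
    {b : Fin K → ℝ} (ha0 : ∀ d, 0 ≤ a d) (hb0 : ∀ k, 0 ≤ b k)
    (ha : ∀ d, ENNReal.ofReal (Real.exp (-a d)) ≤
      dirichlet K (1 / (K : ℝ) ^ c) (nbhd (θ.1 d) (εγ d)))
    (hb : ∀ k, ENNReal.ofReal (Real.exp (-b k)) ≤
      dirichlet V (1 / (V : ℝ) ^ c) (nbhd (θ.2 k) (εβ k)))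
    (hγ hβ hγ' hβ') :
    objectiveCore α Y (truncatedPrior c hθ hY εγ εβ hγ hβ hγ' hβ') ≤
      ENNReal.ofReal (-Real.log (lik θ Y) + N * ∑ d, εγ d ^ 2
        + ∑ k, (∑ d, ∑ n, posterior θ Y n d k) * εβ k ^ 2 + α⁻¹ * (∑ d, a d + ∑ k, b k)) := by
  set r := truncatedPrior c hθ hY εγ εβ hγ hβ hγ' hβ' with hr
  have hlog : 0 ≤ -Real.log (lik θ Y) := by
    have := Real.log_nonpos (hθ.lik_nonneg Y) (hθ.lik_le_one Y)
    linarith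
  have hpost : ∀ n d k, 0 ≤ posterior θ Y n d k := fun n d => (posterior_mem hθ hY n d).1
  have hM0 : 0 ≤ -Real.log (lik θ Y) + N * ∑ d, εγ d ^ 2
        + ∑ k, (∑ d, ∑ n, posterior θ Y n d k) * εβ k ^ 2 := by
    have : ∀ k, 0 ≤ ∑ d, ∑ n, posterior θ Y n d k := fun k =>
      Finset.sum_nonneg fun d _ => Finset.sum_nonneg fun n _ => hpost n d k
    have h2 : 0 ≤ ∑ k, (∑ d, ∑ n, posterior θ Y n d k) * εβ k ^ 2 :=
      Finset.sum_nonneg fun k _ => mul_nonneg (this k) (sq_nonneg _)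
    positivity
  have hS0 : 0 ≤ ∑ d, a d + ∑ k, b k :=
    add_nonneg (Finset.sum_nonneg fun d _ => ha0 d) (Finset.sum_nonneg fun k _ => hb0 k)
  rw [objectiveCore, ENNReal.ofReal_add hM0 (by positivity), ENNReal.ofReal_mul (by positivity)]
  refine add_le_add ?_ (mul_le_mul' le_rfl
    (klDiv_truncatedPrior_le c hθ hY εγ εβ ha hb hγ hβ hγ' hβ'))
  rw [← lintegral_add_left (measurable_negLogLik Y)]
  have hbox : ∀ᵐ ϑ ∂r.qθ, (∀ d, ϑ.1 d ∈ nbhd (θ.1 d) (εγ d)) ∧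
      ∀ k, ϑ.2 k ∈ nbhd (θ.2 k) (εβ k) := by
    have := r.prob_γ
    have := r.prob_β
    have h1 : ∀ᵐ γ ∂Measure.pi r.qγ, ∀ d, γ d ∈ nbhd (θ.1 d) (εγ d) := by
      rw [ae_all_iff]
      exact fun d => Measure.tendsto_eval_ae_ae.eventually
        (ae_cond_mem (measurableSet_nbhd _ _))
    have h2 : ∀ᵐ β ∂Measure.pi r.qβ, ∀ k, β k ∈ nbhd (θ.2 k) (εβ k) := by
      rw [ae_all_iff]
      exact fun k => Measure.tendsto_eval_ae_ae.eventually
        (ae_cond_mem (measurableSet_nbhd _ _))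
    exact (Measure.quasiMeasurePreserving_fst.ae h1).and (Measure.quasiMeasurePreserving_snd.ae h2)
  calc ∫⁻ ϑ, (negLogLik Y ϑ + jensenGap Y r.qS ϑ) ∂r.qθ
      ≤ ∫⁻ _, ENNReal.ofReal (-Real.log (lik θ Y) + N * ∑ d, εγ d ^ 2
        + ∑ k, (∑ d, ∑ n, posterior θ Y n d k) * εβ k ^ 2) ∂r.qθ := by
        refine lintegral_mono_ae ?_
        filter_upwards [hbox, r.ae_isPosParam] with ϑ hϑ hpos
        rw [negLogLik_add_jensenGap hpos Y r.qS_mem]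
        exact ENNReal.ofReal_le_ofReal (neg_elbo_le hθ hY hpos hϑ.1 hϑ.2)
    _ = _ := by rw [lintegral_const, measure_univ, mul_one]

end Candidate

/-! ### Balancing the radii and bounding the minimiser -/

section Minimiser

variable {D K V N : ℕ}

theorem AssumptionS.isParam {δ : ℝ} {θ : Param D K V} {e : Fin D → ℕ} {s : Fin K → ℕ}
    (h : AssumptionS δ θ e s) : IsParam θ := ⟨h.simplex_γ, h.simplex_β⟩

/-- The supported entries sum to one and each is at least `δ`. This dimension-free bound on the
support is what makes later constants depend on `δ` only. -/
theorem ncard_support_mul_le {m : ℕ} {x : Fin m → ℝ} (hx : x ∈ stdSimplex ℝ (Fin m)) {δ : ℝ}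
    (hlow : ∀ i, x i ≠ 0 → δ ≤ x i) : ({i | x i ≠ 0}.ncard : ℝ) * δ ≤ 1 := by
  classical
  calc ({i | x i ≠ 0}.ncard : ℝ) * δ = ∑ i with x i ≠ 0, δ := by
        rw [Finset.sum_const, Set.ncard_eq_toFinset_card', Set.toFinset_ofPred, nsmul_eq_mul]
    _ ≤ ∑ i with x i ≠ 0, x i := Finset.sum_le_sum fun i hi => hlow i (Finset.mem_filter.1 hi).2
    _ ≤ ∑ i, x i := Finset.sum_le_sum_of_subset_of_nonneg (Finset.filter_subset _ _)
        fun i _ _ => hx.1 i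
    _ = 1 := hx.2

theorem exists_ne_zero_of_mem_stdSimplex {ι : Type*} [Fintype ι] {x : ι → ℝ}
    (hx : x ∈ stdSimplex ℝ ι) : ∃ i, x i ≠ 0 := by
  by_contra! h
  have := hx.2
  simp [h] at this

theorem one_le_ncard_support {m : ℕ} {x : Fin m → ℝ} (hx : x ∈ stdSimplex ℝ (Fin m)) :
    1 ≤ {i | x i ≠ 0}.ncard := by
  rw [Nat.one_le_iff_ne_zero, ← Nat.pos_iff_ne_zero, Set.ncard_pos]
  exact exists_ne_zero_of_mem_stdSimplex hx

theorem neZero_of_mem_stdSimplex {m : ℕ} {x : Fin m → ℝ} (hx : x ∈ stdSimplex ℝ (Fin m)) :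
    NeZero m :=
  ⟨fun h => by subst h; obtain ⟨i, -⟩ := exists_ne_zero_of_mem_stdSimplex hx; exact i.elim0⟩

theorem AssumptionS.neZero_K {δ : ℝ} {θ : Param D K V} {e : Fin D → ℕ} {s : Fin K → ℕ}
    (h : AssumptionS δ θ e s) (hD : 0 < D) : NeZero K :=
  neZero_of_mem_stdSimplex (h.simplex_γ ⟨0, hD⟩)

theorem AssumptionS.neZero_V {δ : ℝ} {θ : Param D K V} {e : Fin D → ℕ} {s : Fin K → ℕ}
    (h : AssumptionS δ θ e s) (hD : 0 < D) : NeZero V :=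
  neZero_of_mem_stdSimplex (h.simplex_β ⟨0, Nat.pos_of_ne_zero (h.neZero_K hD).ne⟩)

/-- A geometric mean `ε'` of the radii `ε_d`, with weights `t_d` of large total mass. -/
theorem exists_radius {ι : Type*} [Fintype ι] {t ε : ι → ℝ} {n ε₀ : ℝ} (ht : ∀ i, 0 ≤ t i)
    (hn : 0 < n) (hε : ∀ i, 0 < ε i ∧ ε i < 1) (hε₀ : 0 < ε₀ ∧ ε₀ < 1) :
    ∃ ε' : ℝ, 0 < ε' ∧ ε' < 1 ∧ (∑ i, t i) * ε' ^ 2 ≤ n * ε₀ ^ 2 + ∑ i, t i * ε i ^ 2 ∧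
      -Real.log ε' ≤ -Real.log ε₀ + (∑ i, t i * (-Real.log (ε i))) / n := by
  have hlog : ∀ i, 0 < -Real.log (ε i) := fun i => by
    have := Real.log_neg (hε i).1 (hε i).2
    linarith
  have hlog0 : 0 < -Real.log ε₀ := by
    have := Real.log_neg hε₀.1 hε₀.2
    linarith
  have hnn : 0 ≤ ∑ i, t i * (-Real.log (ε i)) :=
    Finset.sum_nonneg fun i _ => mul_nonneg (ht i) (hlog i).le
  have hnn2 : 0 ≤ ∑ i, t i * ε i ^ 2 := Finset.sum_nonneg fun i _ => mul_nonneg (ht i) (sq_nonneg _)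
  rcases le_or_gt (∑ i, t i) n with h | h
  -- A light topic (weight at most `n`) keeps its own radius.
  · refine ⟨ε₀, hε₀.1, hε₀.2, ?_, ?_⟩
    · have := mul_le_mul_of_nonneg_right h (sq_nonneg ε₀)
      linarith
    · have : 0 ≤ (∑ i, t i * (-Real.log (ε i))) / n := by positivity
      linarith
  · have hT : 0 < ∑ i, t i := hn.trans h
    -- A heavy topic takes the geometric mean of the `ε i` with weights `t i`. Convexity of `exp`
    -- bounds its square by the arithmetic mean of the `ε i ^ 2`, and its logarithm is linear in the
    -- `log (ε i)`.
    refine ⟨Real.exp (-((∑ i, t i * (-Real.log (ε i))) / ∑ i, t i)), Real.exp_pos _, ?_, ?_, ?_⟩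
    · rw [Real.exp_lt_one_iff, neg_neg_iff_pos]
      refine div_pos (lt_of_le_of_ne hnn fun h0 => hT.ne' ?_) hT
      have := (Finset.sum_eq_zero_iff_of_nonneg
        fun i _ => mul_nonneg (ht i) (hlog i).le).1 h0.symm
      refine Finset.sum_eq_zero fun i hi => ?_
      exact (mul_eq_zero.1 (this i hi)).resolve_right (hlog i).ne'
    · have hconv := convexOn_exp.map_sum_le (t := Finset.univ) (w := fun i => t i / ∑ j, t j)
        (p := fun i => 2 * Real.log (ε i)) (fun i _ => div_nonneg (ht i) hT.le)
        (by rw [← Finset.sum_div, div_self hT.ne']) (fun i _ => Set.mem_univ _)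
      have hexp : ∀ i, Real.exp (2 * Real.log (ε i)) = ε i ^ 2 := fun i => by
        rw [two_mul, Real.exp_add, Real.exp_log (hε i).1, sq]
      simp only [smul_eq_mul, hexp] at hconv
      have heq : Real.exp (-((∑ i, t i * (-Real.log (ε i))) / ∑ i, t i)) ^ 2 =
          Real.exp (∑ i, t i / (∑ j, t j) * (2 * Real.log (ε i))) := by
        rw [← Real.exp_nat_mul]
        congr 1
        rw [Finset.sum_div, ← Finset.sum_neg_distrib, Finset.mul_sum]
        refine Finset.sum_congr rfl fun i _ => ?_
        push_cast; ring
      rw [heq]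
      calc _ ≤ (∑ i, t i) * ∑ i, t i / (∑ j, t j) * ε i ^ 2 :=
            mul_le_mul_of_nonneg_left hconv hT.le
        _ = ∑ i, t i * ε i ^ 2 := by
            rw [Finset.mul_sum]
            refine Finset.sum_congr rfl fun i _ => ?_
            field_simp
        _ ≤ _ := by have := mul_nonneg hn.le (sq_nonneg ε₀); linarith
    · rw [Real.log_exp, neg_neg]
      have : (∑ i, t i * (-Real.log (ε i))) / ∑ i, t i ≤ (∑ i, t i * (-Real.log (ε i))) / n :=
        div_le_div_of_nonneg_left hnn hn h.le
      linarith

theorem IsAlphaVB.objectiveCore_le {c α : ℝ} {θs : Param D K V} {Y : Words D V N}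
    {q : MeanField c D K V N} (h : IsAlphaVB α θs Y q) (r : MeanField c D K V N) :
    objectiveCore α Y q ≤ objectiveCore α Y r := by
  -- The log-likelihood of the truth is a finite real constant, hence cancellable in `EReal`.
  have h1 : (objectiveCore α Y q : EReal) + (Real.log (lik θs Y) : EReal) ≤
    (objectiveCore α Y r : EReal) + (Real.log (lik θs Y) : EReal) := h r
  have h2 : (objectiveCore α Y q : EReal) ≤ objectiveCore α Y r :=
    (EReal.addLECancellable_coe _).add_le_add_iff_right.1 h1
  exact_mod_cast h2

/-- The complexity term of the risk bound. -/
noncomputable def complexity (e : Fin D → ℕ) (s : Fin K → ℕ) (V : ℕ) (εγ : Fin D → ℝ)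
    (εβ : Fin K → ℝ) : ℝ :=
  ∑ d, e d * Real.log (K / εγ d) + ∑ k, s k * Real.log (V / εβ k)

theorem log_div_nonneg {m : ℕ} [NeZero m] {ε : ℝ} (hε : 0 < ε ∧ ε < 1) :
    0 ≤ Real.log (m / ε) := by
  have : (1 : ℝ) ≤ m := by exact_mod_cast Nat.one_le_iff_ne_zero.2 (NeZero.ne m)
  exact Real.log_nonneg (by rw [le_div_iff₀ hε.1]; linarith [hε.2])

/-- The objective of a minimiser is at most that of the truncated prior with rebalanced topic radii;
of the minimiser's objective only the likelihood term is retained. -/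
theorem exists_lintegral_negLogLik_le (c δ : ℝ) (hc : 1 < c) (hδ : 0 < δ) :
    ∃ B : ℝ, 0 < B ∧ ∀ (α : ℝ), 0 < α → ∀ (D K V N : ℕ), 0 < D → 0 < N →
      ∀ (θs : Param D K V) (e : Fin D → ℕ) (s : Fin K → ℕ), AssumptionS δ θs e s →
      ∀ (εγ : Fin D → ℝ) (εβ : Fin K → ℝ), (∀ d, 0 < εγ d ∧ εγ d < 1) →
      (∀ k, 0 < εβ k ∧ εβ k < 1) → ∀ (Y : Words D V N), 0 < lik θs Y →
      ∀ q : MeanField c D K V N, IsAlphaVB α θs Y q →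
      ∫⁻ θ, negLogLik Y θ ∂q.qθ ≤ ENNReal.ofReal (-Real.log (lik θs Y)
        + 2 * N * (∑ d, εγ d ^ 2 + ∑ k, εβ k ^ 2)
        + α⁻¹ * (B * complexity e s V εγ εβ)) := by
  obtain ⟨C, hC, hmass⟩ := exists_dirichlet_mass_ge c δ hc hδ
  refine ⟨C * (1 + 1 / δ), by positivity,
    fun α hα D K V N hD hN θs e s hS εγ εβ hεγ hεβ Y hY q hq => ?_⟩
  have := hS.neZero_K hD
  have := hS.neZero_V hD
  have hθ := hS.isParam
  have hN' : (0 : ℝ) < N := by exact_mod_cast hN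
  have hpost := posterior_mem hθ hY
  have hlogγ : ∀ d, 0 < -Real.log (εγ d) := fun d => by
    have := Real.log_neg (hεγ d).1 (hεγ d).2
    linarith
  -- For topic `k`, the weight of document `d` is the expected number of its words assigned to `k`,
  -- and the threshold for being heavy is `N`.
  choose ε' hε'0 hε'1 hε'sq hε'log using fun k => exists_radius
    (t := fun d => ∑ n, posterior θs Y n d k) (n := N)
    (fun d => Finset.sum_nonneg fun n _ => (hpost n d).1 k) hN' hεγ (hεβ k)
  have hcount : ∀ d, ∑ k, ∑ n, posterior θs Y n d k = N := fun d => by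
    rw [Finset.sum_comm]
    simp_rw [(hpost _ d).2]
    simp
  -- The prior mass is applied with the exact support size: it is at most `1/δ`, whereas the nominal
  -- sparsity `s k` may be arbitrarily large and would multiply the document logarithms below.
  let s' : Fin K → ℕ := fun k => {v | θs.2 k v ≠ 0}.ncard
  have hs'δ : ∀ k, (s' k : ℝ) ≤ 1 / δ := fun k => by
    rw [le_div_iff₀ hδ]
    exact ncard_support_mul_le (hS.simplex_β k) (hS.lower_β k)
  have hs' : ∀ k, (s' k : ℝ) ≤ s k := fun k => by exact_mod_cast hS.sparse_β k
  have hV1 : (1 : ℝ) ≤ V := by exact_mod_cast Nat.one_le_iff_ne_zero.2 (NeZero.ne V)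
  have hK1 : (1 : ℝ) ≤ K := by exact_mod_cast Nat.one_le_iff_ne_zero.2 (NeZero.ne K)
  have ha := fun d => hmass K (θs.1 d) (e d) (εγ d) (hS.simplex_γ d) (hS.sparse_γ d)
    (hS.lower_γ d) (hεγ d).1 (hεγ d).2
  have hb := fun k => hmass V (θs.2 k) (s' k) (ε' k) (hS.simplex_β k) le_rfl
    (hS.lower_β k) (hε'0 k) (hε'1 k)
  have ha0 : ∀ d, 0 ≤ C * (e d * Real.log (K / εγ d)) := fun d =>
    mul_nonneg hC.le (mul_nonneg (Nat.cast_nonneg _) (log_div_nonneg (hεγ d)))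
  have hb0 : ∀ k, 0 ≤ C * (s' k * Real.log (V / ε' k)) := fun k =>
    mul_nonneg hC.le (mul_nonneg (Nat.cast_nonneg _) (log_div_nonneg ⟨hε'0 k, hε'1 k⟩))
  have hpos : ∀ x : ℝ, 0 < ENNReal.ofReal (Real.exp x) := fun x =>
    ENNReal.ofReal_pos.2 (Real.exp_pos x)
  have hcore := (hq.objectiveCore_le _).trans (objectiveCore_truncatedPrior_le c hα hθ hY εγ ε'
    ha0 hb0 ha hb (fun d => ((hpos _).trans_le (ha d)).ne') (fun k => ((hpos _).trans_le (hb k)).ne')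
    inferInstance inferInstance)
  -- The Jensen gap and the divergence of the minimiser are nonnegative and are discarded.
  refine le_trans (le_trans ?_ hcore) (ENNReal.ofReal_le_ofReal ?_)
  · rw [objectiveCore, add_assoc]
    exact le_self_add
  · have h1 : ∑ k, (∑ d, ∑ n, posterior θs Y n d k) * ε' k ^ 2 ≤
        N * ∑ k, εβ k ^ 2 + N * ∑ d, εγ d ^ 2 := by
      calc _ ≤ ∑ k, (N * εβ k ^ 2 + ∑ d, (∑ n, posterior θs Y n d k) * εγ d ^ 2) :=
            Finset.sum_le_sum fun k _ => hε'sq k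
        _ = _ := by
            rw [Finset.sum_add_distrib, ← Finset.mul_sum, Finset.sum_comm]
            simp_rw [← Finset.sum_mul, hcount, Finset.mul_sum]
    have hL : ∑ d, -Real.log (εγ d) ≤ ∑ d, e d * Real.log (K / εγ d) := by
      refine Finset.sum_le_sum fun d _ => ?_
      have he : (1 : ℝ) ≤ e d := by
        exact_mod_cast (one_le_ncard_support (hS.simplex_γ d)).trans (hS.sparse_γ d)
      rw [Real.log_div (by positivity) (hεγ d).1.ne']
      have hlK := Real.log_nonneg hK1
      nlinarith [hlogγ d]
    have hsV0 : 0 ≤ ∑ k, s k * Real.log (V / εβ k) := Finset.sum_nonneg fun k _ =>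
      mul_nonneg (Nat.cast_nonneg _) (log_div_nonneg (hεβ k))
    -- The logarithmic cost of rebalancing, summed over topics, is `(1/δ) ∑ d, -log (εγ d)`, because
    -- the weights of each document sum to `N`; `hL` charges it to the document complexity.
    have h2 : ∑ k, s' k * Real.log (V / ε' k) ≤
        ∑ k, s k * Real.log (V / εβ k) + 1 / δ * ∑ d, e d * Real.log (K / εγ d) := by
      calc _ ≤ ∑ k, (s k * Real.log (V / εβ k) +
            1 / δ * ((∑ d, (∑ n, posterior θs Y n d k) * (-Real.log (εγ d))) / N)) := by
            refine Finset.sum_le_sum fun k _ => ?_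
            have hle : Real.log (V / ε' k) ≤ Real.log (V / εβ k) +
                (∑ d, (∑ n, posterior θs Y n d k) * (-Real.log (εγ d))) / N := by
              rw [Real.log_div (by positivity) (hε'0 k).ne',
                Real.log_div (by positivity) (hεβ k).1.ne']
              linarith [hε'log k]
            have hnn : 0 ≤ (∑ d, (∑ n, posterior θs Y n d k) * (-Real.log (εγ d))) / N :=
              div_nonneg (Finset.sum_nonneg fun d _ => mul_nonneg
                (Finset.sum_nonneg fun n _ => (hpost n d).1 k) (hlogγ d).le) hN'.le
            calc s' k * Real.log (V / ε' k) ≤ s' k * (Real.log (V / εβ k) +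
                (∑ d, (∑ n, posterior θs Y n d k) * (-Real.log (εγ d))) / N) :=
                  mul_le_mul_of_nonneg_left hle (Nat.cast_nonneg _)
              _ = s' k * Real.log (V / εβ k) + s' k *
                ((∑ d, (∑ n, posterior θs Y n d k) * (-Real.log (εγ d))) / N) := by ring
              _ ≤ _ := add_le_add
                (mul_le_mul_of_nonneg_right (hs' k) (log_div_nonneg (hεβ k)))
                (mul_le_mul_of_nonneg_right (hs'δ k) hnn)
        _ = ∑ k, s k * Real.log (V / εβ k) + 1 / δ * ∑ d, -Real.log (εγ d) := by
            rw [Finset.sum_add_distrib, ← Finset.mul_sum, ← Finset.sum_div, Finset.sum_comm]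
            simp_rw [← Finset.sum_mul, hcount]
            rw [← Finset.mul_sum]
            field_simp
        _ ≤ _ := by gcongr
    rw [← Finset.mul_sum, ← Finset.mul_sum, complexity]
    have h3 : C * ∑ d, e d * Real.log (K / εγ d) + C * ∑ k, s' k * Real.log (V / ε' k) ≤
        C * (1 + 1 / δ) * (∑ d, e d * Real.log (K / εγ d) + ∑ k, s k * Real.log (V / εβ k)) := by
      have hd : 0 ≤ 1 / δ * ∑ k, s k * Real.log (V / εβ k) := by positivity
      have := mul_le_mul_of_nonneg_left h2 hC.le
      have h5 := mul_nonneg hC.le hd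
      linear_combination this + h5
    have h4 := mul_le_mul_of_nonneg_left h3 (inv_pos.2 hα).le
    have h5 : 0 ≤ (N : ℝ) * ∑ k, εβ k ^ 2 := by positivity
    linarith

end Minimiser

/-! ### Deterministic likelihood-ratio bounds for one sample -/

section Sample

variable {ι Ω : Type*} [Fintype ι]

/-- The number of occurrences of a word. -/
def count [DecidableEq Ω] (w : ι → Ω) (v : Ω) : ℝ := ∑ i, if w i = v then 1 else 0

theorem count_nonneg [DecidableEq Ω] (w : ι → Ω) (v : Ω) : 0 ≤ count w v :=
  Finset.sum_nonneg fun i _ => by split_ifs <;> norm_num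

theorem count_eq_zero [DecidableEq Ω] {w : ι → Ω} {v : Ω} (h : ∀ i, w i ≠ v) : count w v = 0 :=
  Finset.sum_eq_zero fun i _ => if_neg (h i)

variable [Fintype Ω]

/-- The Hellinger-type affinity `∑ p^α q^(1-α)`. -/
noncomputable def affinity (α : ℝ) (p q : Ω → ℝ) : ℝ := ∑ v, p v ^ α * q v ^ (1 - α)

theorem affinity_pos {α : ℝ} {p q : Ω → ℝ} (hp : ∀ v, 0 < p v) (hq : q ∈ stdSimplex ℝ Ω) :
    0 < affinity α p q := by
  obtain ⟨v, hv⟩ := exists_ne_zero_of_mem_stdSimplex hq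
  have : ∀ v, 0 ≤ p v ^ α * q v ^ (1 - α) := fun v =>
    mul_nonneg (Real.rpow_nonneg (hp v).le _) (Real.rpow_nonneg (hq.1 v) _)
  refine lt_of_lt_of_le ?_ (Finset.single_le_sum (fun v _ => this v) (Finset.mem_univ v))
  exact mul_pos (Real.rpow_pos_of_pos (hp v) _)
    (Real.rpow_pos_of_pos (lt_of_le_of_ne (hq.1 v) hv.symm) _)

theorem affinity_le_one {α : ℝ} (hα : 0 ≤ α) (hα1 : α ≤ 1) {p q : Ω → ℝ}
    (hp : p ∈ stdSimplex ℝ Ω) (hq : q ∈ stdSimplex ℝ Ω) : affinity α p q ≤ 1 := by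
  calc affinity α p q ≤ ∑ v, (α * p v + (1 - α) * q v) :=
        Finset.sum_le_sum fun v _ => Real.geom_mean_le_arith_mean2_weighted hα (by linarith)
          (hp.1 v) (hq.1 v) (by ring)
    _ = 1 := by
        rw [Finset.sum_add_distrib, ← Finset.mul_sum, ← Finset.mul_sum, hp.2, hq.2]
        ring

/-- A crude fallback for atypical samples: `p^α q^(1-α)` at a single word is already at most the
whole affinity, so each word costs no more than `-log δ`. -/
theorem mul_sum_log_sub_log_affinity_le {α : ℝ} (hα : 0 < α) (hα1 : α < 1)
    {p q : Ω → ℝ} (hp : p ∈ stdSimplex ℝ Ω) (hp0 : ∀ v, 0 < p v) (hq : q ∈ stdSimplex ℝ Ω)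
    {δ : ℝ} (hδ : 0 < δ) {w : ι → Ω} (hw : ∀ i, δ ≤ q (w i)) :
    α * ∑ i, (Real.log (p (w i)) - Real.log (q (w i)))
      - (Fintype.card ι : ℝ) / 2 * Real.log (affinity α p q) ≤
      Fintype.card ι * (-Real.log δ) := by
  have hA := affinity_pos (α := α) hp0 hq
  have hlog : Real.log (affinity α p q) ≤ 0 :=
    Real.log_nonpos hA.le (affinity_le_one hα.le hα1.le hp hq)
  have hterm : ∀ i, α * (Real.log (p (w i)) - Real.log (q (w i))) ≤
      Real.log (affinity α p q) - Real.log δ := by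
    intro i
    have hqi : 0 < q (w i) := hδ.trans_le (hw i)
    have h1 : p (w i) ^ α * q (w i) ^ (1 - α) ≤ affinity α p q :=
      Finset.single_le_sum (f := fun v => p v ^ α * q v ^ (1 - α))
        (fun v _ => mul_nonneg (Real.rpow_nonneg (hp0 v).le _) (Real.rpow_nonneg (hq.1 v) _))
        (Finset.mem_univ (w i))
    have h2 := Real.log_le_log (mul_pos (Real.rpow_pos_of_pos (hp0 _) _)
      (Real.rpow_pos_of_pos hqi _)) h1
    rw [Real.log_mul (Real.rpow_pos_of_pos (hp0 _) _).ne' (Real.rpow_pos_of_pos hqi _).ne',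
      Real.log_rpow (hp0 _), Real.log_rpow hqi] at h2
    have h3 := Real.log_le_log hδ (hw i)
    linarith
  have hsum := Finset.sum_le_sum fun i (_ : i ∈ Finset.univ) => hterm i
  rw [← Finset.mul_sum, Finset.sum_const, Finset.card_univ, nsmul_eq_mul] at hsum
  have : (Fintype.card ι : ℝ) * Real.log (affinity α p q) ≤ 0 :=
    mul_nonpos_of_nonneg_of_nonpos (Nat.cast_nonneg _) hlog
  linarith

variable [DecidableEq Ω]

theorem sum_count_mul (w : ι → Ω) (f : Ω → ℝ) : ∑ v, count w v * f v = ∑ i, f (w i) := by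
  simp_rw [count, Finset.sum_mul]
  rw [Finset.sum_comm]
  exact Finset.sum_congr rfl fun i _ => by simp

theorem sum_count (w : ι → Ω) : ∑ v, count w v = Fintype.card ι := by
  have := sum_count_mul w fun _ => 1
  simpa using this

/-- Pearson's statistic. -/
noncomputable def chiSq (q : Ω → ℝ) (w : ι → Ω) : ℝ :=
  ∑ v, (count w v - Fintype.card ι * q v) ^ 2 / (Fintype.card ι * q v)

/-- The counts are split as `M q / 2` plus a remainder, which `hgood` makes nonnegative. The first
part gives the affinity by Jensen; the second is a multinomial log-likelihood whose supremum over
`p` is quadratic in the deviations. No covering of the parameter space is needed. -/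
theorem mul_sum_log_sub_log_affinity_le_chiSq [Nonempty ι] {α : ℝ} (hα : 0 < α)
    {p q : Ω → ℝ} (hp : p ∈ stdSimplex ℝ Ω) (hp0 : ∀ v, 0 < p v) (hq : q ∈ stdSimplex ℝ Ω)
    {w : ι → Ω} (hw : ∀ i, 0 < q (w i))
    (hgood : ∀ v, (Fintype.card ι : ℝ) * q v / 2 ≤ count w v) :
    α * ∑ i, (Real.log (p (w i)) - Real.log (q (w i)))
      - (Fintype.card ι : ℝ) / 2 * Real.log (affinity α p q) ≤ 2 * α * chiSq q w := by
  have hM : (0 : ℝ) < Fintype.card ι := by exact_mod_cast Fintype.card_pos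
  set M := (Fintype.card ι : ℝ)
  have hc0 : ∀ v, q v = 0 → count w v = 0 := fun v hv =>
    count_eq_zero fun i hi => by have := hw i; rw [hi, hv] at this; exact lt_irrefl _ this
  -- Jensen under `q`, applied to the ratio `p^α q^(1-α) / q = (p/q)^α`.
  have hJ : α * ∑ v, q v * (Real.log (p v) - Real.log (q v)) ≤ Real.log (affinity α p q) := by
    have := sum_mul_log_div_le (b := fun v => p v ^ α * q v ^ (1 - α)) hq
      (fun v => mul_nonneg (Real.rpow_nonneg (hp0 v).le _) (Real.rpow_nonneg (hq.1 v) _))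
      (fun v hv => mul_pos (Real.rpow_pos_of_pos (hp0 v) _)
        (Real.rpow_pos_of_pos (lt_of_le_of_ne (hq.1 v) hv.symm) _))
    refine le_trans (le_of_eq ?_) this
    rw [Finset.mul_sum]
    refine Finset.sum_congr rfl fun v _ => ?_
    rcases (hq.1 v).eq_or_lt with h | h
    · simp [← h]
    · rw [Real.log_div (mul_pos (Real.rpow_pos_of_pos (hp0 v) _)
        (Real.rpow_pos_of_pos h _)).ne' h.ne', Real.log_mul (Real.rpow_pos_of_pos (hp0 v) _).ne'
        (Real.rpow_pos_of_pos h _).ne', Real.log_rpow (hp0 v), Real.log_rpow h]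
      ring
  have hterm : ∀ v, (count w v - M / 2 * q v) * (Real.log (p v) - Real.log (q v)) ≤
      2 * ((count w v - M * q v) ^ 2 / (M * q v)) + M / 2 * p v - M / 2 * q v := by
    intro v
    rcases (hq.1 v).eq_or_lt with h | h
    · rw [← h, hc0 v h.symm]
      have := mul_pos hM (hp0 v)
      simp only [mul_zero, sub_zero, zero_mul, div_zero, zero_add]
      linarith
    · have hm0 : 0 ≤ count w v - M / 2 * q v := by linarith [hgood v]
      have hMq : 0 < M * q v := mul_pos hM h
      -- With `m` the remainder, `p/q` is factored through `m / (M q / 2)`, the ratio at which the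
      -- bound is tight, and `log x ≤ x - 1` is applied to each factor. The outcome is the Pearson
      -- term plus `M/2 (p v - q v)`, which cancels on summing over `v`.
      have hbound : (count w v - M / 2 * q v) * (Real.log (p v) - Real.log (q v)) ≤
          (count w v - M / 2 * q v) * ((count w v - M / 2 * q v) / (M / 2 * q v) - 1)
            + M / 2 * p v - (count w v - M / 2 * q v) := by
        set m := count w v - M / 2 * q v with hm
        rcases hm0.eq_or_lt with h0 | h0
        · rw [← h0]
          have := mul_pos hM (hp0 v)
          simp only [zero_mul]
          linarith
        · have hr : 0 < m / (M / 2 * q v) := by positivity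
          have h1 := Real.log_le_sub_one_of_pos hr
          have h2 := Real.log_le_sub_one_of_pos
            (show 0 < p v / q v / (m / (M / 2 * q v)) from div_pos (div_pos (hp0 v) h) hr)
          rw [Real.log_div (div_pos (hp0 v) h).ne' hr.ne', Real.log_div (hp0 v).ne' h.ne'] at h2
          have h3 : m * (p v / q v / (m / (M / 2 * q v))) = M / 2 * p v := by field_simp
          have h4 := mul_le_mul_of_nonneg_left (add_le_add h1 h2) h0.le
          linear_combination h4 + h3
      refine hbound.trans (le_of_eq ?_)
      field_simp
      ring
  have hsum := Finset.sum_le_sum fun v (_ : v ∈ Finset.univ) => hterm v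
  have hZ : ∑ v, (count w v - M / 2 * q v) * (Real.log (p v) - Real.log (q v)) =
      ∑ i, (Real.log (p (w i)) - Real.log (q (w i)))
        - M / 2 * ∑ v, q v * (Real.log (p v) - Real.log (q v)) := by
    rw [← sum_count_mul w fun v => Real.log (p v) - Real.log (q v), Finset.mul_sum,
      ← Finset.sum_sub_distrib]
    exact Finset.sum_congr rfl fun v _ => by ring
  have hR : ∑ v, (2 * ((count w v - M * q v) ^ 2 / (M * q v)) + M / 2 * p v - M / 2 * q v) =
      2 * ∑ v, (count w v - M * q v) ^ 2 / (M * q v) := by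
    rw [Finset.sum_sub_distrib, Finset.sum_add_distrib, ← Finset.mul_sum, ← Finset.mul_sum,
      ← Finset.mul_sum, hp.2, hq.2, add_sub_cancel_right]
  rw [hZ, hR] at hsum
  have h1 := mul_le_mul_of_nonneg_left hsum hα.le
  have h2 := mul_le_mul_of_nonneg_left hJ (half_pos hM).le
  rw [chiSq]
  linear_combination h1 + h2

end Sample

/-! ### Moments and tails of counts and of Pearson's statistic -/

section Concentration

open ProbabilityTheory

variable {V : ℕ} {ι : Type*} [Fintype ι]

/-- The distribution `multi(q)` of a word. -/
noncomputable def wordMeasure (q : Fin V → ℝ) : Measure (Fin V) :=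
  ∑ v, ENNReal.ofReal (q v) • Measure.dirac v

theorem wordMeasure_singleton (q : Fin V → ℝ) (v : Fin V) :
    wordMeasure q {v} = ENNReal.ofReal (q v) := by
  simp [wordMeasure, Set.indicator_apply, eq_comm]

theorem isProbabilityMeasure_wordMeasure {q : Fin V → ℝ} (hq : q ∈ stdSimplex ℝ (Fin V)) :
    IsProbabilityMeasure (wordMeasure q) := by
  refine ⟨?_⟩
  simp only [wordMeasure, Measure.coe_finsetSum, Finset.sum_apply, Measure.smul_apply,
    measure_univ, smul_eq_mul, mul_one]
  rw [← ENNReal.ofReal_sum_of_nonneg fun v _ => hq.1 v, hq.2, ENNReal.ofReal_one]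

theorem integral_wordMeasure {q : Fin V → ℝ} (hq : q ∈ stdSimplex ℝ (Fin V)) (f : Fin V → ℝ) :
    ∫ v, f v ∂wordMeasure q = ∑ v, q v * f v := by
  have := isProbabilityMeasure_wordMeasure hq
  rw [integral_fintype Integrable.of_finite]
  refine Finset.sum_congr rfl fun v _ => ?_
  rw [measureReal_def, wordMeasure_singleton, ENNReal.toReal_ofReal (hq.1 v), smul_eq_mul]

/-- The distribution of a sample of independent words. -/
noncomputable def sampleLaw (ι : Type*) [Fintype ι] (q : Fin V → ℝ) : Measure (ι → Fin V) :=
  Measure.pi fun _ => wordMeasure q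

theorem isProbabilityMeasure_sampleLaw {q : Fin V → ℝ} (hq : q ∈ stdSimplex ℝ (Fin V)) :
    IsProbabilityMeasure (sampleLaw ι q) := by
  have := isProbabilityMeasure_wordMeasure hq
  unfold sampleLaw
  infer_instance

theorem integral_exp_sum {q : Fin V → ℝ} (hq : q ∈ stdSimplex ℝ (Fin V)) (f : Fin V → ℝ) :
    ∫ w, Real.exp (∑ i, f (w i)) ∂sampleLaw ι q = (∑ v, q v * Real.exp (f v)) ^ Fintype.card ι := by
  have := isProbabilityMeasure_wordMeasure hq
  simp_rw [Real.exp_sum, sampleLaw]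
  rw [integral_fintype_prod_eq_pow fun v => Real.exp (f v), integral_wordMeasure hq]

/-- A lower tail bound for binomial counts. -/
theorem measureReal_count_le {q : Fin V → ℝ} (hq : q ∈ stdSimplex ℝ (Fin V)) (v : Fin V) :
    (sampleLaw ι q).real {w | count w v ≤ Fintype.card ι * q v / 2} ≤
      Real.exp (-(Fintype.card ι * q v / 8)) := by
  have := isProbabilityMeasure_sampleLaw (ι := ι) hq
  -- Chernoff at `-1/2`: since `exp (-1/2) ≤ 5/8`, the exponent is at most `1/4 - 3/8 = -1/8` times
  -- `M q v`.
  refine (measure_le_le_exp_mul_mgf (t := -1 / 2) _ (by norm_num) Integrable.of_finite).trans ?_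
  have hmgf : mgf (fun w : ι → Fin V => count w v) (sampleLaw ι q) (-1 / 2) ≤
      Real.exp (-(3 / 8 * q v)) ^ Fintype.card ι := by
    have h : ∀ w : ι → Fin V, -1 / 2 * count w v = ∑ i, if w i = v then (-1 / 2 : ℝ) else 0 := by
      intro w
      rw [count, Finset.mul_sum]
      simp
    simp_rw [mgf, h]
    rw [integral_exp_sum hq fun u => if u = v then (-1 / 2 : ℝ) else 0]
    refine pow_le_pow_left₀ (Finset.sum_nonneg fun u _ =>
      mul_nonneg (hq.1 u) (Real.exp_pos _).le) ?_ _
    have hE : ∑ u, q u * Real.exp (if u = v then (-1 / 2 : ℝ) else 0) =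
        1 + q v * (Real.exp (-1 / 2) - 1) := by
      have : ∀ u, q u * Real.exp (if u = v then (-1 / 2 : ℝ) else 0) =
          q u + if u = v then q u * (Real.exp (-1 / 2) - 1) else 0 := fun u => by
        split_ifs
        · ring
        · rw [Real.exp_zero]; ring
      simp_rw [this]
      rw [Finset.sum_add_distrib, hq.2]
      simp
    rw [hE]
    have he : Real.exp (-1 / 2) ≤ 5 / 8 := by
      rw [show (-1 / 2 : ℝ) = -(1 / 2) by norm_num, Real.exp_neg]
      have h1 := Real.quadratic_le_exp_of_nonneg (x := 1 / 2) (by norm_num)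
      calc (Real.exp (1 / 2))⁻¹ ≤ (13 / 8 : ℝ)⁻¹ := inv_anti₀ (by norm_num) (by linarith)
        _ ≤ 5 / 8 := by norm_num
    have h2 := mul_le_mul_of_nonneg_left he (hq.1 v)
    have h3 := Real.add_one_le_exp (-(3 / 8 * q v))
    linarith
  calc _ ≤ Real.exp (-(-1 / 2) * (Fintype.card ι * q v / 2)) *
        Real.exp (-(3 / 8 * q v)) ^ Fintype.card ι :=
        mul_le_mul_of_nonneg_left hmgf (Real.exp_pos _).le
    _ = _ := by
        rw [← Real.exp_nat_mul, ← Real.exp_add]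
        congr 1
        ring

/-- A centred indicator is bounded by one, so `exp x ≤ 1 + x + x²` applies and the linear term has
mean zero. -/
theorem sum_mul_exp_le {q : Fin V → ℝ} (hq : q ∈ stdSimplex ℝ (Fin V)) (v : Fin V) {t : ℝ}
    (ht : |t| ≤ 1) :
    ∑ u, q u * Real.exp (t * ((if u = v then 1 else 0) - q v)) ≤ Real.exp (t ^ 2) := by
  have hv0 := hq.1 v
  have hv1 := le_one_of_mem_stdSimplex hq v
  have hterm : ∀ u, Real.exp (t * ((if u = v then 1 else 0) - q v)) ≤
      1 + t * ((if u = v then 1 else 0) - q v) + t ^ 2 := by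
    intro u
    have hξ : |(if u = v then (1 : ℝ) else 0) - q v| ≤ 1 := by
      split_ifs <;> rw [abs_le] <;> constructor <;> linarith
    have h1 : |t * ((if u = v then (1 : ℝ) else 0) - q v)| ≤ 1 := by
      rw [abs_mul]; exact mul_le_one₀ ht (abs_nonneg _) hξ
    have h2 := (abs_le.1 (Real.abs_exp_sub_one_sub_id_le h1)).2
    have h3 : (t * ((if u = v then (1 : ℝ) else 0) - q v)) ^ 2 ≤ t ^ 2 := by
      rw [mul_pow]
      exact mul_le_of_le_one_right (sq_nonneg t) ((sq_le_one_iff_abs_le_one _).2 hξ)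
    linarith
  calc _ ≤ ∑ u, q u * (1 + t * ((if u = v then 1 else 0) - q v) + t ^ 2) :=
        Finset.sum_le_sum fun u _ => mul_le_mul_of_nonneg_left (hterm u) (hq.1 u)
    _ = t ^ 2 + 1 := by
        have : ∀ u, q u * (1 + t * ((if u = v then 1 else 0) - q v) + t ^ 2) =
            q u * (1 - t * q v + t ^ 2) + if u = v then t * q u else 0 := fun u => by
          split_ifs <;> ring
        simp_rw [this]
        rw [Finset.sum_add_distrib, ← Finset.sum_mul, hq.2]
        simp
        ring
    _ ≤ _ := Real.add_one_le_exp _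

/-- The fourth central moment of a count. -/
theorem integral_count_sub_pow_four_le [Nonempty ι] {q : Fin V → ℝ}
    (hq : q ∈ stdSimplex ℝ (Fin V)) (v : Fin V) :
    ∫ w, ((count w v - Fintype.card ι * q v) ^ 2 / Fintype.card ι) ^ 2 ∂sampleLaw ι q ≤ 144 := by
  have := isProbabilityMeasure_sampleLaw (ι := ι) hq
  have hM1 : (1 : ℝ) ≤ Fintype.card ι := by exact_mod_cast Fintype.card_pos (α := ι)
  set M := (Fintype.card ι : ℝ) with hMdef
  have hM : 0 < M := by linarith
  set r := 1 / Real.sqrt M with hr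
  have hr0 : 0 < r := by positivity
  have hr2 : r ^ 2 = 1 / M := by rw [hr, div_pow, Real.sq_sqrt hM.le, one_pow]
  have hr1 : r ≤ 1 := by
    rw [hr, div_le_one (by positivity)]
    exact Real.one_le_sqrt.2 hM1
  have hexp : ∀ t : ℝ, |t| ≤ 1 → t ^ 2 = 1 / M →
      ∫ w, Real.exp (t * (count w v - M * q v)) ∂sampleLaw ι q ≤ 3 := by
    intro t ht ht2
    have h : ∀ w : ι → Fin V, t * (count w v - M * q v) =
        ∑ i, t * ((if w i = v then (1 : ℝ) else 0) - q v) := by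
      intro w
      rw [← Finset.mul_sum, Finset.sum_sub_distrib, count, Finset.sum_const, Finset.card_univ,
        nsmul_eq_mul]
    simp_rw [h]
    rw [integral_exp_sum hq fun u => t * ((if u = v then (1 : ℝ) else 0) - q v)]
    calc _ ≤ Real.exp (t ^ 2) ^ Fintype.card ι :=
          pow_le_pow_left₀ (Finset.sum_nonneg fun u _ =>
            mul_nonneg (hq.1 u) (Real.exp_pos _).le) (sum_mul_exp_le hq v ht) _
      _ = Real.exp 1 := by
          rw [← Real.exp_nat_mul, ht2, ← hMdef, mul_one_div_cancel hM.ne']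
      _ ≤ 3 := by linarith [Real.exp_one_lt_d9]
  -- The fourth moment is read off from the exponential moments at `±1/√M`: each is at most `e ≤ 3`,
  -- and `4! · (3 + 3) = 144`.
  have hpt : ∀ x : ℝ, (x ^ 2 / M) ^ 2 ≤ 24 * (Real.exp (r * x) + Real.exp (-r * x)) := by
    intro x
    have h1 : (x ^ 2 / M) ^ 2 = |r * x| ^ 4 := by
      rw [show (4 : ℕ) = 2 * 2 from rfl, pow_mul, sq_abs, mul_pow, hr2]
      ring
    have h2 := Real.pow_div_factorial_le_exp |r * x| (abs_nonneg _) 4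
    have h3 : Real.exp |r * x| ≤ Real.exp (r * x) + Real.exp (-r * x) := by
      rw [neg_mul]
      exact Real.exp_abs_le _
    rw [h1]
    have h4 : ((4).factorial : ℝ) = 24 := by norm_num [Nat.factorial]
    rw [h4, div_le_iff₀ (by norm_num)] at h2
    linarith
  calc _ ≤ ∫ w, 24 * (Real.exp (r * (count w v - M * q v)) +
          Real.exp (-r * (count w v - M * q v))) ∂sampleLaw ι q :=
        integral_mono Integrable.of_finite Integrable.of_finite fun w => hpt _
    _ ≤ _ := by
        rw [integral_const_mul, integral_add Integrable.of_finite Integrable.of_finite]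
        have h1 := hexp r (by rwa [abs_of_pos hr0]) hr2
        have h2 := hexp (-r) (by rwa [abs_neg, abs_of_pos hr0]) (by rw [neg_sq, hr2])
        linarith

/-- The second moment of Pearson's statistic. -/
theorem integral_chiSq_sq_le [Nonempty ι] {q : Fin V → ℝ} (hq : q ∈ stdSimplex ℝ (Fin V)) {δ : ℝ}
    (hδ : 0 < δ) (hlow : ∀ v, q v ≠ 0 → δ ≤ q v) :
    ∫ w, chiSq q w ^ 2 ∂sampleLaw ι q ≤ 144 / δ ^ 4 := by
  have := isProbabilityMeasure_sampleLaw (ι := ι) hq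
  have hM : (0 : ℝ) < Fintype.card ι := by exact_mod_cast Fintype.card_pos (α := ι)
  set M := (Fintype.card ι : ℝ)
  have hpt : ∀ w : ι → Fin V, chiSq q w ^ 2 ≤
      ∑ v, q v * (((count w v - M * q v) ^ 2 / M) ^ 2 / δ ^ 4) := by
    intro w
    -- Pearson's statistic as a `q`-average, so that convexity of the square keeps the bound
    -- independent of the number of words. Null words drop out because division by zero is zero.
    have h1 : chiSq q w = ∑ v, q v * ((count w v - M * q v) ^ 2 / M / q v ^ 2) := by
      refine Finset.sum_congr rfl fun v _ => ?_
      rcases eq_or_ne (q v) 0 with h | h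
      · simp [h]
      · change (count w v - M * q v) ^ 2 / (M * q v) = _
        field_simp
    rw [h1]
    refine (Real.pow_arith_mean_le_arith_mean_pow _ _ _ (fun v _ => hq.1 v) hq.2
      (fun v _ => by positivity) 2).trans (Finset.sum_le_sum fun v _ => ?_)
    rcases eq_or_ne (q v) 0 with h | h
    · simp [h]
    · refine mul_le_mul_of_nonneg_left ?_ (hq.1 v)
      rw [div_pow, ← pow_mul]
      have := pow_le_pow_left₀ hδ.le (hlow v h) 4
      exact div_le_div_of_nonneg_left (by positivity) (by positivity) this
  calc _ ≤ ∫ w, ∑ v, q v * (((count w v - M * q v) ^ 2 / M) ^ 2 / δ ^ 4) ∂sampleLaw ι q :=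
        integral_mono Integrable.of_finite Integrable.of_finite hpt
    _ = ∑ v, q v * ((∫ w, ((count w v - M * q v) ^ 2 / M) ^ 2 ∂sampleLaw ι q) / δ ^ 4) := by
        rw [integral_finsetSum _ fun v _ => Integrable.of_finite]
        refine Finset.sum_congr rfl fun v _ => ?_
        rw [integral_const_mul, integral_div]
    _ ≤ ∑ v, q v * (144 / δ ^ 4) := by
        refine Finset.sum_le_sum fun v _ => mul_le_mul_of_nonneg_left ?_ (hq.1 v)
        exact div_le_div_of_nonneg_right (integral_count_sub_pow_four_le hq v) (by positivity)
    _ = 144 / δ ^ 4 := by rw [← Finset.sum_mul, hq.2, one_mul]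

/-- The samples in which some word is much rarer than expected. -/
def rareSet (q : Fin V → ℝ) (ι : Type*) [Fintype ι] : Set (ι → Fin V) :=
  {w | ∃ v, count w v < Fintype.card ι * q v / 2}

/-- A union bound over supported words only, of which there are at most `1/δ`; a null word can never
be rarer than expected. -/
theorem measureReal_rareSet_le {q : Fin V → ℝ} (hq : q ∈ stdSimplex ℝ (Fin V)) {δ : ℝ}
    (hδ : 0 < δ) (hlow : ∀ v, q v ≠ 0 → δ ≤ q v) :
    (sampleLaw ι q).real (rareSet q ι) ≤ 1 / δ * Real.exp (-(Fintype.card ι * δ / 8)) := by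
  classical
  have := isProbabilityMeasure_sampleLaw (ι := ι) hq
  have hsub : rareSet q ι ⊆ ⋃ v ∈ Finset.univ.filter fun v => q v ≠ 0,
      {w | count w v ≤ Fintype.card ι * q v / 2} := by
    rintro w ⟨v, hv⟩
    have hv0 : q v ≠ 0 := fun h => by
      rw [h, mul_zero, zero_div] at hv
      exact hv.not_ge (count_nonneg w v)
    simp only [Set.mem_iUnion, Set.mem_ofPred_eq, Finset.mem_filter, Finset.mem_univ, true_and,
      exists_prop]
    exact ⟨v, hv0, hv.le⟩
  calc (sampleLaw ι q).real (rareSet q ι)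
      ≤ (sampleLaw ι q).real (⋃ v ∈ Finset.univ.filter fun v => q v ≠ 0,
          {w | count w v ≤ Fintype.card ι * q v / 2}) :=
        measureReal_mono hsub (measure_ne_top _ _)
    _ ≤ ∑ v with q v ≠ 0, (sampleLaw ι q).real {w | count w v ≤ Fintype.card ι * q v / 2} :=
        measureReal_biUnion_finset_le _ _
    _ ≤ ∑ v with q v ≠ 0, Real.exp (-(Fintype.card ι * δ / 8)) := by
        refine Finset.sum_le_sum fun v hv => (measureReal_count_le hq v).trans ?_
        rw [Real.exp_le_exp, neg_le_neg_iff]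
        have := hlow v (Finset.mem_filter.1 hv).2
        gcongr
    _ ≤ _ := by
        rw [Finset.sum_const, nsmul_eq_mul]
        refine mul_le_mul_of_nonneg_right ?_ (Real.exp_pos _).le
        rw [le_div_iff₀ hδ]
        have := ncard_support_mul_le hq hlow
        rwa [Set.ncard_eq_toFinset_card', Set.toFinset_ofPred] at this

/-- The indicator carries weight `M` because `M` words pay the fallback bound on this event. The
exponential tail beats any power; the cubic bound `exp (-x) ≤ 6 / x³` leaves a factor `1/M`, which
the later Chebyshev step uses. -/
theorem integral_indicator_rareSet_le [Nonempty ι] {q : Fin V → ℝ}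
    (hq : q ∈ stdSimplex ℝ (Fin V)) {δ : ℝ}
    (hδ : 0 < δ) (hlow : ∀ v, q v ≠ 0 → δ ≤ q v) :
    ∫ w, ((rareSet q ι).indicator (fun _ => (Fintype.card ι : ℝ)) w) ^ 2 ∂sampleLaw ι q ≤
      3072 / δ ^ 4 / Fintype.card ι := by
  have := isProbabilityMeasure_sampleLaw (ι := ι) hq
  have hM : (0 : ℝ) < Fintype.card ι := by exact_mod_cast Fintype.card_pos (α := ι)
  set M := (Fintype.card ι : ℝ) with hMdef
  have h1 : ∀ w : ι → Fin V, ((rareSet q ι).indicator (fun _ => M) w) ^ 2 =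
      (rareSet q ι).indicator (fun _ => M ^ 2) w := fun w => by
    by_cases h : w ∈ rareSet q ι <;> simp [h]
  simp_rw [h1]
  rw [integral_indicator_const _ (Set.toFinite _).measurableSet, smul_eq_mul]
  have h2 := measureReal_rareSet_le (ι := ι) hq hδ hlow
  rw [← hMdef] at h2
  have h3 : Real.exp (-(M * δ / 8)) ≤ 6 / (M * δ / 8) ^ 3 := by
    have := Real.pow_div_factorial_le_exp (M * δ / 8) (by positivity) 3
    have h6 : ((3).factorial : ℝ) = 6 := by norm_num [Nat.factorial]
    rw [h6] at this
    rw [Real.exp_neg, ← inv_div ((M * δ / 8) ^ 3)]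
    exact inv_anti₀ (by positivity) this
  calc _ ≤ 1 / δ * (6 / (M * δ / 8) ^ 3) * M ^ 2 := by
        refine mul_le_mul_of_nonneg_right (h2.trans ?_) (sq_nonneg M)
        exact mul_le_mul_of_nonneg_left h3 (by positivity)
    _ = 3072 / δ ^ 4 / M := by
        field_simp
        norm_num

/-- Chebyshev's inequality for a sum of functions of independent variables. -/
theorem measureReal_le_sum_le {κ : Type*} [Fintype κ] {Ω : κ → Type*}
    [∀ i, MeasurableSpace (Ω i)] [∀ i, Finite (Ω i)] [∀ i, MeasurableSingletonClass (Ω i)]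
    (μ : ∀ i, Measure (Ω i)) [∀ i, IsProbabilityMeasure (μ i)] (X : ∀ i, Ω i → ℝ) {Q m t : ℝ}
    (hm : 0 ≤ m) (hQm : Q ≤ m ^ 2) (hX : ∀ i, ∫ ω, X i ω ^ 2 ∂μ i ≤ Q) (ht : 0 < t)
    (htm : 2 * Fintype.card κ * m ≤ t) :
    (Measure.pi μ).real {ω | t ≤ ∑ i, X i (ω i)} ≤ 4 * Fintype.card κ * Q / t ^ 2 := by
  have hvar_le : ∀ i, Var[X i; μ i] ≤ Q := fun i =>
    (variance_le_expectation_sq Measurable.of_discrete.aestronglyMeasurable).trans (hX i)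
  have hmean : ∀ i, ∫ ω, X i ω ∂μ i ≤ m := fun i => by
    have h1 := variance_eq_sub (μ := μ i) (X := X i) MemLp.of_discrete
    have h2 := variance_nonneg (X i) (μ i)
    have h3 : (∫ ω, X i ω ∂μ i) ^ 2 ≤ m ^ 2 := by
      have h4 := hX i
      simp only [Pi.pow_apply] at h1
      linarith
    exact le_of_sq_le_sq h3 hm
  have hmeansum : ∫ ω, (∑ i, fun ω : ∀ i, Ω i => X i (ω i)) ω ∂Measure.pi μ ≤ t / 2 := by
    simp only [Finset.sum_apply]
    rw [integral_finsetSum _ fun i _ => Integrable.of_finite]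
    calc _ = ∑ i, ∫ ω, X i ω ∂μ i := Finset.sum_congr rfl fun i _ =>
          integral_comp_eval Measurable.of_discrete.aestronglyMeasurable
      _ ≤ ∑ _i : κ, m := Finset.sum_le_sum fun i _ => hmean i
      -- Half of the threshold `t` covers the mean, so Chebyshev acts on a deviation of `t / 2`.
      _ ≤ t / 2 := by
          rw [Finset.sum_const, Finset.card_univ, nsmul_eq_mul]
          linarith
  have hch := meas_ge_le_variance_div_sq (μ := Measure.pi μ)
    (X := ∑ i, fun ω : ∀ i, Ω i => X i (ω i)) MemLp.of_discrete (half_pos ht)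
  have hvar : Var[∑ i, fun ω : ∀ i, Ω i => X i (ω i); Measure.pi μ] ≤ Fintype.card κ * Q := by
    rw [variance_sum_pi fun i => MemLp.of_discrete]
    calc _ ≤ ∑ _i : κ, Q := Finset.sum_le_sum fun i _ => hvar_le i
      _ = _ := by rw [Finset.sum_const, Finset.card_univ, nsmul_eq_mul]
  have hsub : {ω : ∀ i, Ω i | t ≤ ∑ i, X i (ω i)} ⊆
      {ω | t / 2 ≤ |(∑ i, fun ω : ∀ i, Ω i => X i (ω i)) ω -
        ∫ ω, (∑ i, fun ω : ∀ i, Ω i => X i (ω i)) ω ∂Measure.pi μ|} := by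
    intro ω hω
    have hω' : t ≤ ∑ i, X i (ω i) := hω
    rw [← Finset.sum_apply ω Finset.univ fun i (ω : ∀ i, Ω i) => X i (ω i)] at hω'
    change t / 2 ≤ |_|
    refine le_trans ?_ (le_abs_self _)
    linarith
  have h1 := ENNReal.toReal_mono ENNReal.ofReal_ne_top ((measure_mono hsub).trans hch)
  rw [ENNReal.toReal_ofReal (div_nonneg (variance_nonneg _ _) (by positivity))] at h1
  refine h1.trans ?_
  rw [div_pow, div_div_eq_mul_div]
  refine div_le_div_of_nonneg_right ?_ (by positivity)
  linarith

end Concentration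

/-! ### The law of the data and the likelihood ratio over all documents -/

section DataLaw

variable {D K V N : ℕ}

theorem dataLaw_singleton (θ : Param D K V) (Y : Words D V N) :
    dataLaw N θ {Y} = ENNReal.ofReal (lik θ Y) := by
  simp [dataLaw, Set.indicator_apply, eq_comm]

/-- The words of one document. -/
def docWords (Y : Words D V N) (d : Fin D) : Fin N → Fin V := fun n => Y n d

/-- The words of all documents. -/
def pooledWords (Y : Words D V N) : Fin N × Fin D → Fin V := fun i => Y i.1 i.2

theorem map_docWords_dataLaw {θ : Param D K V} (hθ : IsParam θ) :
    dataLaw N θ = (Measure.pi fun d => sampleLaw (Fin N) (wordProb θ d)).map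
      fun w n d => w d n := by
  have := fun d => isProbabilityMeasure_wordMeasure (hθ.wordProb_mem d)
  have := fun d => isProbabilityMeasure_sampleLaw (ι := Fin N) (hθ.wordProb_mem d)
  refine Measure.ext_of_singleton fun Y => ?_
  have hpre : (fun (w : Fin D → Fin N → Fin V) n d => w d n) ⁻¹' {Y} = {docWords Y} := by
    ext w
    simp only [Set.mem_preimage, Set.mem_singleton_iff, docWords, funext_iff]
    exact forall_comm
  rw [Measure.map_apply Measurable.of_discrete (measurableSet_singleton Y), hpre,
    Measure.pi_singleton, dataLaw_singleton, lik_eq_prod, Finset.prod_comm]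
  simp_rw [sampleLaw, Measure.pi_singleton, wordMeasure_singleton, docWords]
  rw [ENNReal.ofReal_prod_of_nonneg fun d _ => Finset.prod_nonneg fun n _ =>
    (hθ.wordProb_mem d).1 _]
  exact Finset.prod_congr rfl fun d _ =>
    ENNReal.ofReal_prod_of_nonneg fun n _ => (hθ.wordProb_mem d).1 _

theorem map_pooledWords_dataLaw {θ : Param D K V} {q : Fin V → ℝ} (hq : q ∈ stdSimplex ℝ (Fin V))
    (h : ∀ d, wordProb θ d = q) :
    dataLaw N θ = (sampleLaw (Fin N × Fin D) q).map fun w n d => w (n, d) := by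
  have := isProbabilityMeasure_wordMeasure hq
  have := isProbabilityMeasure_sampleLaw (ι := Fin N × Fin D) hq
  refine Measure.ext_of_singleton fun Y => ?_
  have hpre : (fun (w : Fin N × Fin D → Fin V) n d => w (n, d)) ⁻¹' {Y} = {pooledWords Y} := by
    ext w
    simp only [Set.mem_preimage, Set.mem_singleton_iff, pooledWords, funext_iff, Prod.forall]
  rw [Measure.map_apply Measurable.of_discrete (measurableSet_singleton Y), hpre,
    sampleLaw, Measure.pi_singleton, dataLaw_singleton, lik_eq_prod]
  simp_rw [wordMeasure_singleton, pooledWords, h]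
  rw [← ENNReal.ofReal_prod_of_nonneg fun d _ => hq.1 _, Fintype.prod_prod_type]

theorem isProbabilityMeasure_dataLaw {θ : Param D K V} (hθ : IsParam θ) :
    IsProbabilityMeasure (dataLaw N θ) := by
  have := fun d => isProbabilityMeasure_sampleLaw (ι := Fin N) (hθ.wordProb_mem d)
  rw [map_docWords_dataLaw hθ]
  exact Measure.isProbabilityMeasure_map Measurable.of_discrete.aemeasurable

theorem ae_lik_pos (θ : Param D K V) : ∀ᵐ Y ∂dataLaw N θ, 0 < lik θ Y := by
  rw [ae_iff_of_countable]
  intro Y hY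
  rw [dataLaw_singleton] at hY
  by_contra h
  exact hY (ENNReal.ofReal_of_nonpos (not_lt.1 h))

/-- A nonzero mixture probability has at least one nonzero summand, and both of its factors are at
least `δ`. Hence `δ ^ 2` is the lower bound used for word distributions. -/
theorem AssumptionS.wordProb_ge {δ : ℝ} (hδ : 0 < δ) {θ : Param D K V} {e : Fin D → ℕ}
    {s : Fin K → ℕ} (h : AssumptionS δ θ e s) (d : Fin D) (v : Fin V)
    (hv : wordProb θ d v ≠ 0) : δ ^ 2 ≤ wordProb θ d v := by
  obtain ⟨k, -, hk⟩ := Finset.exists_ne_zero_of_sum_ne_zero hv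
  have h1 := h.lower_γ d k (left_ne_zero_of_mul hk)
  have h2 := h.lower_β k v (right_ne_zero_of_mul hk)
  calc δ ^ 2 = δ * δ := sq δ
    _ ≤ θ.1 d k * θ.2 k v := mul_le_mul h1 h2 hδ.le (hδ.le.trans h1)
    _ ≤ _ := Finset.single_le_sum (f := fun k => θ.1 d k * θ.2 k v)
      (fun k _ => mul_nonneg ((h.simplex_γ d).1 k) ((h.simplex_β k).1 v)) (Finset.mem_univ k)

theorem log_lik {θ : Param D K V} {Y : Words D V N} (h : ∀ n d, 0 < wordProb θ d (Y n d)) :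
    Real.log (lik θ Y) = ∑ d, ∑ n, Real.log (wordProb θ d (Y n d)) := by
  rw [lik_eq_prod, Finset.prod_comm, Real.log_prod fun d _ =>
    (Finset.prod_pos fun n _ => h n d).ne']
  exact Finset.sum_congr rfl fun d _ => Real.log_prod fun n _ => (h n d).ne'

/-- The likelihood ratio, document by document. -/
theorem log_lik_ratio_le_sum_docs [NeZero K] [NeZero N] {α δ : ℝ} (hα : 0 < α) (hα1 : α < 1)
    (hδ : 0 < δ)
    {θs θ : Param D K V} (hθs : IsParam θs) (hlow : ∀ d v, wordProb θs d v ≠ 0 → δ ≤ wordProb θs d v)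
    (hθ : IsPosParam θ) {Y : Words D V N} (hY : 0 < lik θs Y) :
    α * (Real.log (lik θ Y) - Real.log (lik θs Y))
      - N / 2 * ∑ d, Real.log (affinity α (wordProb θ d) (wordProb θs d)) ≤
      2 * α * ∑ d, chiSq (wordProb θs d) (docWords Y d)
        + -Real.log δ * ∑ d, (rareSet (wordProb θs d) (Fin N)).indicator (fun _ => (N : ℝ))
          (docWords Y d) := by
  have hpos := wordProb_pos_of_lik_pos hθs hY
  rw [log_lik hpos, log_lik fun n d => hθ.wordProb_pos d _, ← Finset.sum_sub_distrib,
    Finset.mul_sum, Finset.mul_sum, ← Finset.sum_sub_distrib, Finset.mul_sum, Finset.mul_sum,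
    ← Finset.sum_add_distrib]
  refine Finset.sum_le_sum fun d _ => ?_
  rw [← Finset.sum_sub_distrib]
  have hchi : 0 ≤ chiSq (wordProb θs d) (docWords Y d) := Finset.sum_nonneg fun v _ =>
    div_nonneg (sq_nonneg _) (mul_nonneg (Nat.cast_nonneg _) ((hθs.wordProb_mem d).1 v))
  have hp := hθ.isParam.wordProb_mem d
  have hp0 := hθ.wordProb_pos d
  have hq := hθs.wordProb_mem d
  -- Atypical documents pay the fallback bound `N (-log δ)`, recorded by the indicator; the others
  -- pay Pearson's statistic.
  by_cases h : docWords Y d ∈ rareSet (wordProb θs d) (Fin N)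
  · have := mul_sum_log_sub_log_affinity_le (w := docWords Y d) hα hα1 hp hp0 hq hδ
      fun n => hlow d _ (hpos n d).ne'
    rw [Set.indicator_of_mem h]
    rw [Fintype.card_fin] at this
    have h2 : 0 ≤ 2 * α * chiSq (wordProb θs d) (docWords Y d) := by positivity
    simp only [docWords] at this h2 ⊢
    linarith
  · rw [Set.indicator_of_notMem h, mul_zero, add_zero]
    have hg : ∀ v, (Fintype.card (Fin N) : ℝ) * wordProb θs d v / 2 ≤ count (docWords Y d) v := by
      intro v
      by_contra hv
      exact h ⟨v, not_le.1 hv⟩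
    have : Nonempty (Fin N) := ⟨0⟩
    have := mul_sum_log_sub_log_affinity_le_chiSq hα hp hp0 hq (w := docWords Y d)
      (fun n => hpos n d) hg
    rw [Fintype.card_fin] at this
    exact this

/-- The likelihood ratio, if all documents have the same word distribution. -/
theorem log_lik_ratio_le_pooled [NeZero K] [NeZero N] [NeZero D] {α : ℝ} (hα : 0 < α)
    {θs θ : Param D K V} (hθs : IsParam θs) (hθ : IsPosParam θ) {p q : Fin V → ℝ}
    (hp : ∀ d, wordProb θ d = p) (hq : ∀ d, wordProb θs d = q)
    {Y : Words D V N} (hY : 0 < lik θs Y) (hrare : pooledWords Y ∉ rareSet q (Fin N × Fin D)) :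
    α * (Real.log (lik θ Y) - Real.log (lik θs Y))
      - N / 2 * ∑ d, Real.log (affinity α (wordProb θ d) (wordProb θs d)) ≤
      2 * α * chiSq q (pooledWords Y) := by
  have hpos := wordProb_pos_of_lik_pos hθs hY
  have hg : ∀ v, (Fintype.card (Fin N × Fin D) : ℝ) * q v / 2 ≤ count (pooledWords Y) v := by
    intro v
    by_contra hv
    exact hrare ⟨v, not_le.1 hv⟩
  have : Nonempty (Fin N × Fin D) := ⟨(0, 0)⟩
  have := mul_sum_log_sub_log_affinity_le_chiSq (p := p) (q := q) hα
    (hp 0 ▸ hθ.isParam.wordProb_mem 0) (hp 0 ▸ hθ.wordProb_pos 0) (hq 0 ▸ hθs.wordProb_mem 0)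
    (w := pooledWords Y) (fun i => hq i.2 ▸ hpos i.1 i.2) hg
  refine le_trans (le_of_eq ?_) this
  rw [log_lik hpos, log_lik fun n d => hθ.wordProb_pos d _]
  simp_rw [hp, hq, ← Finset.sum_sub_distrib, Fintype.sum_prod_type, pooledWords]
  rw [Finset.sum_comm, Finset.sum_const, Finset.card_univ, Fintype.card_prod, Fintype.card_fin,
    Fintype.card_fin, nsmul_eq_mul]
  push_cast
  ring

/-- Every sparsity is at least one and every logarithm at least `log 2`. This lets the complexity
absorb random fluctuations of order `D + K`; it can fail when `K` or `V` is one. -/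
theorem complexity_ge {δ : ℝ} {θs : Param D K V} {e : Fin D → ℕ} {s : Fin K → ℕ}
    (hS : AssumptionS δ θs e s) {εγ : Fin D → ℝ} {εβ : Fin K → ℝ}
    (hεγ : ∀ d, 0 < εγ d ∧ εγ d < 1) (hεβ : ∀ k, 0 < εβ k ∧ εβ k < 1) (hK : 2 ≤ K) (hV : 2 ≤ V) :
    Real.log 2 * (D + K) ≤ complexity e s V εγ εβ := by
  have key : ∀ (m n : ℕ) (ε : ℝ), 2 ≤ m → 1 ≤ n → 0 < ε ∧ ε < 1 →
      Real.log 2 ≤ n * Real.log (m / ε) := by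
    intro m n ε hm hn hε
    have hm' : (2 : ℝ) ≤ m := by exact_mod_cast hm
    have hn' : (1 : ℝ) ≤ n := by exact_mod_cast hn
    have h1 : Real.log 2 ≤ Real.log (m / ε) := by
      refine Real.log_le_log two_pos ?_
      rw [le_div_iff₀ hε.1]
      linarith [hε.2]
    have h2 : 0 < Real.log 2 := Real.log_pos (by norm_num)
    exact h1.trans (le_mul_of_one_le_left (h2.le.trans h1) hn')
  calc Real.log 2 * (D + K) = ∑ _d : Fin D, Real.log 2 + ∑ _k : Fin K, Real.log 2 := by
        simp; ring
    _ ≤ _ := add_le_add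
        (Finset.sum_le_sum fun d _ => key K (e d) _ hK
          ((one_le_ncard_support (hS.simplex_γ d)).trans (hS.sparse_γ d)) (hεγ d))
        (Finset.sum_le_sum fun k _ => key V (s k) _ hV
          ((one_le_ncard_support (hS.simplex_β k)).trans (hS.sparse_β k)) (hεβ k))

theorem complexity_nonneg [NeZero K] [NeZero V] (e : Fin D → ℕ) (s : Fin K → ℕ) {εγ : Fin D → ℝ}
    {εβ : Fin K → ℝ} (hεγ : ∀ d, 0 < εγ d ∧ εγ d < 1) (hεβ : ∀ k, 0 < εβ k ∧ εβ k < 1) :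
    0 ≤ complexity e s V εγ εβ :=
  add_nonneg
    (Finset.sum_nonneg fun d _ => mul_nonneg (Nat.cast_nonneg _) (log_div_nonneg (hεγ d)))
    (Finset.sum_nonneg fun k _ => mul_nonneg (Nat.cast_nonneg _) (log_div_nonneg (hεβ k)))

/-- Concentration for many documents. -/
theorem measureReal_docs_le {θ : Param D K V} (hθ : IsParam θ) (hD : 0 < D) (hN : 0 < N) {δ : ℝ}
    (hδ : 0 < δ) (hlow : ∀ d v, wordProb θ d v ≠ 0 → δ ≤ wordProb θ d v) {r : ℝ} (hr : 0 < r)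
    (hrDK : r ≤ D + K) :
    (dataLaw N θ).real ({Y | 24 / δ ^ 2 * max (N * r) D ≤
        ∑ d, chiSq (wordProb θ d) (docWords Y d)} ∪
      {Y | 112 / δ ^ 2 * (D + K) ≤ ∑ d, (rareSet (wordProb θ d) (Fin N)).indicator
        (fun _ => (N : ℝ)) (docWords Y d)}) ≤ 2 / (N * r) := by
  have := fun d => isProbabilityMeasure_sampleLaw (ι := Fin N) (hθ.wordProb_mem d)
  have : Nonempty (Fin N) := ⟨⟨0, hN⟩⟩
  have hD' : (0 : ℝ) < D := by exact_mod_cast hD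
  have hN' : (1 : ℝ) ≤ N := by exact_mod_cast hN
  have hmax : (D : ℝ) ≤ max (N * r) D := le_max_right _ _
  have hmax' : N * r ≤ max (N * r) D := le_max_left _ _
  have hmax0 : 0 < max (N * r) D := hD'.trans_le hmax
  have htr : ∀ s : Set (Words D V N), (dataLaw N θ).real s =
      (Measure.pi fun d => sampleLaw (Fin N) (wordProb θ d)).real
        ((fun (w : Fin D → Fin N → Fin V) n d => w d n) ⁻¹' s) := fun s => by
    rw [map_docWords_dataLaw hθ, map_measureReal_apply Measurable.of_discrete
      (Set.toFinite s).measurableSet]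
  have h1 : (dataLaw N θ).real {Y | 24 / δ ^ 2 * max (N * r) D ≤
        ∑ d, chiSq (wordProb θ d) (docWords Y d)} ≤ 1 / (N * r) := by
    rw [htr]
    -- The mean bound `12 / δ²` is the root of the second-moment bound `144 / δ⁴`. A threshold
    -- containing both `D` and `N r` dominates the mean and turns the variance ratio into `1 / (N
    -- r)`.
    refine (measureReal_le_sum_le (fun d => sampleLaw (Fin N) (wordProb θ d))
      (fun d w => chiSq (wordProb θ d) w) (Q := 144 / δ ^ 4) (m := 12 / δ ^ 2)
      (t := 24 / δ ^ 2 * max (N * r) D) (by positivity) (le_of_eq (by ring))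
      (fun d => integral_chiSq_sq_le (hθ.wordProb_mem d) hδ (hlow d)) (by positivity) ?_).trans ?_
    · rw [Fintype.card_fin]
      calc 2 * (D : ℝ) * (12 / δ ^ 2) = 24 / δ ^ 2 * D := by ring
        _ ≤ _ := by gcongr
    · rw [Fintype.card_fin]
      calc 4 * (D : ℝ) * (144 / δ ^ 4) / (24 / δ ^ 2 * max (N * r) D) ^ 2
          = D / (max (N * r) D * max (N * r) D) := by field_simp; norm_num
        _ ≤ D / (N * r * D) := by gcongr
        _ = 1 / (N * r) := by field_simp
  have h2 : (dataLaw N θ).real {Y | 112 / δ ^ 2 * (D + K) ≤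
      ∑ d, (rareSet (wordProb θ d) (Fin N)).indicator (fun _ => (N : ℝ)) (docWords Y d)} ≤
      1 / (N * r) := by
    rw [htr]
    -- Excluding all atypical documents by a union bound would cost a factor `D`; their total weight
    -- is controlled instead. Here `56² = 3136 ≥ 3072`, and `r ≤ D + K` yields the probability `1 /
    -- (N r)`.
    refine (measureReal_le_sum_le (fun d => sampleLaw (Fin N) (wordProb θ d))
      (fun d w => (rareSet (wordProb θ d) (Fin N)).indicator (fun _ => (N : ℝ)) w)
      (Q := 3072 / δ ^ 4 / N) (m := 56 / δ ^ 2)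
      (t := 112 / δ ^ 2 * (D + K)) (by positivity) ?_ (fun d => ?_) (by positivity) ?_).trans ?_
    · calc 3072 / δ ^ 4 / (N : ℝ) ≤ 3072 / δ ^ 4 := div_le_self (by positivity) hN'
        _ ≤ 3136 / δ ^ 4 := by gcongr; norm_num
        _ = _ := by ring
    · have := integral_indicator_rareSet_le (ι := Fin N) (hθ.wordProb_mem d) hδ (hlow d)
      rwa [Fintype.card_fin] at this
    · rw [Fintype.card_fin]
      calc 2 * (D : ℝ) * (56 / δ ^ 2) = 112 / δ ^ 2 * D := by ring
        _ ≤ _ := by gcongr; linarith [(Nat.cast_nonneg K : (0 : ℝ) ≤ K)]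
    · rw [Fintype.card_fin]
      have hK0 : (0 : ℝ) ≤ K := Nat.cast_nonneg K
      calc 4 * (D : ℝ) * (3072 / δ ^ 4 / N) / (112 / δ ^ 2 * (D + K)) ^ 2
          = 48 / 49 * (D / (N * ((D + K) * (D + K)))) := by field_simp; norm_num
        _ ≤ 1 * (D / (N * (r * D))) := by gcongr <;> linarith
        _ = 1 / (N * r) := by field_simp
  calc _ ≤ _ := measureReal_union_le _ _
    _ ≤ 1 / (N * r) + 1 / (N * r) := add_le_add h1 h2
    _ = _ := by ring

/-- Concentration for a single topic. -/
theorem measureReal_pooled_le {θ : Param D K V} {q : Fin V → ℝ} (hq : q ∈ stdSimplex ℝ (Fin V))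
    (hθ : ∀ d, wordProb θ d = q) (hD : 0 < D) (hN : 0 < N) {δ : ℝ}
    (hδ : 0 < δ) (hlow : ∀ v, q v ≠ 0 → δ ≤ q v) {r : ℝ} (hr : 1 ≤ N * r)
    (hrD : r ≤ D + 1) :
    (dataLaw N θ).real ({Y | N * r ≤ chiSq q (pooledWords Y)} ∪
      {Y | pooledWords Y ∈ rareSet q (Fin N × Fin D)}) ≤
      (144 / δ ^ 4 + 16 / δ ^ 2) / (N * r) := by
  have := isProbabilityMeasure_sampleLaw (ι := Fin N × Fin D) hq
  have : Nonempty (Fin N × Fin D) := ⟨(⟨0, hN⟩, ⟨0, hD⟩)⟩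
  have hD' : (1 : ℝ) ≤ D := by exact_mod_cast hD
  have hN' : (1 : ℝ) ≤ N := by exact_mod_cast hN
  have hNr : 0 < N * r := by linarith
  have htr : ∀ s : Set (Words D V N), (dataLaw N θ).real s = (sampleLaw (Fin N × Fin D) q).real
        ((fun (w : Fin N × Fin D → Fin V) n d => w (n, d)) ⁻¹' s) := fun s => by
    rw [map_pooledWords_dataLaw hq hθ, map_measureReal_apply Measurable.of_discrete
      (Set.toFinite s).measurableSet]
  have h1 : (dataLaw N θ).real {Y | N * r ≤ chiSq q (pooledWords Y)} ≤
      144 / δ ^ 4 / (N * r) := by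
    rw [htr]
    have hM := mul_meas_ge_le_integral_of_nonneg (μ := sampleLaw (Fin N × Fin D) q)
      (f := fun w => chiSq q w ^ 2) (ae_of_all _ fun w => sq_nonneg _) Integrable.of_finite
      (N * r)
    rw [le_div_iff₀ hNr, mul_comm]
    refine le_trans ?_ (hM.trans (integral_chiSq_sq_le hq hδ hlow))
    refine mul_le_mul_of_nonneg_left (measureReal_mono fun w hw => ?_) hNr.le
    have hw' : N * r ≤ chiSq q w := hw
    -- Because `N r ≥ 1`, exceeding `N r` forces the square to exceed it too, so Markov for the
    -- second moment suffices.
    change N * r ≤ chiSq q w ^ 2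
    nlinarith
  have h2 : (dataLaw N θ).real {Y | pooledWords Y ∈ rareSet q (Fin N × Fin D)} ≤
      16 / δ ^ 2 / (N * r) := by
    rw [htr]
    refine (measureReal_rareSet_le (ι := Fin N × Fin D) hq hδ hlow).trans ?_
    rw [Fintype.card_prod, Fintype.card_fin, Fintype.card_fin]
    push_cast
    have hx : 0 < (N : ℝ) * D * δ / 8 := by positivity
    have he : Real.exp (-(N * D * δ / 8)) ≤ 1 / (N * D * δ / 8) := by
      rw [Real.exp_neg, ← one_div]
      exact one_div_le_one_div_of_le hx (by linarith [Real.add_one_le_exp ((N : ℝ) * D * δ / 8)])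
    calc 1 / δ * Real.exp (-(N * D * δ / 8)) ≤ 1 / δ * (1 / (N * D * δ / 8)) := by gcongr
      -- The factor two is created so that `r ≤ D + 1 ≤ 2 D` applies.
      _ = 16 / δ ^ 2 / (N * (2 * D)) := by field_simp; norm_num
      _ ≤ _ := by gcongr; linarith
  calc _ ≤ _ := measureReal_union_le _ _
    _ ≤ _ := add_le_add h1 h2
    _ = _ := by ring

end DataLaw

/-! ### Uniform likelihood control, Rényi risk and Hellinger risk -/

section Risk

variable {D K V N : ℕ}

/-- The likelihood ratio is controlled, uniformly over the parameter, on a likely event. -/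
theorem exists_log_lik_ratio_le (δ : ℝ) (hδ : 0 < δ) :
    ∃ A C : ℝ, 0 < A ∧ 0 < C ∧ ∀ (D K V N : ℕ), 0 < D → 0 < N →
      ∀ (θs : Param D K V) (e : Fin D → ℕ) (s : Fin K → ℕ), AssumptionS δ θs e s →
      ∀ (εγ : Fin D → ℝ) (εβ : Fin K → ℝ), (∀ d, 0 < εγ d ∧ εγ d < 1) →
      (∀ k, 0 < εβ k ∧ εβ k < 1) → 1 ≤ N * (∑ d, εγ d ^ 2 + ∑ k, εβ k ^ 2) →
      ∃ G : Set (Words D V N),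
        (dataLaw N θs).real Gᶜ ≤ C / (N * (∑ d, εγ d ^ 2 + ∑ k, εβ k ^ 2)) ∧
        ∀ Y ∈ G, 0 < lik θs Y → ∀ α : ℝ, 0 < α → α < 1 → ∀ θ : Param D K V, IsPosParam θ →
          α * (Real.log (lik θ Y) - Real.log (lik θs Y))
            - N / 2 * ∑ d, Real.log (affinity α (wordProb θ d) (wordProb θs d)) ≤
          A * (α * (N * (∑ d, εγ d ^ 2 + ∑ k, εβ k ^ 2)) + complexity e s V εγ εβ) := by
  have hδ2 : 0 < δ ^ 2 := by positivity
  have hl2 : 0 < Real.log 2 := Real.log_pos (by norm_num)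
  refine ⟨2 + 48 / (δ ^ 2) ^ 2
      + (48 / (δ ^ 2) ^ 2 + |Real.log (δ ^ 2)| * (112 / (δ ^ 2) ^ 2)) / Real.log 2,
    2 + (144 / (δ ^ 2) ^ 4 + 16 / (δ ^ 2) ^ 2), by positivity, by positivity,
    fun D K V N hD hN θs e s hS εγ εβ hεγ hεβ hr1 => ?_⟩
  set r := ∑ d, εγ d ^ 2 + ∑ k, εβ k ^ 2 with hr
  set c₁ := 48 / (δ ^ 2) ^ 2 with hc₁
  set c₂ := |Real.log (δ ^ 2)| * (112 / (δ ^ 2) ^ 2) with hc₂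
  have hc₁0 : 0 < c₁ := by positivity
  have hc₂0 : 0 ≤ c₂ := by positivity
  have hq0 : 0 ≤ (c₁ + c₂) / Real.log 2 := by positivity
  have hc4 : 0 < 144 / (δ ^ 2) ^ 4 + 16 / (δ ^ 2) ^ 2 := by positivity
  have := hS.neZero_K hD
  have := hS.neZero_V hD
  have : NeZero D := ⟨hD.ne'⟩
  have : NeZero N := ⟨hN.ne'⟩
  have hθs := hS.isParam
  have hlow := hS.wordProb_ge hδ
  have hN' : (0 : ℝ) < N := by exact_mod_cast hN
  have hNr : 0 < N * r := by linarith
  have hr0 : 0 < r := pos_of_mul_pos_right hNr hN'.le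
  have hcx := complexity_nonneg (V := V) e s hεγ hεβ
  have hrDK : r ≤ D + K := by
    have h : ∀ x : ℝ, 0 < x ∧ x < 1 → x ^ 2 ≤ 1 := fun x hx => by nlinarith [hx.1, hx.2]
    calc r ≤ ∑ _d : Fin D, (1 : ℝ) + ∑ _k : Fin K, (1 : ℝ) :=
          add_le_add (Finset.sum_le_sum fun d _ => h _ (hεγ d))
            (Finset.sum_le_sum fun k _ => h _ (hεβ k))
      _ = _ := by simp
  rcases Nat.lt_or_ge K 2 with hK | hK
  -- One topic: the complexity may be far below `D`, so summing one statistic per document is too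
  -- costly. All documents have the same word distribution, and the pooled sample needs a single
  -- Pearson statistic.
  · obtain rfl : K = 1 := by have := NeZero.ne K; omega
    have hword : ∀ θ : Param D 1 V, IsParam θ → ∀ d, wordProb θ d = θ.2 0 := by
      intro θ hθ d
      have h1 : θ.1 d 0 = 1 := by simpa using (hθ.1 d).2
      funext v
      simp [wordProb, h1]
    refine ⟨({Y | N * r ≤ chiSq (θs.2 0) (pooledWords Y)} ∪
      {Y | pooledWords Y ∈ rareSet (θs.2 0) (Fin N × Fin D)})ᶜ, ?_, ?_⟩
    · rw [compl_compl]
      refine (measureReal_pooled_le (hS.simplex_β 0) (hword θs hθs) hD hN hδ2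
        (fun v hv => ?_) hr1 (by simpa using hrDK)).trans ?_
      · rw [← hword θs hθs 0] at hv ⊢
        exact hlow 0 v hv
      · exact div_le_div_of_nonneg_right (by linarith) hNr.le
    · intro Y hY hlik α hα hα1 θ hθ
      simp only [Set.mem_compl_iff, Set.mem_union, Set.mem_ofPred_eq, not_or, not_le] at hY
      have h := log_lik_ratio_le_pooled hα hθs hθ (hword θ hθ.isParam) (hword θs hθs) hlik hY.2
      have h1 := mul_le_mul_of_nonneg_left hY.1.le (by positivity : 0 ≤ 2 * α)
      have h2 : 0 ≤ α * (N * r) := by positivity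
      have h3 : 0 ≤ (c₁ + (c₁ + c₂) / Real.log 2) * (α * (N * r)) := by positivity
      have h4 : 0 ≤ (2 + c₁ + (c₁ + c₂) / Real.log 2) * complexity e s V εγ εβ := by positivity
      linarith
  rcases Nat.lt_or_ge V 2 with hV | hV
  -- One word: every likelihood and every affinity equals one, so no event has to be excluded.
  · obtain rfl : V = 1 := by have := NeZero.ne V; omega
    refine ⟨Set.univ, ?_, ?_⟩
    · rw [Set.compl_univ, measureReal_empty]
      positivity
    · intro Y _ _ α hα _ θ hθ
      have hone : ∀ θ : Param D K 1, IsParam θ → ∀ d v, wordProb θ d v = 1 := by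
        intro θ hθ d v
        have := (hθ.wordProb_mem d).2
        rw [Fin.sum_univ_one] at this
        rwa [Subsingleton.elim v 0]
      have h1 := hone θ hθ.isParam
      have h2 := hone θs hθs
      simp only [lik_eq_prod, h1, h2, affinity, Finset.prod_const_one, Real.log_one,
        Real.one_rpow, mul_one, Finset.sum_const, Finset.card_univ, Fintype.card_fin, one_smul,
        smul_zero, sub_zero, mul_zero]
      positivity
  · refine ⟨({Y | 24 / (δ ^ 2) ^ 2 * max (N * r) D ≤
        ∑ d, chiSq (wordProb θs d) (docWords Y d)} ∪
      {Y | 112 / (δ ^ 2) ^ 2 * (D + K) ≤ ∑ d, (rareSet (wordProb θs d) (Fin N)).indicator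
        (fun _ => (N : ℝ)) (docWords Y d)})ᶜ, ?_, ?_⟩
    · rw [compl_compl]
      refine (measureReal_docs_le hθs hD hN hδ2 hlow hr0 hrDK).trans ?_
      gcongr
      linarith
    · intro Y hY hlik α hα hα1 θ hθ
      simp only [Set.mem_compl_iff, Set.mem_union, Set.mem_ofPred_eq, not_or, not_le] at hY
      have h := log_lik_ratio_le_sum_docs hα hα1 hδ2 hθs hlow hθ hlik
      have hcg := complexity_ge hS hεγ hεβ hK hV
      have hD0 : (0 : ℝ) ≤ D := Nat.cast_nonneg D
      have hK0 : (0 : ℝ) ≤ K := Nat.cast_nonneg K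
      have hmax : max (N * r) (D : ℝ) ≤ N * r + D :=
        max_le (by linarith) (by linarith)
      have h1 : 2 * α * ∑ d, chiSq (wordProb θs d) (docWords Y d) ≤
          c₁ * (α * (N * r)) + c₁ * (D + K) := by
        calc _ ≤ 2 * α * (24 / (δ ^ 2) ^ 2 * (N * r + D)) := by
              refine mul_le_mul_of_nonneg_left (hY.1.le.trans ?_) (by positivity)
              gcongr
          _ = c₁ * (α * (N * r)) + c₁ * (α * D) := by rw [hc₁]; ring
          _ ≤ _ := by
              gcongr
              nlinarith
      have h2 : -Real.log (δ ^ 2) * ∑ d, (rareSet (wordProb θs d) (Fin N)).indicator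
          (fun _ => (N : ℝ)) (docWords Y d) ≤ c₂ * (D + K) := by
        have h0 : 0 ≤ ∑ d, (rareSet (wordProb θs d) (Fin N)).indicator
            (fun _ => (N : ℝ)) (docWords Y d) :=
          Finset.sum_nonneg fun d _ => Set.indicator_nonneg (fun _ _ => hN'.le) _
        calc _ ≤ |Real.log (δ ^ 2)| * (112 / (δ ^ 2) ^ 2 * (D + K)) :=
              mul_le_mul (neg_le_abs _) hY.2.le h0 (abs_nonneg _)
          _ = _ := by rw [hc₂]; ring
      -- The fluctuations of order `D + K` are charged to the complexity.
      have h3 : (c₁ + c₂) * ((D : ℝ) + K) ≤ (c₁ + c₂) / Real.log 2 * complexity e s V εγ εβ := by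
        rw [div_mul_eq_mul_div, le_div_iff₀ hl2]
        have := mul_le_mul_of_nonneg_left hcg (by positivity : 0 ≤ c₁ + c₂)
        linarith
      have h4 : 0 ≤ (2 + (c₁ + c₂) / Real.log 2) * (α * (N * r)) := by positivity
      have h5 : 0 ≤ (2 + c₁) * complexity e s V εγ εβ := by positivity
      linarith

/-- Affinities tensorise over the independent documents, so the Rényi divergence of an observation
is a sum over documents. -/
theorem sum_obsPMF_rpow {α : ℝ} {θ θs : Param D K V} (hθ : IsParam θ) (hθs : IsParam θs) :
    ∑ y, obsPMF θ y ^ α * obsPMF θs y ^ (1 - α) =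
      ∏ d, affinity α (wordProb θ d) (wordProb θs d) := by
  simp_rw [affinity]
  rw [← sum_prod_apply fun d v => wordProb θ d v ^ α * wordProb θs d v ^ (1 - α)]
  refine Finset.sum_congr rfl fun y _ => ?_
  rw [obsPMF_eq_prod, obsPMF_eq_prod, Finset.prod_mul_distrib,
    Real.finsetProd_rpow _ _ fun d _ => (hθ.wordProb_mem d).1 _,
    Real.finsetProd_rpow _ _ fun d _ => (hθs.wordProb_mem d).1 _]

theorem renyiDiv_obsPMF [NeZero K] {α : ℝ} {θ θs : Param D K V} (hθ : IsPosParam θ)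
    (hθs : IsParam θs) :
    renyiDiv α (obsPMF θ) (obsPMF θs) = ENNReal.ofReal
      ((-∑ d, Real.log (affinity α (wordProb θ d) (wordProb θs d))) / (1 - α)) := by
  have hA := fun d => affinity_pos (α := α) (hθ.wordProb_pos d) (hθs.wordProb_mem d)
  rw [renyiDiv, sum_obsPMF_rpow hθ.isParam hθs,
    if_neg (Finset.prod_pos fun d _ => hA d).not_ge, Real.log_prod fun d _ => (hA d).ne']
  congr 1
  rw [← neg_sub α 1, div_neg, neg_div, neg_neg]
  ring

/-- From the likelihood ratio and the objective to the risk. -/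
theorem lintegral_renyiDiv_le [NeZero K] [NeZero V] {c α : ℝ} (hα : 0 < α) (hα1 : α < 1)
    (hD : 0 < D) (hN : 0 < N) {θs : Param D K V} (hθs : IsParam θs) {Y : Words D V N}
    {q : MeanField c D K V N} {U W : ℝ} (hU : 0 ≤ U) (hW : 0 ≤ W)
    (hneg : ∫⁻ θ, negLogLik Y θ ∂q.qθ ≤ ENNReal.ofReal (-Real.log (lik θs Y) + U))
    (hratio : ∀ θ : Param D K V, IsPosParam θ → α * (Real.log (lik θ Y) - Real.log (lik θs Y))
        - N / 2 * ∑ d, Real.log (affinity α (wordProb θ d) (wordProb θs d)) ≤ W) :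
    ∫⁻ θ, (D : ℝ≥0∞)⁻¹ * renyiDiv α (obsPMF θ) (obsPMF θs) ∂q.qθ ≤
      ENNReal.ofReal (2 * (α * U + W) / (D * N * (1 - α))) := by
  have hD' : (0 : ℝ) < D := by exact_mod_cast hD
  have hN' : (0 : ℝ) < N := by exact_mod_cast hN
  have hα1' : 0 < 1 - α := by linarith
  set L := -Real.log (lik θs Y) with hL
  have hL0 : 0 ≤ L := by
    have := Real.log_nonpos (hθs.lik_nonneg Y) (hθs.lik_le_one Y)
    linarith
  set κ : ℝ := D * N * (1 - α) / 2 with hκ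
  have hκ0 : 0 < κ := by positivity
  set I := ∫⁻ θ, (D : ℝ≥0∞)⁻¹ * renyiDiv α (obsPMF θ) (obsPMF θs) ∂q.qθ with hI
  -- The constant `α L` is placed on the left so that all terms are nonnegative and the comparison
  -- can be integrated in `ℝ≥0∞`; it is cancelled afterwards, being finite. The value of `κ` turns
  -- the normalised divergence into `N/2` times the negative log affinities.
  have hpt : ∀ᵐ θ ∂q.qθ, ENNReal.ofReal κ * ((D : ℝ≥0∞)⁻¹ *
      renyiDiv α (obsPMF θ) (obsPMF θs)) + ENNReal.ofReal (α * L) ≤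
      ENNReal.ofReal α * negLogLik Y θ + ENNReal.ofReal W := by
    filter_upwards [q.ae_isPosParam] with θ hθ
    have hlog : Real.log (lik θ Y) ≤ 0 :=
      Real.log_nonpos (hθ.isParam.lik_nonneg Y) (hθ.isParam.lik_le_one Y)
    have hφ : 0 ≤ -∑ d, Real.log (affinity α (wordProb θ d) (wordProb θs d)) := by
      rw [← Finset.sum_neg_distrib]
      refine Finset.sum_nonneg fun d _ => neg_nonneg.2 (Real.log_nonpos ?_ ?_)
      · exact (affinity_pos (hθ.wordProb_pos d) (hθs.wordProb_mem d)).le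
      · exact affinity_le_one hα.le hα1.le (hθ.isParam.wordProb_mem d) (hθs.wordProb_mem d)
    rw [renyiDiv_obsPMF hθ hθs, negLogLik_eq (hθ.lik_pos Y), ← ENNReal.ofReal_natCast D,
      ← ENNReal.ofReal_inv_of_pos hD', ← ENNReal.ofReal_mul (by positivity),
      ← ENNReal.ofReal_mul hκ0.le, ← ENNReal.ofReal_mul hα.le,
      ← ENNReal.ofReal_add (by positivity) (by positivity),
      ← ENNReal.ofReal_add (mul_nonneg hα.le (by linarith)) hW]
    refine ENNReal.ofReal_le_ofReal ?_
    have h1 : κ * ((D : ℝ)⁻¹ * ((-∑ d, Real.log (affinity α (wordProb θ d) (wordProb θs d)))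
        / (1 - α))) = -(N / 2 * ∑ d, Real.log (affinity α (wordProb θ d) (wordProb θs d))) := by
      rw [hκ]
      field_simp
    rw [h1, hL]
    linarith [hratio θ hθ]
  have hint := lintegral_mono_ae hpt
  rw [lintegral_add_right _ measurable_const, lintegral_add_right _ measurable_const,
    lintegral_const_mul' _ _ ENNReal.ofReal_ne_top, lintegral_const_mul' _ _ ENNReal.ofReal_ne_top,
    lintegral_const, lintegral_const, measure_univ, mul_one, mul_one, ← hI] at hint
  have h2 : ENNReal.ofReal κ * I + ENNReal.ofReal (α * L) ≤
      ENNReal.ofReal (α * U + W) + ENNReal.ofReal (α * L) := by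
    refine hint.trans ?_
    calc _ ≤ ENNReal.ofReal α * ENNReal.ofReal (L + U) + ENNReal.ofReal W := by gcongr
      _ = _ := by
          rw [← ENNReal.ofReal_mul hα.le, ← ENNReal.ofReal_add (by positivity) hW,
            ← ENNReal.ofReal_add (by positivity) (by positivity)]
          congr 1
          ring
  have h3 := (ENNReal.add_le_add_iff_right ENNReal.ofReal_ne_top).1 h2
  have h4 : 2 * (α * U + W) / (D * N * (1 - α)) = (α * U + W) / κ := by
    rw [hκ]
    field_simp
  rw [h4, ENNReal.ofReal_div_of_pos hκ0, ENNReal.le_div_iff_mul_le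
    (Or.inl (ENNReal.ofReal_pos.2 hκ0).ne') (Or.inl ENNReal.ofReal_ne_top), mul_comm]
  exact h3

/-- The risk bound for the Rényi divergence. -/
theorem exists_renyi_risk_le (c δ : ℝ) (hc : 1 < c) (hδ : 0 < δ) :
    ∃ A C : ℝ, 0 < A ∧ 0 < C ∧ ∀ α : ℝ, 0 < α → α < 1 → ∀ (D K V N : ℕ), 0 < D → 0 < N →
      ∀ (θs : Param D K V) (e : Fin D → ℕ) (s : Fin K → ℕ), AssumptionS δ θs e s →
      ∀ (εγ : Fin D → ℝ) (εβ : Fin K → ℝ), (∀ d, 0 < εγ d ∧ εγ d < 1) →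
      (∀ k, 0 < εβ k ∧ εβ k < 1) →
      1 - C / (N * (∑ d, εγ d ^ 2 + ∑ k, εβ k ^ 2)) ≤
        (dataLaw N θs).real {Y | ∀ q : MeanField c D K V N, IsAlphaVB α θs Y q →
          ∫⁻ θ, (D : ℝ≥0∞)⁻¹ * renyiDiv α (obsPMF θ) (obsPMF θs) ∂q.qθ ≤
            ENNReal.ofReal (A * (α * (N * (∑ d, εγ d ^ 2 + ∑ k, εβ k ^ 2))
              + complexity e s V εγ εβ) / (D * N * (1 - α)))} := by
  obtain ⟨B, hB, hneg⟩ := exists_lintegral_negLogLik_le c δ hc hδ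
  obtain ⟨A, C, hA, hC, hratio⟩ := exists_log_lik_ratio_le δ hδ
  refine ⟨2 * (2 + B + A), 1 + C, by positivity, by positivity,
    fun α hα hα1 D K V N hD hN θs e s hS εγ εβ hεγ hεβ => ?_⟩
  have := hS.neZero_K hD
  have := hS.neZero_V hD
  have := isProbabilityMeasure_dataLaw (N := N) hS.isParam
  have hD' : (0 : ℝ) < D := by exact_mod_cast hD
  have hN' : (0 : ℝ) < N := by exact_mod_cast hN
  set r := ∑ d, εγ d ^ 2 + ∑ k, εβ k ^ 2 with hr
  have hr0 : 0 < r := by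
    have h1 : 0 < ∑ d, εγ d ^ 2 := Finset.sum_pos (fun d _ => pow_pos (hεγ d).1 2)
      ⟨⟨0, hD⟩, Finset.mem_univ _⟩
    have h2 : 0 ≤ ∑ k, εβ k ^ 2 := Finset.sum_nonneg fun k _ => sq_nonneg _
    linarith
  have hNr : 0 < N * r := by positivity
  -- If `N r < 1`, the summand `1` in the probability constant `1 + C` makes the claimed probability
  -- nonpositive.
  rcases lt_or_ge ((N : ℝ) * r) 1 with h1 | h1
  · refine le_trans ?_ measureReal_nonneg
    rw [sub_nonpos, le_div_iff₀ hNr]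
    linarith
  obtain ⟨G, hG, hGr⟩ := hratio D K V N hD hN θs e s hS εγ εβ hεγ hεβ h1
  have hcx := complexity_nonneg (V := V) e s hεγ hεβ
  have hGprob : 1 - (1 + C) / (N * r) ≤ (dataLaw N θs).real G := by
    have h2 := probReal_compl_eq_one_sub (μ := dataLaw N θs) (Set.toFinite G).measurableSet
    have h3 : C / (N * r) ≤ (1 + C) / (N * r) := by gcongr; linarith
    linarith
  refine hGprob.trans ?_
  have hsub : G ≤ᵐ[dataLaw N θs] {Y | ∀ q : MeanField c D K V N, IsAlphaVB α θs Y q →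
      ∫⁻ θ, (D : ℝ≥0∞)⁻¹ * renyiDiv α (obsPMF θ) (obsPMF θs) ∂q.qθ ≤
        ENNReal.ofReal (2 * (2 + B + A) * (α * (N * r)
          + complexity e s V εγ εβ) / (D * N * (1 - α)))} := by
    filter_upwards [ae_lik_pos θs] with Y hY hYG q hq
    have h2 := hneg α hα D K V N hD hN θs e s hS εγ εβ hεγ hεβ Y hY q hq
    rw [add_assoc] at h2
    have h3 := lintegral_renyiDiv_le hα hα1 hD hN hS.isParam (by positivity) (by positivity) h2
      (hGr Y hYG hY α hα hα1)
    refine h3.trans (ENNReal.ofReal_le_ofReal ?_)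
    refine div_le_div_of_nonneg_right ?_ (mul_nonneg (by positivity) (by linarith))
    have h4 : α * (2 * N * r + α⁻¹ * (B * complexity e s V εγ εβ)) =
        2 * (α * (N * r)) + B * complexity e s V εγ εβ := by
      field_simp
    rw [h4]
    have h5 : 0 ≤ B * (α * (N * r)) := by positivity
    linarith
  exact ENNReal.toReal_mono (measure_ne_top _ _) (measure_mono_ae hsub)

theorem obsPMF_mem {θ : Param D K V} (hθ : IsParam θ) :
    obsPMF θ ∈ stdSimplex ℝ (Fin D → Fin V) := by
  refine ⟨fun y => Finset.prod_nonneg fun d _ => (hθ.wordProb_mem d).1 _, ?_⟩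
  simp_rw [obsPMF_eq_prod]
  rw [sum_prod_apply fun d v => wordProb θ d v]
  exact Finset.prod_eq_one fun d _ => (hθ.wordProb_mem d).2

/-- For `a ≤ 1/2`, `x^a y^(1-a)` is the weighted geometric mean of `√x √y` (weight `2a`) and `y`.
Summing AM–GM compares the affinity with the Bhattacharyya coefficient; exchanging the two
distributions covers `α ≥ 1/2`. -/
theorem min_mul_hellingerSq_le {ι : Type*} [Fintype ι] {p q : ι → ℝ} (hp : p ∈ stdSimplex ℝ ι)
    (hq : q ∈ stdSimplex ℝ ι) {α : ℝ} (hα : 0 < α) (hα1 : α < 1) :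
    min α (1 - α) * hellingerSq p q ≤ 1 - ∑ i, p i ^ α * q i ^ (1 - α) := by
  have hh : hellingerSq p q = ∑ i, p i + ∑ i, q i - 2 * ∑ i, Real.sqrt (p i) * Real.sqrt (q i) := by
    rw [hellingerSq, Finset.mul_sum, ← Finset.sum_add_distrib, ← Finset.sum_sub_distrib]
    refine Finset.sum_congr rfl fun i _ => ?_
    rw [sub_sq, Real.sq_sqrt (hp.1 i), Real.sq_sqrt (hq.1 i)]
    ring
  have hterm : ∀ x y a : ℝ, 0 ≤ x → 0 ≤ y → 0 < a → a ≤ 1 / 2 →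
      x ^ a * y ^ (1 - a) ≤ 2 * a * (Real.sqrt x * Real.sqrt y) + (1 - 2 * a) * y := by
    intro x y a hx hy ha ha2
    have h := Real.geom_mean_le_arith_mean2_weighted (w₁ := 2 * a) (w₂ := 1 - 2 * a)
      (p₁ := Real.sqrt x * Real.sqrt y) (p₂ := y) (by linarith) (by linarith) (by positivity) hy
      (by ring)
    refine le_trans (le_of_eq ?_) h
    rw [Real.mul_rpow (Real.sqrt_nonneg _) (Real.sqrt_nonneg _), Real.sqrt_eq_rpow,
      Real.sqrt_eq_rpow, ← Real.rpow_mul hx, ← Real.rpow_mul hy, mul_assoc,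
      show 1 / 2 * (2 * a) = a by ring,
      ← Real.rpow_add_of_nonneg hy ha.le (by linarith)]
    congr 2
    ring
  rw [hh, hp.2, hq.2]
  rcases le_total α (1 / 2) with h | h
  · rw [min_eq_left (by linarith)]
    have hs := Finset.sum_le_sum fun i (_ : i ∈ Finset.univ) =>
      hterm (p i) (q i) α (hp.1 i) (hq.1 i) hα h
    rw [Finset.sum_add_distrib, ← Finset.mul_sum, ← Finset.mul_sum, hq.2] at hs
    linarith
  · rw [min_eq_right (by linarith)]
    have hs := Finset.sum_le_sum fun i (_ : i ∈ Finset.univ) =>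
      hterm (q i) (p i) (1 - α) (hq.1 i) (hp.1 i) (by linarith) (by linarith)
    rw [Finset.sum_add_distrib, ← Finset.mul_sum, ← Finset.mul_sum, hp.2] at hs
    simp only [sub_sub_cancel] at hs
    have e1 : ∑ i, q i ^ (1 - α) * p i ^ α = ∑ i, p i ^ α * q i ^ (1 - α) :=
      Finset.sum_congr rfl fun i _ => mul_comm _ _
    have e2 : ∑ i, Real.sqrt (q i) * Real.sqrt (p i) = ∑ i, Real.sqrt (p i) * Real.sqrt (q i) :=
      Finset.sum_congr rfl fun i _ => mul_comm _ _
    rw [e1, e2] at hs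
    linarith

theorem ofReal_hellingerSq_le_renyiDiv {ι : Type*} [Fintype ι] {p q : ι → ℝ}
    (hp : p ∈ stdSimplex ℝ ι) (hq : q ∈ stdSimplex ℝ ι) {α : ℝ} (hα : 0 < α) (hα1 : α < 1) :
    ENNReal.ofReal (hellingerSq p q) ≤
      ENNReal.ofReal ((1 - α) / min α (1 - α)) * renyiDiv α p q := by
  have hm : 0 < min α (1 - α) := lt_min hα (by linarith)
  have hα1' : 0 < 1 - α := by linarith
  have hκ : 0 < (1 - α) / min α (1 - α) := div_pos hα1' hm
  rw [renyiDiv]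
  split_ifs with h
  · rw [ENNReal.mul_top (ENNReal.ofReal_pos.2 hκ).ne']
    exact le_top
  · rw [← ENNReal.ofReal_mul hκ.le]
    refine ENNReal.ofReal_le_ofReal ?_
    have h1 := min_mul_hellingerSq_le hp hq hα hα1
    have h2 := Real.log_le_sub_one_of_pos (not_le.1 h)
    have h3 : (1 - α) / min α (1 - α) * (1 / (α - 1) *
        Real.log (∑ i, p i ^ α * q i ^ (1 - α))) =
        -Real.log (∑ i, p i ^ α * q i ^ (1 - α)) / min α (1 - α) := by
      have : α - 1 ≠ 0 := by linarith
      field_simp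
      ring
    rw [h3, le_div_iff₀ hm]
    linarith

/-- From the Rényi risk to the Hellinger risk. -/
theorem lintegral_hellingerSq_rpow_le [NeZero K] [NeZero V] {c α : ℝ} (hα : 0 < α) (hα1 : α < 1)
    (hD : 0 < D) {θs : Param D K V} (hθs : IsParam θs) {q : MeanField c D K V N} {R : ℝ}
    (h : ∫⁻ θ, (D : ℝ≥0∞)⁻¹ * renyiDiv α (obsPMF θ) (obsPMF θs) ∂q.qθ ≤ ENNReal.ofReal R) :
    (∫⁻ θ, ENNReal.ofReal ((D : ℝ)⁻¹ * hellingerSq (obsPMF θ) (obsPMF θs)) ∂q.qθ) ^ (1 / 2 : ℝ) ≤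
      ENNReal.ofReal (Real.sqrt ((1 - α) / min α (1 - α) * R)) := by
  have hD' : (0 : ℝ) < D := by exact_mod_cast hD
  have hm : 0 < min α (1 - α) := lt_min hα (by linarith)
  have hκ : 0 < (1 - α) / min α (1 - α) := div_pos (by linarith) hm
  have h1 : ∫⁻ θ, ENNReal.ofReal ((D : ℝ)⁻¹ * hellingerSq (obsPMF θ) (obsPMF θs)) ∂q.qθ ≤
      ENNReal.ofReal ((1 - α) / min α (1 - α) * R) := by
    calc _ ≤ ∫⁻ θ, ENNReal.ofReal ((1 - α) / min α (1 - α)) *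
          ((D : ℝ≥0∞)⁻¹ * renyiDiv α (obsPMF θ) (obsPMF θs)) ∂q.qθ := by
          refine lintegral_mono_ae ?_
          filter_upwards [q.ae_isPosParam] with θ hθ
          rw [ENNReal.ofReal_mul (by positivity), ENNReal.ofReal_inv_of_pos hD',
            ENNReal.ofReal_natCast, mul_left_comm]
          gcongr
          exact ofReal_hellingerSq_le_renyiDiv (obsPMF_mem hθ.isParam) (obsPMF_mem hθs) hα hα1
      _ ≤ _ := by
          rw [lintegral_const_mul' _ _ ENNReal.ofReal_ne_top, ENNReal.ofReal_mul hκ.le]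
          gcongr
  rcases le_or_gt 0 ((1 - α) / min α (1 - α) * R) with h0 | h0
  · rw [Real.sqrt_eq_rpow, ← ENNReal.ofReal_rpow_of_nonneg h0 (by norm_num)]
    exact ENNReal.rpow_le_rpow h1 (by norm_num)
  · rw [ENNReal.ofReal_of_nonpos h0.le, nonpos_iff_eq_zero] at h1
    rw [h1, ENNReal.zero_rpow_of_pos (by norm_num)]
    exact zero_le

/-- The radius `√(log N / N)`. -/
theorem radius_bounds {N : ℕ} (hN : 2 ≤ N) :
    0 < Real.sqrt (Real.log N / N) ∧ Real.sqrt (Real.log N / N) < 1 ∧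
      N * Real.sqrt (Real.log N / N) ^ 2 = Real.log N ∧
      -Real.log (Real.sqrt (Real.log N / N)) ≤ 2 * Real.log N := by
  have hN2 : (2 : ℝ) ≤ N := by exact_mod_cast hN
  have hN0 : (0 : ℝ) < N := by linarith
  have hlog : 1 / 2 ≤ Real.log N := by
    have := Real.log_le_log two_pos hN2
    linarith [Real.log_two_gt_d9]
  have hlogN : Real.log N < N := by linarith [Real.log_le_sub_one_of_pos hN0]
  have hx : 0 < Real.log N / N := by positivity
  refine ⟨Real.sqrt_pos.2 hx, ?_, ?_, ?_⟩
  · rw [Real.sqrt_lt' one_pos, one_pow, div_lt_one hN0]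
    exact hlogN
  · rw [Real.sq_sqrt hx.le]
    field_simp
  · rw [Real.log_sqrt hx.le, Real.log_div (by positivity) hN0.ne']
    -- From `log N ≥ 1/2 ≥ 1/N`, valid for `N ≥ 2`.
    have h1 : -Real.log N ≤ Real.log (Real.log N) := by
      rw [← Real.log_inv]
      refine Real.log_le_log (by positivity) (le_trans ?_ hlog)
      rw [one_div]
      exact inv_anti₀ two_pos hN2
    linarith

/-- The squared radii contribute one `log N` per document and per topic, absorbed since all
sparsities are at least one, and the radius logarithms at most two more: hence the factor `3`. -/
theorem risk_at_radius_le {δ : ℝ} {θs : Param D K V} {e : Fin D → ℕ} {s : Fin K → ℕ}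
    (hS : AssumptionS δ θs e s) (hD : 0 < D) (hN : 2 ≤ N) {α : ℝ} (hα : 0 < α) (hα1 : α < 1) :
    α * (N * (∑ _d : Fin D, Real.sqrt (Real.log N / N) ^ 2
        + ∑ _k : Fin K, Real.sqrt (Real.log N / N) ^ 2))
      + complexity e s V (fun _ => Real.sqrt (Real.log N / N))
        (fun _ => Real.sqrt (Real.log N / N)) ≤
    3 * ((∑ d, (e d : ℝ)) * Real.log (D * K * N) + (∑ k, (s k : ℝ)) * Real.log (K * V * N)) := by
  obtain ⟨h0, -, hsq, hlog⟩ := radius_bounds hN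
  set ε := Real.sqrt (Real.log N / N) with hε
  have hN2 : (2 : ℝ) ≤ N := by exact_mod_cast hN
  have hD1 : (1 : ℝ) ≤ D := by exact_mod_cast hD
  have hK0 := hS.neZero_K hD
  have hV0 := hS.neZero_V hD
  have hK1 : (1 : ℝ) ≤ K := by exact_mod_cast Nat.one_le_iff_ne_zero.2 (NeZero.ne K)
  have hV1 : (1 : ℝ) ≤ V := by exact_mod_cast Nat.one_le_iff_ne_zero.2 (NeZero.ne V)
  have hlD := Real.log_nonneg hD1
  have hlK := Real.log_nonneg hK1
  have hlV := Real.log_nonneg hV1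
  have hlN : 0 < Real.log N := Real.log_pos (by linarith)
  rw [Real.log_mul (by positivity) (by positivity), Real.log_mul (by positivity) (by positivity),
    Real.log_mul (by positivity) (by positivity), Real.log_mul (by positivity) (by positivity)]
  have he : ∀ d, (1 : ℝ) ≤ e d := fun d => by
    exact_mod_cast (one_le_ncard_support (hS.simplex_γ d)).trans (hS.sparse_γ d)
  have hs : ∀ k, (1 : ℝ) ≤ s k := fun k => by
    exact_mod_cast (one_le_ncard_support (hS.simplex_β k)).trans (hS.sparse_β k)
  have h1 : α * (N * (∑ _d : Fin D, ε ^ 2 + ∑ _k : Fin K, ε ^ 2)) ≤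
      ∑ d, e d * Real.log N + ∑ k, s k * Real.log N := by
    calc α * (N * (∑ _d : Fin D, ε ^ 2 + ∑ _k : Fin K, ε ^ 2))
        ≤ 1 * (N * (∑ _d : Fin D, ε ^ 2 + ∑ _k : Fin K, ε ^ 2)) := by gcongr
      _ = ∑ _d : Fin D, 1 * Real.log N + ∑ _k : Fin K, 1 * Real.log N := by
          rw [one_mul, mul_add, Finset.mul_sum, Finset.mul_sum, hsq]
          simp_rw [one_mul]
      _ ≤ _ := by gcongr with d _ k _ <;> simp [he, hs]
  have h2 : complexity e s V (fun _ => ε) (fun _ => ε) ≤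
      ∑ d, e d * (Real.log K + 2 * Real.log N) + ∑ k, s k * (Real.log V + 2 * Real.log N) := by
    rw [complexity]
    gcongr
    · rw [Real.log_div (by positivity) h0.ne']
      linarith
    · rw [Real.log_div (by positivity) h0.ne']
      linarith
  refine (add_le_add h1 h2).trans ?_
  simp_rw [← Finset.sum_mul]
  have hse : 0 ≤ ∑ d, (e d : ℝ) := Finset.sum_nonneg fun d _ => Nat.cast_nonneg _
  have hss : 0 ≤ ∑ k, (s k : ℝ) := Finset.sum_nonneg fun k _ => Nat.cast_nonneg _
  have i1 := mul_nonneg hse hlD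
  have i2 := mul_nonneg hse hlK
  have i3 := mul_nonneg hss hlK
  have i4 := mul_nonneg hss hlV
  linarith

end Risk
end LDA

/-! ### Assembly of the two claims -/

theorem mainTheorem11 (c δ₀ : ℝ) (hc : 1 < c) (hδ : 0 < δ₀) :
    ∃ A C : ℝ, 0 < A ∧ 0 < C ∧
      (∀ α : ℝ, 0 < α → α < 1 →
        ∀ (D K V N : ℕ), 0 < D → 0 < N →
        ∀ (θs : LDA.Param D K V) (e : Fin D → ℕ) (s : Fin K → ℕ), LDA.AssumptionS δ₀ θs e s →
        ∀ (εγ : Fin D → ℝ) (εβ : Fin K → ℝ),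
          (∀ d, 0 < εγ d ∧ εγ d < 1) → (∀ k, 0 < εβ k ∧ εβ k < 1) →
          1 - C / (N * ∑ d, εγ d ^ 2 + N * ∑ k, εβ k ^ 2) ≤
            (LDA.dataLaw N θs).real {Y | ∀ q : LDA.MeanField c D K V N, LDA.IsAlphaVB α θs Y q →
              ∫⁻ θ, (D : ℝ≥0∞)⁻¹ * LDA.renyiDiv α (LDA.obsPMF θ) (LDA.obsPMF θs) ∂q.qθ ≤
                ENNReal.ofReal (A *
                  (α / (1 - α) * (1 / D * ∑ d, εγ d ^ 2 + 1 / D * ∑ k, εβ k ^ 2)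
                    + 1 / (N * (1 - α)) *
                      (1 / D * ∑ d, e d * Real.log (K / εγ d)
                        + 1 / D * ∑ k, s k * Real.log (V / εβ k))))}) ∧
      (∀ α : ℝ, 0 < α → α < 1 →
        ∀ (D K V : ℕ → ℕ), (∀ N, 0 < D N) →
        ∀ (θs : ∀ N, LDA.Param (D N) (K N) (V N)) (e : ∀ N, Fin (D N) → ℕ)
          (s : ∀ N, Fin (K N) → ℕ), (∀ N, LDA.AssumptionS δ₀ (θs N) (e N) (s N)) →
        Tendsto (fun N : ℕ => ((∑ d, (e N d : ℝ)) + ∑ k, (s N k : ℝ)) / (D N * N)) atTop (𝓝 0) →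
        Tendsto (fun N : ℕ =>
          (LDA.dataLaw N (θs N)).real
            {Y | ∀ q : LDA.MeanField c (D N) (K N) (V N) N, LDA.IsAlphaVB α (θs N) Y q →
              (∫⁻ θ, ENNReal.ofReal ((D N : ℝ)⁻¹ *
                  LDA.hellingerSq (LDA.obsPMF θ) (LDA.obsPMF (θs N))) ∂q.qθ) ^ (1 / 2 : ℝ) ≤
                ENNReal.ofReal (A * Real.sqrt
                  ((∑ d, (e N d : ℝ)) / (D N * N * min α (1 - α)) * Real.log (D N * K N * N)
                    + (∑ k, (s N k : ℝ)) / (D N * N * min α (1 - α)) *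
                      Real.log (K N * V N * N)))})
          atTop (𝓝 1)) := by
  obtain ⟨A, C, hA, hC, hrisk⟩ := LDA.exists_renyi_risk_le c δ₀ hc hδ
  -- One constant serves both claims: the first needs at least `A`, and the second needs `(A + 3)² ≥
  -- 3 A` once the constant is moved under the square root.
  refine ⟨A + 3, C, by positivity, hC, ?_, ?_⟩
  · intro α hα hα1 D K V N hD hN θs e s hS εγ εβ hεγ hεβ
    have := LDA.isProbabilityMeasure_dataLaw (N := N) hS.isParam
    have := hS.neZero_K hD
    have := hS.neZero_V hD
    have hD' : (0 : ℝ) < D := by exact_mod_cast hD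
    have hN' : (0 : ℝ) < N := by exact_mod_cast hN
    have hα1' : 0 < 1 - α := by linarith
    have h := hrisk α hα hα1 D K V N hD hN θs e s hS εγ εβ hεγ hεβ
    rw [mul_add] at h
    refine h.trans (measureReal_mono fun Y hY q hq => (hY q hq).trans ?_)
    refine ENNReal.ofReal_le_ofReal ?_
    have hcx := LDA.complexity_nonneg (V := V) e s hεγ hεβ
    have h0 : 0 ≤ (α * (N * (∑ d, εγ d ^ 2 + ∑ k, εβ k ^ 2)) + LDA.complexity e s V εγ εβ)
        / (D * N * (1 - α)) := by positivity
    calc _ ≤ (A + 3) * ((α * (N * (∑ d, εγ d ^ 2 + ∑ k, εβ k ^ 2))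
          + LDA.complexity e s V εγ εβ) / (D * N * (1 - α))) := by
          rw [← mul_add, mul_div_assoc]
          gcongr
          linarith
      _ = _ := by
          rw [LDA.complexity]
          field_simp
  · intro α hα hα1 D K V hD θs e s hS _
    have hlim : Tendsto (fun N : ℕ => 1 - C / Real.log N) atTop (𝓝 1) := by
      have : Tendsto (fun N : ℕ => C / Real.log N) atTop (𝓝 0) :=
        tendsto_const_nhds.div_atTop (Real.tendsto_log_atTop.comp tendsto_natCast_atTop_atTop)
      simpa using tendsto_const_nhds.sub this
    refine tendsto_of_tendsto_of_tendsto_of_le_of_le' hlim tendsto_const_nhds ?_ ?_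
    · filter_upwards [eventually_ge_atTop 2] with N hN
      have := LDA.isProbabilityMeasure_dataLaw (N := N) (hS N).isParam
      have := (hS N).neZero_K (hD N)
      have := (hS N).neZero_V (hD N)
      obtain ⟨hε0, hε1, hεsq, -⟩ := LDA.radius_bounds hN
      have hD1 : (1 : ℝ) ≤ D N := by exact_mod_cast hD N
      have hN2 : (2 : ℝ) ≤ N := by exact_mod_cast hN
      have hlN : 0 < Real.log N := Real.log_pos (by linarith)
      have hα1' : 0 < 1 - α := by linarith
      have hm : 0 < min α (1 - α) := lt_min hα hα1'
      have h := hrisk α hα hα1 (D N) (K N) (V N) N (hD N) (by omega) (θs N) (e N) (s N) (hS N)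
        (fun _ => Real.sqrt (Real.log N / N)) (fun _ => Real.sqrt (Real.log N / N))
        (fun _ => ⟨hε0, hε1⟩) fun _ => ⟨hε0, hε1⟩
      -- A single document already contributes `log N`, so the failure probability is at most `C /
      -- log N`.
      have hr : Real.log N ≤ N * (∑ _d : Fin (D N), Real.sqrt (Real.log N / N) ^ 2
          + ∑ _k : Fin (K N), Real.sqrt (Real.log N / N) ^ 2) := by
        rw [mul_add, Finset.mul_sum, Finset.mul_sum, hεsq]
        simp only [Finset.sum_const, Finset.card_univ, Fintype.card_fin, nsmul_eq_mul]
        have := mul_nonneg (Nat.cast_nonneg (α := ℝ) (K N)) hlN.le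
        have := mul_le_mul_of_nonneg_right hD1 hlN.le
        linarith
      have hprob : 1 - C / Real.log N ≤ 1 - C / (N * (∑ _d : Fin (D N),
          Real.sqrt (Real.log N / N) ^ 2 + ∑ _k : Fin (K N), Real.sqrt (Real.log N / N) ^ 2)) := by
        gcongr
      refine (hprob.trans h).trans (measureReal_mono fun Y hY q hq => ?_)
      refine (LDA.lintegral_hellingerSq_rpow_le hα hα1 (hD N) (hS N).isParam (hY q hq)).trans ?_
      refine ENNReal.ofReal_le_ofReal ?_
      rw [← Real.sqrt_sq (by positivity : 0 ≤ A + 3), ← Real.sqrt_mul (sq_nonneg _)]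
      refine Real.sqrt_le_sqrt ?_
      have hT := LDA.risk_at_radius_le (hS N) (hD N) hN hα hα1
      set T := (∑ d, (e N d : ℝ)) * Real.log (D N * K N * N)
        + (∑ k, (s N k : ℝ)) * Real.log (K N * V N * N) with hTdef
      have hT0 : 0 ≤ T := by
        have hcx := LDA.complexity_nonneg (V := V N) (e N) (s N)
          (εγ := fun _ => Real.sqrt (Real.log N / N)) (εβ := fun _ => Real.sqrt (Real.log N / N))
          (fun _ => ⟨hε0, hε1⟩) fun _ => ⟨hε0, hε1⟩
        have := mul_nonneg hα.le (hlN.le.trans hr)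
        linarith
      calc _ ≤ (1 - α) / min α (1 - α) * (A * (3 * T) / (D N * N * (1 - α))) := by gcongr
        _ = 3 * A * (T / (D N * N * min α (1 - α))) := by field_simp
        _ ≤ (A + 3) ^ 2 * (T / (D N * N * min α (1 - α))) := by
            gcongr
            nlinarith
        _ = _ := by rw [hTdef]; field_simp
    · exact Eventually.of_forall fun N => by
        have := LDA.isProbabilityMeasure_dataLaw (N := N) (hS N).isParam
        exact measureReal_le_one
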